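/- **Setting.** Let $m\ge1$ be the number of nodes and $n\ge0$, $p\ge1$ the dimensions. For $f_i,g_i:\mathbb R^n\times\mathbb R^p\to\mathbb R$, $i=1,\dots,m$, put $$\theta_i^*(x)=\arg\min_{\theta}g_i(x,\theta),\qquad \Phi(x)=\frac1m\sum_{i=1}^m f_i(x,\theta_i^*(x)).$$ *Network.* The nodes form a connected undirected graph (self-loops allowed), and $W=[w_{ij}]$ is symmetric and doubly stochastic with $w_{ij}>0$ if $(i,j)$ is an edge and $w_{ij}=0$ otherwise; $\rho:=\|W-\frac1m 1_m1_m^{\rm T}\|^2<1$ (spectral norm). *Functions.* Let $L_{f,x},L_{f,\theta},L_{g,\theta},L_{g,x\theta},L_{g,\theta\theta},C_{f,\theta},C_{g,x\theta},\mu_g>0$. For every $i$: $f_i$ is $C^1$; $\nabla_xf_i$ and $\nabla_\theta f_i$ are $L_{f,x}$- and $L_{f,\theta}$-Lipschitz in the pair $(x,\theta)$ (Euclidean norm on pairs); $\|\nabla_\theta f_i(x,\theta_i^*(x))\|\le C_{f,\theta}$ for all $x$; $g_i$ is $C^2$, $g_i(x,\cdot)$ is $\mu_g$-strongly convex and $\nabla_\theta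 g_i(x,\cdot)$ is $L_{g,\theta}$-Lipschitz for all $x$; $\nabla^2_{x\theta}g_i$ and $\nabla^2_{\theta\theta}g_i$ are $L_{g,x\theta}$- and $L_{g,\theta\theta}$-Lipschitz in $(x,\theta)$; $\|\nabla^2_{x\theta}g_i\|\le C_{g,x\theta}$. Moreover $\Phi$ is bounded below. Put $\kappa=\max\{L_{f,x},L_{f,\theta},L_{g,\theta},L_{g,x\theta},L_{g,\theta\theta}\}/\mu_g$. **Algorithm (LoPA-GT with exact derivatives).** For $k\ge0$ let $d_i^k=\nabla_\theta g_i(x_i^k,\theta_i^k)$, $h_i^k=\nabla^2_{\theta\theta}g_i(x_i^k,\theta_i^k)v_i^k-\nabla_\theta f_i(x_i^k,\theta_i^k)$, $s_i^k=\nabla_xf_i(x_i^k,\theta_i^k)-\nabla^2_{x\theta}g_i(x_i^k,\theta_i^k)v_i^k$, and $$\theta_i^{k+1}=\theta_i^k-\beta d_i^k,\quad v_i^{k+1}=v_i^k-\lambda h_i^k,\quad x_i^{k+1}=(1-\tau)x_i^k+\tau\Big(\sum_jw_{ij}x_j^k-\alpha y_i^k\Big),$$ $$z_i^{k+1}=s_i^k+(1-\gamma)(z_i^k-s_i^k),\qquad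 y_i^{k+1}=\sum_jw_{ij}y_j^k+z_i^{k+1}-z_i^k .$$ Let $\bar x^k=\frac1m\sum_ix_i^k$. The initialization satisfies $x_i^0=x_j^0$ for all $i,j$ and $y_i^0=z_i^0$, and for a constant $D>0$ the five quantities $\Phi(\bar x^0)-\inf\Phi$, $\frac1m\sum_i\|\theta_i^0-\theta_i^*(\bar x^0)\|^2$, $\frac1m\sum_i\|v_i^0\|^2$, $\frac1m\sum_i\|z_i^0\|^2$, $\frac1m\sum_i\|\nabla_xf_i(\bar x^0,\theta_i^*(\bar x^0))\|^2$ are at most $D$. **Derived constants.** $M=\frac{C_{f,\theta}}{\mu_g}$, $L_{\theta^*}=\frac{C_{g,x\theta}}{\mu_g}$, $L_v=\frac{L_{f,\theta}}{\mu_g}+\frac{C_{f,\theta}L_{g,\theta\theta}}{\mu_g^2}$, $L_{v^*}=L_v(1+L_{\theta^*})$, $L=(L_{f,x}+C_{g,x\theta}L_v+\frac{C_{f,\theta}L_{g,x\theta}}{\mu_g})(1+L_{\theta^*})$, $L_{fg,x}=2L_{f,x}^2+4M^2L_{g,x\theta}^2$, $L_{fg,\theta}=2L_{f,\theta}^2+4M^2L_{g,\theta\theta}^2$,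 $\omega_\theta=\frac{\mu_gL_{g,\theta}}{2(\mu_g+L_{g,\theta})}$, $P=L_{fg,x}+\frac{32C_{g,x\theta}^2L_{fg,\theta}}{\mu_g^2}$, $\varphi=P\Big(1+\frac{4\max\{L_{g,\theta},C_{g,x\theta}\}^2}{\omega_\theta^2}\Big)$, $$u_1'=\min\Big\{\tfrac1{2\tau L},\tfrac{(1-\rho)^2}{32\varphi^{1/2}(\tau L)^{1/2}}\Big\},\quad u_2'=(1-\rho)^{4/3}(\tau L)^{1/3}\min\Big\{\tfrac1{6\varphi^{1/3}},\tfrac{P^{1/3}}{4\varphi^{1/3}L_{fg,x}^{1/3}},\tfrac1{4L_{fg,x}^{1/3}}\Big\},$$ $$u_3'=\min\Big\{\tfrac{\min\{1,\,2\mu_g/(\mu_g+L_{g,\theta})\}}{96\tau L_{v^*}C_{g,x\theta}},\ \tfrac{\min\{\frac2{\mu_g+L_{g,\theta}},\frac{\mu_g+L_{g,\theta}}{2\mu_gL_{g,\theta}}\}\,\omega_\theta}{12\tau P^{1/2}L_{\theta^*}}\Big\},\qquad u'=\min\Big\{1,u_1',\tfrac{\min\{1,u_2'\}}{8\tau L},u_3'\Big\}.$$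 **Step-sizes.** $0<\tau<1$ with $t_1\kappa^{-4}\le\tau\le t_2\kappa^{-4}$ for fixed $t_1,t_2>0$; $0<\alpha\le u'$; and $\gamma=c_\gamma\alpha$, $\lambda=c_\lambda\alpha$, $\beta=c_\beta\alpha$ with $$\tfrac{48L_{v^*}C_{g,x\theta}}{\mu_g}\tau\le c_\lambda,\ \ \lambda<\min\{\tfrac1{\mu_g},\tfrac2{\mu_g+L_{g,\theta}}\};\qquad \tfrac{6L_{\theta^*}}{\omega_\theta}P^{1/2}\tau\le c_\beta,\ \ \beta<\min\{\tfrac2{\mu_g+L_{g,\theta}},\tfrac{\mu_g+L_{g,\theta}}{2\mu_gL_{g,\theta}}\};\qquad 4L\tau\le c_\gamma,\ \ \gamma<\min\{1,u_2'\}.$$ **Statement.** There is a constant $C>0$ depending only on $L_{f,x},L_{f,\theta},L_{g,\theta},L_{g,x\theta},L_{g,\theta\theta},C_{f,\theta},C_{g,x\theta},D,t_1,t_2$ (and not on $\mu_g$, $\kappa$, $\rho$, $W$, $m,n,p$, $f_i,g_i$, the initial point, $K$ or the step-sizes) such that, in the above setting, $\Phi$ is differentiable and for every $K\ge1$ $$\frac1{K+1}\sum_{k=0}^K\|\nabla\Phi(\bar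 x^k)\|^2\ \le\ C\,\frac{u'}{\alpha}\,\frac{\kappa^8}{(1-\rho)^2K}.$$ In particular the average is $O\big(\kappa^8/((1-\rho)^2K)\big)$ for $\alpha=u'$, and for every $\alpha\le u'$ that is at least a fixed fraction of $u'$. -/

import Mathlib

noncomputable section

namespace LoPA

/-- The Euclidean space `ℝ^d`. -/
abbrev E (d : ℕ) := EuclideanSpace ℝ (Fin d)

/-! ### Partial derivatives of a function of the pair `(x, θ)` -/

/-- Partial gradient `∇_x f (x, θ)`. -/
def gradX {n p : ℕ} (f : E n → E p → ℝ) (x : E n) (θ : E p) : E n :=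
  gradient (fun x' => f x' θ) x

/-- Partial gradient `∇_θ f (x, θ)`. -/
def gradTheta {n p : ℕ} (f : E n → E p → ℝ) (x : E n) (θ : E p) : E p :=
  gradient (fun θ' => f x θ') θ

/-- The Jacobian `∇²_{xθ} g (x, θ)`, the `n × p` matrix of the mixed derivatives
`∂²g / ∂x_a ∂θ_b`, as a linear map `ℝ^p → ℝ^n`. -/
def hessXTheta {n p : ℕ} (g : E n → E p → ℝ) (x : E n) (θ : E p) : E p →L[ℝ] E n :=
  fderiv ℝ (fun θ' => gradX g x θ') θ

/-- The Hessian `∇²_{θθ} g (x, θ)` as a linear map `ℝ^p → ℝ^p`. -/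
def hessThetaTheta {n p : ℕ} (g : E n → E p → ℝ) (x : E n) (θ : E p) : E p →L[ℝ] E p :=
  fderiv ℝ (fun θ' => gradTheta g x θ') θ

/-! ### The bilevel problem -/

/-- The inner solution `θ^*(x) = argmin_θ g (x, θ)`. -/
def innerSol {n p : ℕ} (g : E n → E p → ℝ) (x : E n) : E p :=
  Classical.epsilon fun θ => ∀ θ', g x θ ≤ g x θ'

/-- The overall objective `Φ(x) = (1/m) ∑ i, f_i (x, θ_i^*(x))`. -/
def objective {m n p : ℕ} (f g : Fin m → E n → E p → ℝ) (x : E n) : ℝ :=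
  (1 / (m : ℝ)) * ∑ i, f i x (innerSol (g i) x)

/-- The constants of the problem other than the strong convexity modulus. -/
structure Constants where
  Lfx : ℝ
  Lfθ : ℝ
  Lgθ : ℝ
  Lgxθ : ℝ
  Lgθθ : ℝ
  Cfθ : ℝ
  Cgxθ : ℝ

/-- All the constants are positive. -/
structure Constants.Pos (c : Constants) : Prop where
  Lfx : 0 < c.Lfx
  Lfθ : 0 < c.Lfθ
  Lgθ : 0 < c.Lgθ
  Lgxθ : 0 < c.Lgxθ
  Lgθθ : 0 < c.Lgθθ
  Cfθ : 0 < c.Cfθ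
  Cgxθ : 0 < c.Cgxθ

/-- Euclidean distance of the pairs `(x, θ)` and `(x', θ')`. -/
def pairDist {n p : ℕ} (x x' : E n) (θ θ' : E p) : ℝ :=
  Real.sqrt (‖x - x'‖ ^ 2 + ‖θ - θ'‖ ^ 2)

/-- Network assumption: a connected undirected graph with edge relation `edge` (self-loops are
allowed), and a symmetric doubly stochastic weight matrix supported exactly on the edges. -/
structure NetworkAssumption {m : ℕ} (edge : Fin m → Fin m → Prop)
    (W : Matrix (Fin m) (Fin m) ℝ) : Prop where
  connected : ∀ i j, Relation.ReflTransGen edge i j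
  symm : ∀ i j, W i j = W j i
  pos_iff : ∀ i j, 0 < W i j ↔ edge i j
  zero_of_not_edge : ∀ i j, ¬ edge i j → W i j = 0
  doubly_stochastic : W ∈ doublyStochastic ℝ (Fin m)

/-- `ρ = ‖W - (1/m) 1 1ᵀ‖²`, with the spectral norm. -/
def rho {m : ℕ} (W : Matrix (Fin m) (Fin m) ℝ) : ℝ :=
  ‖Matrix.toEuclideanCLM (n := Fin m) (𝕜 := ℝ) (W - Matrix.of fun _ _ => 1 / (m : ℝ))‖ ^ 2

/-- Assumptions on the outer functions (`g` enters through `θ_i^*`). -/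
structure OuterAssumption {m n p : ℕ} (c : Constants) (f g : Fin m → E n → E p → ℝ) : Prop where
  contDiff : ∀ i, ContDiff ℝ 1 fun q : E n × E p => f i q.1 q.2
  lipschitz_gradX : ∀ i x x' θ θ',
    ‖gradX (f i) x θ - gradX (f i) x' θ'‖ ≤ c.Lfx * pairDist x x' θ θ'
  lipschitz_gradTheta : ∀ i x x' θ θ',
    ‖gradTheta (f i) x θ - gradTheta (f i) x' θ'‖ ≤ c.Lfθ * pairDist x x' θ θ'
  bound_gradTheta : ∀ i x, ‖gradTheta (f i) x (innerSol (g i) x)‖ ≤ c.Cfθ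

/-- Assumptions on the inner functions, with strong convexity modulus `μ`. -/
structure InnerAssumption {m n p : ℕ} (c : Constants) (μ : ℝ) (g : Fin m → E n → E p → ℝ) :
    Prop where
  strongConvex : ∀ i x, StrongConvexOn Set.univ μ (g i x)
  contDiff : ∀ i, ContDiff ℝ 2 fun q : E n × E p => g i q.1 q.2
  lipschitz_gradTheta : ∀ i x θ θ',
    ‖gradTheta (g i) x θ - gradTheta (g i) x θ'‖ ≤ c.Lgθ * ‖θ - θ'‖
  lipschitz_hessXTheta : ∀ i x x' θ θ',
    ‖hessXTheta (g i) x θ - hessXTheta (g i) x' θ'‖ ≤ c.Lgxθ * pairDist x x' θ θ'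
  lipschitz_hessThetaTheta : ∀ i x x' θ θ',
    ‖hessThetaTheta (g i) x θ - hessThetaTheta (g i) x' θ'‖ ≤ c.Lgθθ * pairDist x x' θ θ'
  bound_hessXTheta : ∀ i x θ, ‖hessXTheta (g i) x θ‖ ≤ c.Cgxθ

/-! ### The algorithm (gradient tracking version, exact derivatives) -/

/-- The state `(x_i, θ_i, v_i, z_i, y_i)` of all the nodes. -/
structure State (m n p : ℕ) where
  x : Fin m → E n
  θ : Fin m → E p
  v : Fin m → E p
  z : Fin m → E n
  y : Fin m → E n

/-- The step-sizes `α, β, λ, γ, τ`. -/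
structure StepSizes where
  α : ℝ
  β : ℝ
  lam : ℝ
  γ : ℝ
  τ : ℝ

section Algorithm

variable {m n p : ℕ} (f g : Fin m → E n → E p → ℝ)

/-- `d_i = ∇_θ g_i (x_i, θ_i)`. -/
def dirD (S : State m n p) (i : Fin m) : E p :=
  gradTheta (g i) (S.x i) (S.θ i)

/-- `h_i = ∇²_{θθ} g_i (x_i, θ_i) v_i - ∇_θ f_i (x_i, θ_i)`. -/
def dirH (S : State m n p) (i : Fin m) : E p :=
  hessThetaTheta (g i) (S.x i) (S.θ i) (S.v i) - gradTheta (f i) (S.x i) (S.θ i)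

/-- `s_i = ∇_x f_i (x_i, θ_i) - ∇²_{xθ} g_i (x_i, θ_i) v_i`. -/
def dirS (S : State m n p) (i : Fin m) : E n :=
  gradX (f i) (S.x i) (S.θ i) - hessXTheta (g i) (S.x i) (S.θ i) (S.v i)

/-- `z_i^{k+1} = s_i^k + (1 - γ) (z_i^k - s_i^k)`. -/
def nextZ (γ : ℝ) (S : State m n p) (i : Fin m) : E n :=
  dirS f g S i + (1 - γ) • (S.z i - dirS f g S i)

/-- One iteration. Sums over the neighbours of `i` are written as sums over all nodes, since
`W i j = 0` when `j` is not a neighbour of `i`. -/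
def step (W : Matrix (Fin m) (Fin m) ℝ) (t : StepSizes) (S : State m n p) : State m n p where
  x := fun i => (1 - t.τ) • S.x i + t.τ • ((∑ j, W i j • S.x j) - t.α • S.y i)
  θ := fun i => S.θ i - t.β • dirD g S i
  v := fun i => S.v i - t.lam • dirH f g S i
  z := nextZ f g t.γ S
  y := fun i => (∑ j, W i j • S.y j) + nextZ f g t.γ S i - S.z i

/-- The state after `k` iterations from the initial state `S₀`. -/
def iter (W : Matrix (Fin m) (Fin m) ℝ) (t : StepSizes) (S₀ : State m n p) :
    ℕ → State m n p
  | 0 => S₀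
  | k + 1 => step f g W t (iter W t S₀ k)

/-- The average `(1/m) ∑ i, x_i`. -/
def State.xbar (S : State m n p) : E n := (1 / (m : ℝ)) • ∑ i, S.x i

/-- Initialization: the `x_i^0` agree and `y_i^0 = z_i^0`; the initial objective gap and the
mean squares of the initial quantities are at most `D`. -/
structure InitAssumption (D : ℝ) (S₀ : State m n p) : Prop where
  x_eq : ∀ i j, S₀.x i = S₀.x j
  y_eq : ∀ i, S₀.y i = S₀.z i
  gap : objective f g S₀.xbar - ⨅ x, objective f g x ≤ D
  theta_le : (1 / (m : ℝ)) * ∑ i, ‖S₀.θ i - innerSol (g i) S₀.xbar‖ ^ 2 ≤ D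
  v_le : (1 / (m : ℝ)) * ∑ i, ‖S₀.v i‖ ^ 2 ≤ D
  z_le : (1 / (m : ℝ)) * ∑ i, ‖S₀.z i‖ ^ 2 ≤ D
  grad_le : (1 / (m : ℝ)) * ∑ i, ‖gradX (f i) S₀.xbar (innerSol (g i) S₀.xbar)‖ ^ 2 ≤ D

end Algorithm

/-! ### Derived constants and the step-size threshold -/

namespace Constants

variable (c : Constants) (μ : ℝ)

/-- The condition number `κ`. -/
def kappa : ℝ := max c.Lfx (max c.Lfθ (max c.Lgθ (max c.Lgxθ c.Lgθθ))) / μ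

def M : ℝ := c.Cfθ / μ

/-- Lipschitz constant of `θ_i^*`. -/
def Lθstar : ℝ := c.Cgxθ / μ

def Lv : ℝ := c.Lfθ / μ + c.Cfθ * c.Lgθθ / μ ^ 2

def Lvstar : ℝ := c.Lv μ * (1 + c.Lθstar μ)

/-- Lipschitz constant of `∇Φ`. -/
def L : ℝ := (c.Lfx + c.Cgxθ * c.Lv μ + c.Cfθ * c.Lgxθ / μ) * (1 + c.Lθstar μ)

def Lfgx : ℝ := 2 * c.Lfx ^ 2 + 4 * c.M μ ^ 2 * c.Lgxθ ^ 2

def Lfgθ : ℝ := 2 * c.Lfθ ^ 2 + 4 * c.M μ ^ 2 * c.Lgθθ ^ 2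

def ωθ : ℝ := μ * c.Lgθ / (2 * (μ + c.Lgθ))

def P : ℝ := c.Lfgx μ + 32 * c.Cgxθ ^ 2 * c.Lfgθ μ / μ ^ 2

/-- `max L_{g,θ} C_{g,xθ}` is a Lipschitz constant of `∇_θ g_i` in either variable. -/
def φ : ℝ := c.P μ * (1 + 4 * (max c.Lgθ c.Cgxθ) ^ 2 / c.ωθ μ ^ 2)

variable (ρ τ : ℝ)

def u₁ : ℝ :=
  min (1 / (2 * τ * c.L μ))
    ((1 - ρ) ^ 2 / (32 * Real.sqrt (c.φ μ) * Real.sqrt (τ * c.L μ)))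

def u₂ : ℝ :=
  min ((1 - ρ) ^ (4 / 3 : ℝ) * (τ * c.L μ) ^ (1 / 3 : ℝ) / (6 * c.φ μ ^ (1 / 3 : ℝ)))
    (min
      ((1 - ρ) ^ (4 / 3 : ℝ) * (τ * c.L μ) ^ (1 / 3 : ℝ) /
        (4 * c.φ μ ^ (1 / 3 : ℝ) * c.Lfgx μ ^ (1 / 3 : ℝ)) * c.P μ ^ (1 / 3 : ℝ))
      ((1 - ρ) ^ (4 / 3 : ℝ) * (τ * c.L μ) ^ (1 / 3 : ℝ) / (4 * c.Lfgx μ ^ (1 / 3 : ℝ))))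

def u₃ : ℝ :=
  min (min 1 (2 * μ / (μ + c.Lgθ)) / (96 * τ * c.Lvstar μ * c.Cgxθ))
    (min (2 / (μ + c.Lgθ)) ((μ + c.Lgθ) / (2 * μ * c.Lgθ)) * c.ωθ μ /
      (12 * τ * Real.sqrt (c.P μ) * c.Lθstar μ))

/-- The threshold `u'` for the step-size `α`. -/
def uPrime : ℝ :=
  min 1 (min (c.u₁ μ ρ τ) (min (min 1 (c.u₂ μ ρ τ) / (8 * τ * c.L μ)) (c.u₃ μ τ)))

/-- Admissible proportionality constants in `γ = c_γ α`, `λ = c_λ α`, `β = c_β α`. -/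
structure AdmissibleRatios (α cγ clam cβ : ℝ) : Prop where
  lam_lower : 48 * c.Lvstar μ * c.Cgxθ / μ * τ ≤ clam
  lam_upper : clam * α < min (1 / μ) (2 / (μ + c.Lgθ))
  beta_lower : 6 * c.Lθstar μ / c.ωθ μ * Real.sqrt (c.P μ) * τ ≤ cβ
  beta_upper : cβ * α < min (2 / (μ + c.Lgθ)) ((μ + c.Lgθ) / (2 * μ * c.Lgθ))
  gamma_lower : 4 * c.L μ * τ ≤ cγ
  gamma_upper : cγ * α < min 1 (c.u₂ μ ρ τ)

end Constants

end LoPA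

end

namespace LoPA

open Filter Topology

/-! ### Partial derivatives as restrictions of the total derivative -/

/-! The argument couples the objective at x̄ to five mean square errors: of `z` against the local
hypergradients at x̄, of `v` against the adjoint solutions, of `θ` against the inner solutions, and
the consensus errors of `x` and `y`. Put T = τα. Gradient tracking keeps ȳ = z̄, so x̄ moves by -Tȳ,
where ȳ is an inexact gradient whose error is controlled by that of `z`. The descent lemma then
gives -(T/2)‖∇Φ‖², a spare -(T/4)‖ȳ‖², and a multiple of the `z` error (`objective_step_le`).

Each error contracts at its own rate (γ for `z`, λμ for `v`, 2βω for `θ`, τ(1-ρ)/2 and (1-ρ)/2 for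
consensus), up to other errors. For `z`, `v` and `θ` there is also a drift of order T²‖ȳ‖², because
the target moves with x̄. The first four weights in `errorEnergy` are T times a constant over the
rate, so contraction removes a fixed multiple of T times the error; the weight of `y` cancels the
`y` term in the `x` recursion. The lower bounds on c_γ, c_λ, c_β make the drifts fit into the spare
‖ȳ‖² term, and P and φ are large enough to pay for the cross terms. Hence the Lyapunov function
drops by (T/2)‖∇Φ(x̄)‖² per step (`StepBounds.energy_descent`, `lyapunov_step_le`), and the drops
telescope (`sum_norm_gradient_sq_le`).

The gradient of Φ comes from an adjoint argument that needs θ* to be only Lipschitz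
(`NodeAssumption.hasGradientAt`).

The rate is then bookkeeping in κ: the initial Lyapunov gap is O(κ) (`initial_lyapunov_le`), 1/τ is
O(κ⁴), and 1/u' is O(κ³/(1-ρ)²) (`Constants.dominates_uPrime`). The product is κ⁸/(1-ρ)². -/

theorem hasFDerivAt_snd {n p : ℕ} {F : Type*} [NormedAddCommGroup F] [NormedSpace ℝ F]
    {G : E n × E p → F} {x : E n} {θ : E p} (h : DifferentiableAt ℝ G (x, θ)) :
    HasFDerivAt (fun θ' => G (x, θ'))
      ((fderiv ℝ G (x, θ)).comp (ContinuousLinearMap.inr ℝ (E n) (E p))) θ :=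
  h.hasFDerivAt.comp θ (hasFDerivAt_prodMk_right x θ)

theorem hasFDerivAt_fst {n p : ℕ} {F : Type*} [NormedAddCommGroup F] [NormedSpace ℝ F]
    {G : E n × E p → F} {x : E n} {θ : E p} (h : DifferentiableAt ℝ G (x, θ)) :
    HasFDerivAt (fun x' => G (x', θ))
      ((fderiv ℝ G (x, θ)).comp (ContinuousLinearMap.inl ℝ (E n) (E p))) x :=
  h.hasFDerivAt.comp x (hasFDerivAt_prodMk_left x θ)

section Partial

variable {n p : ℕ} {f g : E n → E p → ℝ}

theorem inner_gradTheta (hf : ContDiff ℝ 1 fun q : E n × E p => f q.1 q.2)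
    (x : E n) (θ w : E p) :
    inner ℝ (gradTheta f x θ) w = fderiv ℝ (fun q : E n × E p => f q.1 q.2) (x, θ) (0, w) := by
  have h := hasFDerivAt_snd (hf.differentiable one_ne_zero (x, θ))
  rw [gradTheta, gradient, InnerProductSpace.toDual_symm_apply, h.fderiv]
  simp

theorem inner_gradX (hf : ContDiff ℝ 1 fun q : E n × E p => f q.1 q.2)
    (x u : E n) (θ : E p) :
    inner ℝ (gradX f x θ) u = fderiv ℝ (fun q : E n × E p => f q.1 q.2) (x, θ) (u, 0) := by
  have h := hasFDerivAt_fst (hf.differentiable one_ne_zero (x, θ))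
  rw [gradX, gradient, InnerProductSpace.toDual_symm_apply, h.fderiv]
  simp

theorem hasGradientAt_theta (hf : ContDiff ℝ 1 fun q : E n × E p => f q.1 q.2)
    (x : E n) (θ : E p) : HasGradientAt (f x) (gradTheta f x θ) θ :=
  (hasFDerivAt_snd (hf.differentiable one_ne_zero (x, θ))).differentiableAt.hasGradientAt

theorem contDiff_fderiv (hg : ContDiff ℝ 2 fun q : E n × E p => g q.1 q.2) :
    ContDiff ℝ 1 (fderiv ℝ fun q : E n × E p => g q.1 q.2) :=
  hg.fderiv_right (by norm_num)

theorem contDiff_gradTheta (hg : ContDiff ℝ 2 fun q : E n × E p => g q.1 q.2) :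
    ContDiff ℝ 1 fun q : E n × E p => gradTheta g q.1 q.2 := by
  have h1 : ∀ q : E n × E p, gradTheta g q.1 q.2 = (InnerProductSpace.toDual ℝ (E p)).symm
      ((fderiv ℝ (fun q : E n × E p => g q.1 q.2) q).comp
        (ContinuousLinearMap.inr ℝ (E n) (E p))) := by
    intro q
    rw [gradTheta, gradient,
      (hasFDerivAt_snd (hg.differentiable two_ne_zero (q.1, q.2))).fderiv]
  simp_rw [h1]
  exact (InnerProductSpace.toDual ℝ (E p)).symm.contDiff.comp
    ((contDiff_fderiv hg).clm_comp contDiff_const)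

theorem contDiff_gradX (hg : ContDiff ℝ 2 fun q : E n × E p => g q.1 q.2) :
    ContDiff ℝ 1 fun q : E n × E p => gradX g q.1 q.2 := by
  have h1 : ∀ q : E n × E p, gradX g q.1 q.2 = (InnerProductSpace.toDual ℝ (E n)).symm
      ((fderiv ℝ (fun q : E n × E p => g q.1 q.2) q).comp
        (ContinuousLinearMap.inl ℝ (E n) (E p))) := by
    intro q
    rw [gradX, gradient,
      (hasFDerivAt_fst (hg.differentiable two_ne_zero (q.1, q.2))).fderiv]
  simp_rw [h1]
  exact (InnerProductSpace.toDual ℝ (E n)).symm.contDiff.comp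
    ((contDiff_fderiv hg).clm_comp contDiff_const)

theorem hasFDerivAt_gradTheta (hg : ContDiff ℝ 2 fun q : E n × E p => g q.1 q.2)
    (x : E n) (θ : E p) :
    HasFDerivAt (fun θ' => gradTheta g x θ') (hessThetaTheta g x θ) θ :=
  (hasFDerivAt_snd ((contDiff_gradTheta hg).differentiable one_ne_zero
    (x, θ))).differentiableAt.hasFDerivAt

theorem hasFDerivAt_gradX (hg : ContDiff ℝ 2 fun q : E n × E p => g q.1 q.2)
    (x : E n) (θ : E p) :
    HasFDerivAt (fun θ' => gradX g x θ') (hessXTheta g x θ) θ :=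
  (hasFDerivAt_snd ((contDiff_gradX hg).differentiable one_ne_zero
    (x, θ))).differentiableAt.hasFDerivAt

/-- Both Hessian blocks are read off from the single second derivative of g on the product, so that
symmetry of `hessThetaTheta` and adjointness of the mixed blocks both become symmetry of that
bilinear form. -/
theorem inner_hessThetaTheta (hg : ContDiff ℝ 2 fun q : E n × E p => g q.1 q.2)
    (x : E n) (θ v w : E p) :
    inner ℝ (hessThetaTheta g x θ v) w =
      fderiv ℝ (fderiv ℝ fun q : E n × E p => g q.1 q.2) (x, θ) (0, v) (0, w) := by
  have h1 := (hasFDerivAt_gradTheta hg x θ).inner ℝ (hasFDerivAt_const w θ)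
  have h2 := (hasFDerivAt_snd ((contDiff_fderiv hg).differentiable one_ne_zero (x, θ))).clm_apply
    (hasFDerivAt_const ((0, w) : E n × E p) θ)
  have h3 := h1.congr_of_eventuallyEq (f₁ := fun θ' =>
    fderiv ℝ (fun q : E n × E p => g q.1 q.2) (x, θ') (0, w))
    (Eventually.of_forall fun θ' => (inner_gradTheta (hg.of_le one_le_two) x θ' w).symm)
  simpa using DFunLike.congr_fun (h3.unique h2) v

theorem inner_hessXTheta (hg : ContDiff ℝ 2 fun q : E n × E p => g q.1 q.2)
    (x u : E n) (θ v : E p) :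
    inner ℝ (hessXTheta g x θ v) u =
      fderiv ℝ (fderiv ℝ fun q : E n × E p => g q.1 q.2) (x, θ) (0, v) (u, 0) := by
  have h1 := (hasFDerivAt_gradX hg x θ).inner ℝ (hasFDerivAt_const u θ)
  have h2 := (hasFDerivAt_snd ((contDiff_fderiv hg).differentiable one_ne_zero (x, θ))).clm_apply
    (hasFDerivAt_const ((u, 0) : E n × E p) θ)
  have h3 := h1.congr_of_eventuallyEq (f₁ := fun θ' =>
    fderiv ℝ (fun q : E n × E p => g q.1 q.2) (x, θ') (u, 0))
    (Eventually.of_forall fun θ' => (inner_gradX (hg.of_le one_le_two) x u θ').symm)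
  simpa using DFunLike.congr_fun (h3.unique h2) v

theorem snd_fderiv_symm (hg : ContDiff ℝ 2 fun q : E n × E p => g q.1 q.2)
    (q a b : E n × E p) :
    fderiv ℝ (fderiv ℝ fun q : E n × E p => g q.1 q.2) q a b =
      fderiv ℝ (fderiv ℝ fun q : E n × E p => g q.1 q.2) q b a :=
  (hg.contDiffAt.isSymmSndFDerivAt (by simp)) a b

theorem inner_hessThetaTheta_symm (hg : ContDiff ℝ 2 fun q : E n × E p => g q.1 q.2)
    (x : E n) (θ v w : E p) :
    inner ℝ (hessThetaTheta g x θ v) w = inner ℝ (hessThetaTheta g x θ w) v := by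
  rw [inner_hessThetaTheta hg, inner_hessThetaTheta hg, snd_fderiv_symm hg]

end Partial

/-! ### Strongly convex functions on `ℝ^p` -/

theorem HasGradientAt.hasDerivAt_line {p : ℕ} {h : E p → ℝ} {a θ : E p}
    (hh : HasGradientAt h a θ) (d : E p) :
    HasDerivAt (fun t : ℝ => h (θ + t • d)) (inner ℝ a d) 0 := by
  have h1 : HasDerivAt (fun t : ℝ => θ + t • d) d 0 := by
    simpa using ((hasDerivAt_id (0 : ℝ)).smul_const d).const_add θ
  have h2 : HasFDerivAt h (InnerProductSpace.toDual ℝ (E p) a) (θ + (0 : ℝ) • d) := by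
    simpa using hh.hasFDerivAt
  exact h2.comp_hasDerivAt (0 : ℝ) h1

/-- Divide the strong convexity inequality on the segment from θ to θ' by its parameter t and let t
↓ 0. The factor 1 - t in the quadratic term tends to 1, so the full modulus survives. -/
theorem StrongConvexOn.le_of_hasGradientAt {p : ℕ} {μ : ℝ} {h : E p → ℝ}
    (hh : StrongConvexOn Set.univ μ h) {a θ : E p} (ha : HasGradientAt h a θ) (θ' : E p) :
    h θ + inner ℝ a (θ' - θ) + μ / 2 * ‖θ' - θ‖ ^ 2 ≤ h θ' := by
  have h1 := (HasGradientAt.hasDerivAt_line ha (θ' - θ)).tendsto_slope_zero_right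
  have h2 : Tendsto (fun t : ℝ => h θ' - h θ - (1 - t) * (μ / 2 * ‖θ' - θ‖ ^ 2)) (𝓝[>] 0)
      (𝓝 (h θ' - h θ - (1 - 0) * (μ / 2 * ‖θ' - θ‖ ^ 2))) := by
    apply Tendsto.mono_left _ nhdsWithin_le_nhds
    exact Continuous.tendsto (by fun_prop) 0
  have h3 := le_of_tendsto_of_tendsto h1 h2 ?_
  · linarith
  · filter_upwards [Ioo_mem_nhdsGT (zero_lt_one' ℝ)] with t ht
    have h4 := hh.2 (Set.mem_univ θ) (Set.mem_univ θ') (sub_nonneg.2 ht.2.le) ht.1.le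
      (by ring)
    have h5 : (1 - t) • θ + t • θ' = θ + t • (θ' - θ) := by module
    rw [h5, norm_sub_rev θ θ'] at h4
    simp only [smul_eq_mul, zero_add, zero_smul, add_zero] at h4 ⊢
    rw [inv_mul_le_iff₀ ht.1]
    linarith

/-- A bound for the norm of a symmetric operator through its quadratic form. -/
theorem norm_apply_le_of_quadratic_form {p : ℕ} {T : E p → E p} {r : ℝ}
    (hadd : ∀ u w, T (u + w) = T u + T w) (hsub : ∀ u w, T (u - w) = T u - T w)
    (hsmul : ∀ (a : ℝ) u, T (a • u) = a • T u)
    (hsymm : ∀ u w, inner ℝ (T u) w = inner ℝ (T w) u)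
    (hT : ∀ u, |inner ℝ (T u) u| ≤ r * ‖u‖ ^ 2) (u : E p) : ‖T u‖ ≤ r * ‖u‖ := by
  have key : ∀ w, 4 * inner ℝ (T u) w ≤ 2 * r * (‖u‖ ^ 2 + ‖w‖ ^ 2) := by
    intro w
    have h1 := (abs_le.1 (hT (u + w))).2
    have h2 := (abs_le.1 (hT (u - w))).1
    have h3 : inner ℝ (T (u + w)) (u + w) - inner ℝ (T (u - w)) (u - w)
        = 4 * inner ℝ (T u) w := by
      rw [hadd, hsub]
      simp only [inner_add_left, inner_add_right, inner_sub_left, inner_sub_right]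
      rw [hsymm w u]; ring
    have h4 : ‖u + w‖ ^ 2 + ‖u - w‖ ^ 2 = 2 * (‖u‖ ^ 2 + ‖w‖ ^ 2) := by
      simpa only [sq] using parallelogram_law_with_norm ℝ u w
    have h5 : r * ‖u + w‖ ^ 2 + r * ‖u - w‖ ^ 2 = 2 * r * (‖u‖ ^ 2 + ‖w‖ ^ 2) := by
      rw [← mul_add, h4]; ring
    linarith
  rcases eq_or_ne (T u) 0 with h0 | h0
  · have hr := hT u
    rcases eq_or_ne u 0 with hu | hu
    · rw [h0, hu]; simp
    · have hu' : 0 < ‖u‖ := norm_pos_iff.2 hu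
      have : 0 ≤ r * ‖u‖ ^ 2 := (abs_nonneg _).trans hr
      rw [h0, norm_zero]
      exact mul_nonneg (nonneg_of_mul_nonneg_left this (by positivity)) hu'.le
  · have hb : 0 < ‖T u‖ := norm_pos_iff.2 h0
    have hu : 0 < ‖u‖ := by
      rw [norm_pos_iff]
      rintro rfl
      exact h0 (by simpa using hsmul 0 0)
    -- The test vector is the multiple of `T u` of length ‖u‖, which balances the two squares in
    -- `key`.
    have h1 := key ((‖u‖ / ‖T u‖) • T u)
    rw [inner_smul_right, real_inner_self_eq_norm_sq, norm_smul, Real.norm_eq_abs,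
      abs_of_pos (div_pos hu hb), div_mul_cancel₀ _ hb.ne'] at h1
    have h2 : ‖u‖ / ‖T u‖ * ‖T u‖ ^ 2 = ‖u‖ * ‖T u‖ := by field_simp
    rw [h2] at h1
    nlinarith

/-! ### The inner problem: Hessian bounds, contraction of gradient steps, existence of the
minimizer. -/

section Inner

variable {n p : ℕ} {g : E n → E p → ℝ} {μ Lg : ℝ}

theorem strong_monotone (hg : ContDiff ℝ 1 fun q : E n × E p => g q.1 q.2)
    (hc : ∀ x, StrongConvexOn Set.univ μ (g x)) (x : E n) (θ θ' : E p) :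
    μ * ‖θ - θ'‖ ^ 2 ≤ inner ℝ (gradTheta g x θ - gradTheta g x θ') (θ - θ') := by
  have h1 := StrongConvexOn.le_of_hasGradientAt (hc x) (hasGradientAt_theta hg x θ) θ'
  have h2 := StrongConvexOn.le_of_hasGradientAt (hc x) (hasGradientAt_theta hg x θ') θ
  rw [norm_sub_rev, ← neg_sub θ θ', inner_neg_right] at h1
  rw [inner_sub_left]
  linarith

theorem mul_norm_sub_le (hg : ContDiff ℝ 1 fun q : E n × E p => g q.1 q.2)
    (hc : ∀ x, StrongConvexOn Set.univ μ (g x)) (x : E n) (θ θ' : E p) :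
    μ * ‖θ - θ'‖ ≤ ‖gradTheta g x θ - gradTheta g x θ'‖ := by
  rcases eq_or_ne θ θ' with rfl | h
  · simp
  · have h0 : 0 < ‖θ - θ'‖ := norm_pos_iff.2 (sub_ne_zero.2 h)
    have h1 := strong_monotone hg hc x θ θ'
    have h2 := real_inner_le_norm (gradTheta g x θ - gradTheta g x θ') (θ - θ')
    nlinarith

/-- Strong monotonicity between θ + t w and θ, divided by t² and passed to the limit t ↓ 0. -/
theorem hess_coercive (hg : ContDiff ℝ 2 fun q : E n × E p => g q.1 q.2)
    (hc : ∀ x, StrongConvexOn Set.univ μ (g x)) (x : E n) (θ w : E p) :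
    μ * ‖w‖ ^ 2 ≤ inner ℝ (hessThetaTheta g x θ w) w := by
  have h1 : HasDerivAt (fun t : ℝ => θ + t • w) w 0 := by
    simpa using ((hasDerivAt_id (0 : ℝ)).smul_const w).const_add θ
  have h2 : HasFDerivAt (fun θ' => gradTheta g x θ') (hessThetaTheta g x θ)
      (θ + (0 : ℝ) • w) := by simpa using hasFDerivAt_gradTheta hg x θ
  have h3 := ((h2.comp_hasDerivAt 0 h1).inner ℝ
    (hasDerivAt_const (0 : ℝ) w)).tendsto_slope_zero_right
  simp only [Function.comp_apply, zero_add, zero_smul, add_zero, inner_zero_right,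
    smul_eq_mul] at h3
  refine ge_of_tendsto h3 ?_
  filter_upwards [self_mem_nhdsWithin] with t (ht : 0 < t)
  have h4 := strong_monotone (hg.of_le one_le_two) hc x (θ + t • w) θ
  rw [add_sub_cancel_left, norm_smul, Real.norm_eq_abs, abs_of_pos ht, inner_smul_right,
    inner_sub_left] at h4
  rw [le_inv_mul_iff₀ ht]
  have h5 : t * (t * (μ * ‖w‖ ^ 2)) ≤ t * (inner ℝ (gradTheta g x (θ + t • w)) w
      - inner ℝ (gradTheta g x θ) w) := by linarith
  exact le_of_mul_le_mul_left h5 ht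

theorem mul_norm_le_norm_hess (hg : ContDiff ℝ 2 fun q : E n × E p => g q.1 q.2)
    (hc : ∀ x, StrongConvexOn Set.univ μ (g x)) (x : E n) (θ w : E p) :
    μ * ‖w‖ ≤ ‖hessThetaTheta g x θ w‖ := by
  rcases eq_or_ne w 0 with rfl | h
  · simp
  · have h0 : 0 < ‖w‖ := norm_pos_iff.2 h
    have h1 := hess_coercive hg hc x θ w
    have h2 := real_inner_le_norm (hessThetaTheta g x θ w) w
    nlinarith

theorem norm_hess_le (hLg : 0 ≤ Lg)
    (hl : ∀ x θ θ', ‖gradTheta g x θ - gradTheta g x θ'‖ ≤ Lg * ‖θ - θ'‖)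
    (x : E n) (θ : E p) : ‖hessThetaTheta g x θ‖ ≤ Lg := by
  have h : LipschitzWith ⟨Lg, hLg⟩ fun θ' => gradTheta g x θ' :=
    LipschitzWith.of_dist_le_mul fun a b => by
      rw [dist_eq_norm, dist_eq_norm]; exact hl x a b
  exact norm_fderiv_le_of_lipschitz ℝ h

/-- Compare the lower and upper bounds on the gradient difference at a unit vector and 0; this is
where p ≥ 1 matters. It is the source of κ ≥ 1. -/
theorem modulus_le [NeZero p] (hg : ContDiff ℝ 1 fun q : E n × E p => g q.1 q.2)
    (hc : ∀ x, StrongConvexOn Set.univ μ (g x))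
    (hl : ∀ x θ θ', ‖gradTheta g x θ - gradTheta g x θ'‖ ≤ Lg * ‖θ - θ'‖) : μ ≤ Lg := by
  have h1 := mul_norm_sub_le hg hc 0 (EuclideanSpace.single 0 (1 : ℝ)) 0
  have h2 := h1.trans (hl 0 _ _)
  simpa using h2

/-- `‖I - β ∇²_{θθ} g‖ ≤ 1 - β μ`. -/
theorem norm_sub_smul_hess_le (hg : ContDiff ℝ 2 fun q : E n × E p => g q.1 q.2)
    (hc : ∀ x, StrongConvexOn Set.univ μ (g x)) (hLg : 0 ≤ Lg)
    (hl : ∀ x θ θ', ‖gradTheta g x θ - gradTheta g x θ'‖ ≤ Lg * ‖θ - θ'‖)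
    {β : ℝ} (hβ : 0 ≤ β) (hβ' : β * (μ + Lg) ≤ 2) (x : E n) (θ w : E p) :
    ‖w - β • hessThetaTheta g x θ w‖ ≤ (1 - β * μ) * ‖w‖ := by
  refine norm_apply_le_of_quadratic_form (T := fun w => w - β • hessThetaTheta g x θ w)
    (fun u w => by simp only [map_add]; module) (fun u w => by simp only [map_sub]; module)
    (fun a u => by simp only [map_smul]; module) (fun u w => ?_) (fun u => ?_) w
  · rw [inner_sub_left, inner_sub_left, inner_smul_left, inner_smul_left,
      inner_hessThetaTheta_symm hg, real_inner_comm]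
  · rw [inner_sub_left, inner_smul_left, real_inner_self_eq_norm_sq]
    have h1 := hess_coercive hg hc x θ u
    have h2 : inner ℝ (hessThetaTheta g x θ u) u ≤ Lg * ‖u‖ ^ 2 := by
      refine (real_inner_le_norm _ _).trans ?_
      have := (hessThetaTheta g x θ).le_of_opNorm_le (norm_hess_le hLg hl x θ) u
      nlinarith [norm_nonneg u]
    have h3 := mul_le_mul_of_nonneg_left h1 hβ
    have h4 := mul_le_mul_of_nonneg_left h2 hβ
    -- The quadratic form of I - βH lies between 1 - βLg and 1 - βμ. The condition β(μ + Lg) ≤ 2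
    -- says exactly that the lower end is at least -(1 - βμ).
    have h5 := mul_le_mul_of_nonneg_right hβ' (sq_nonneg ‖u‖)
    simp only [conj_trivial]
    rw [abs_le]
    constructor <;> nlinarith

/-- The derivative of the gradient step is I - βH, so the operator bound passes to the map by the
mean value inequality. -/
theorem gradient_step_contracts (hg : ContDiff ℝ 2 fun q : E n × E p => g q.1 q.2)
    (hc : ∀ x, StrongConvexOn Set.univ μ (g x)) (hLg : 0 ≤ Lg)
    (hl : ∀ x θ θ', ‖gradTheta g x θ - gradTheta g x θ'‖ ≤ Lg * ‖θ - θ'‖)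
    {β : ℝ} (hβ : 0 ≤ β) (hβ' : β * (μ + Lg) ≤ 2) (hβμ : β * μ ≤ 1) (x : E n) (θ θ' : E p) :
    ‖(θ - β • gradTheta g x θ) - (θ' - β • gradTheta g x θ')‖ ≤ (1 - β * μ) * ‖θ - θ'‖ := by
  refine Convex.norm_image_sub_le_of_norm_hasFDerivWithin_le
    (f := fun θ => θ - β • gradTheta g x θ)
    (f' := fun θ => ContinuousLinearMap.id ℝ (E p) - β • hessThetaTheta g x θ)
    (s := Set.univ) (fun y _ => ?_) (fun y _ => ?_) convex_univ trivial trivial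
  · exact ((hasFDerivAt_id y).sub
      ((hasFDerivAt_gradTheta hg x y).const_smul β)).hasFDerivWithinAt
  · exact ContinuousLinearMap.opNorm_le_bound _ (sub_nonneg.2 hβμ) fun w => by
      simpa using norm_sub_smul_hess_le hg hc hLg hl hβ hβ' x y w

/-- A zero of the gradient is a fixed point of a gradient step, and for β = 1/(μ + Lg) that step is
a contraction, so Banach's theorem supplies one. -/
theorem exists_gradTheta_eq_zero (hg : ContDiff ℝ 2 fun q : E n × E p => g q.1 q.2)
    (hc : ∀ x, StrongConvexOn Set.univ μ (g x)) (hμ : 0 < μ) (hLg : 0 < Lg)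
    (hl : ∀ x θ θ', ‖gradTheta g x θ - gradTheta g x θ'‖ ≤ Lg * ‖θ - θ'‖) (x : E n) :
    ∃ θ, gradTheta g x θ = 0 := by
  set β := 1 / (μ + Lg) with hβ
  have hβ0 : 0 < β := by positivity
  have hβ1 : β * (μ + Lg) = 1 := by rw [hβ]; field_simp
  have hβμ : β * μ ≤ 1 := by nlinarith
  have hK : ContractingWith (1 - β * μ).toNNReal
      fun θ => θ - β • gradTheta g x θ := by
    refine ⟨?_, LipschitzWith.of_dist_le_mul fun a b => ?_⟩
    · rw [Real.toNNReal_lt_one]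
      have := mul_pos hβ0 hμ
      linarith
    · rw [dist_eq_norm, dist_eq_norm, Real.coe_toNNReal _ (sub_nonneg.2 hβμ)]
      exact gradient_step_contracts hg hc hLg.le hl hβ0.le (by linarith) hβμ x a b
  refine ⟨hK.fixedPoint, ?_⟩
  have h := hK.fixedPoint_isFixedPt
  rw [Function.IsFixedPt, sub_eq_self] at h
  exact (smul_eq_zero.1 h).resolve_left hβ0.ne'

theorem gradTheta_innerSol (hg : ContDiff ℝ 2 fun q : E n × E p => g q.1 q.2)
    (hc : ∀ x, StrongConvexOn Set.univ μ (g x)) (hμ : 0 < μ) (hLg : 0 < Lg)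
    (hl : ∀ x θ θ', ‖gradTheta g x θ - gradTheta g x θ'‖ ≤ Lg * ‖θ - θ'‖) (x : E n) :
    gradTheta g x (innerSol g x) = 0 := by
  obtain ⟨θ₀, h0⟩ := exists_gradTheta_eq_zero hg hc hμ hLg hl x
  have hmin : ∃ θ, ∀ θ', g x θ ≤ g x θ' := by
    refine ⟨θ₀, fun θ' => ?_⟩
    have := StrongConvexOn.le_of_hasGradientAt (hc x)
      (hasGradientAt_theta (hg.of_le one_le_two) x θ₀) θ'
    rw [h0, inner_zero_left] at this
    have h2 : 0 ≤ μ / 2 * ‖θ' - θ₀‖ ^ 2 := by positivity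
    linarith
  have h1 : ∀ θ', g x (innerSol g x) ≤ g x θ' := Classical.epsilon_spec hmin
  have h2 : IsLocalMin (g x) (innerSol g x) := Eventually.of_forall h1
  have h3 := h2.fderiv_eq_zero
  rw [gradTheta, gradient]
  exact (congrArg _ h3).trans (map_zero _)

/-- By symmetry of second derivatives, the x-derivative of ∇_θ g is the adjoint of `hessXTheta`, and
the adjoint has the same norm. -/
theorem norm_gradTheta_sub_le {Cg : ℝ} (hg : ContDiff ℝ 2 fun q : E n × E p => g q.1 q.2)
    (hb : ∀ x θ, ‖hessXTheta g x θ‖ ≤ Cg) (x x' : E n) (θ : E p) :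
    ‖gradTheta g x θ - gradTheta g x' θ‖ ≤ Cg * ‖x - x'‖ := by
  have hd : ∀ y, HasFDerivAt (fun x => gradTheta g x θ)
      (ContinuousLinearMap.adjoint (hessXTheta g y θ)) y := by
    intro y
    have h1 := hasFDerivAt_fst ((contDiff_gradTheta hg).differentiable one_ne_zero (y, θ))
    have h2 : ∀ u w, inner ℝ (fderiv ℝ (fun q : E n × E p => gradTheta g q.1 q.2) (y, θ) (u, 0)) w
        = inner ℝ u (hessXTheta g y θ w) := by
      intro u w
      have h3 := h1.inner ℝ (hasFDerivAt_const w y)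
      have h4 := (hasFDerivAt_fst ((contDiff_fderiv hg).differentiable one_ne_zero
        (y, θ))).clm_apply (hasFDerivAt_const ((0, w) : E n × E p) y)
      have h5 := h3.congr_of_eventuallyEq (f₁ := fun x' =>
        fderiv ℝ (fun q : E n × E p => g q.1 q.2) (x', θ) (0, w))
        (Eventually.of_forall fun x' => (inner_gradTheta (hg.of_le one_le_two) x' θ w).symm)
      rw [← real_inner_comm u, inner_hessXTheta hg, snd_fderiv_symm hg]
      simpa using DFunLike.congr_fun (h5.unique h4) u
    refine h1.congr_fderiv ?_
    ext1 u
    refine ext_inner_right ℝ fun w => ?_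
    rw [ContinuousLinearMap.adjoint_inner_left]
    simpa using h2 u w
  exact Convex.norm_image_sub_le_of_norm_hasFDerivWithin_le (s := Set.univ)
    (fun y _ => (hd y).hasFDerivWithinAt)
    (fun y _ => by rw [LinearIsometryEquiv.norm_map]; exact hb y θ) convex_univ trivial trivial

end Inner

/-- Convexity of the square at the points a and b/ε with weights 1 - ε and ε. Taking ε to be the
contraction margin costs nothing in the contraction factor. -/
theorem sq_convex_combination_le {ε : ℝ} (h0 : 0 < ε) (h1 : ε ≤ 1) (a b : ℝ) :
    ((1 - ε) * a + b) ^ 2 ≤ (1 - ε) * a ^ 2 + b ^ 2 / ε := by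
  have h : (1 - ε) * a ^ 2 + b ^ 2 / ε - ((1 - ε) * a + b) ^ 2
      = (1 - ε) / ε * (ε * a - b) ^ 2 := by field_simp; ring
  have : 0 ≤ (1 - ε) / ε * (ε * a - b) ^ 2 :=
    mul_nonneg (div_nonneg (sub_nonneg.2 h1) h0.le) (sq_nonneg _)
  linarith

theorem pairDist_sq {n p : ℕ} (x x' : E n) (θ θ' : E p) :
    pairDist x x' θ θ' ^ 2 = ‖x - x'‖ ^ 2 + ‖θ - θ'‖ ^ 2 :=
  Real.sq_sqrt (by positivity)

theorem pairDist_nonneg {n p : ℕ} (x x' : E n) (θ θ' : E p) : 0 ≤ pairDist x x' θ θ' :=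
  Real.sqrt_nonneg _

theorem pairDist_le_add {n p : ℕ} (x x' : E n) (θ θ' : E p) :
    pairDist x x' θ θ' ≤ ‖x - x'‖ + ‖θ - θ'‖ := by
  refine Real.sqrt_le_iff.2 ⟨by positivity, ?_⟩
  nlinarith [mul_nonneg (norm_nonneg (x - x')) (norm_nonneg (θ - θ'))]

/-- The assumptions on the pair of functions of a single node. -/
structure NodeAssumption {n p : ℕ} (c : Constants) (μ : ℝ) (f g : E n → E p → ℝ) : Prop where
  cpos : c.Pos
  μpos : 0 < μ
  f_contDiff : ContDiff ℝ 1 fun q : E n × E p => f q.1 q.2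
  f_lipX : ∀ x x' θ θ', ‖gradX f x θ - gradX f x' θ'‖ ≤ c.Lfx * pairDist x x' θ θ'
  f_lipTheta : ∀ x x' θ θ',
    ‖gradTheta f x θ - gradTheta f x' θ'‖ ≤ c.Lfθ * pairDist x x' θ θ'
  f_bound : ∀ x, ‖gradTheta f x (innerSol g x)‖ ≤ c.Cfθ
  g_convex : ∀ x, StrongConvexOn Set.univ μ (g x)
  g_contDiff : ContDiff ℝ 2 fun q : E n × E p => g q.1 q.2
  g_lipTheta : ∀ x θ θ', ‖gradTheta g x θ - gradTheta g x θ'‖ ≤ c.Lgθ * ‖θ - θ'‖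
  g_lipXTheta : ∀ x x' θ θ',
    ‖hessXTheta g x θ - hessXTheta g x' θ'‖ ≤ c.Lgxθ * pairDist x x' θ θ'
  g_lipThetaTheta : ∀ x x' θ θ',
    ‖hessThetaTheta g x θ - hessThetaTheta g x' θ'‖ ≤ c.Lgθθ * pairDist x x' θ θ'
  g_bound : ∀ x θ, ‖hessXTheta g x θ‖ ≤ c.Cgxθ

/-- The solution `v^*(x)` of `∇²_{θθ} g (x, θ^*(x)) v = ∇_θ f (x, θ^*(x))`. -/
noncomputable def adjointSol {n p : ℕ} (f g : E n → E p → ℝ) (x : E n) : E p :=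
  Classical.epsilon fun v =>
    hessThetaTheta g x (innerSol g x) v = gradTheta f x (innerSol g x)

/-- The gradient of `x ↦ f (x, θ^*(x))`. -/
noncomputable def hypergrad {n p : ℕ} (f g : E n → E p → ℝ) (x : E n) : E n :=
  gradX f x (innerSol g x) - hessXTheta g x (innerSol g x) (adjointSol f g x)

/-! ### Estimates at a single node: sensitivity of the solutions, the hypergradient, one-step
recursions. -/

namespace NodeAssumption

variable {n p : ℕ} {c : Constants} {μ : ℝ} {f g : E n → E p → ℝ}

theorem gradTheta_innerSol (h : NodeAssumption c μ f g) (x : E n) :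
    gradTheta g x (innerSol g x) = 0 :=
  LoPA.gradTheta_innerSol h.g_contDiff h.g_convex h.μpos h.cpos.Lgθ h.g_lipTheta x

/-- Strong monotonicity at x bounds μ‖θ*(x) - θ*(x')‖ by ‖∇_θ g(x, θ*(x'))‖. Since ∇_θ g(x', θ*(x'))
= 0, this is a change in x alone. -/
theorem norm_innerSol_sub_le (h : NodeAssumption c μ f g) (x x' : E n) :
    ‖innerSol g x - innerSol g x'‖ ≤ c.Lθstar μ * ‖x - x'‖ := by
  have h1 := mul_norm_sub_le (h.g_contDiff.of_le one_le_two) h.g_convex x (innerSol g x')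
    (innerSol g x)
  have h2 := norm_gradTheta_sub_le h.g_contDiff h.g_bound x x' (innerSol g x')
  rw [h.gradTheta_innerSol, sub_zero] at h1
  rw [h.gradTheta_innerSol, sub_zero] at h2
  rw [Constants.Lθstar, div_mul_eq_mul_div, le_div_iff₀ h.μpos, norm_sub_rev]
  linarith

theorem pairDist_innerSol_le (h : NodeAssumption c μ f g) (x x' : E n) :
    pairDist x x' (innerSol g x) (innerSol g x') ≤ (1 + c.Lθstar μ) * ‖x - x'‖ := by
  have h1 := pairDist_le_add x x' (innerSol g x) (innerSol g x')
  have h2 := h.norm_innerSol_sub_le x x'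
  linarith

/-- Coercivity makes the Hessian injective, hence surjective in finite dimension, so the equation
chosen by `Classical.epsilon` is solvable. -/
theorem hess_adjointSol (h : NodeAssumption c μ f g) (x : E n) :
    hessThetaTheta g x (innerSol g x) (adjointSol f g x) = gradTheta f x (innerSol g x) := by
  refine Classical.epsilon_spec (p := fun v =>
    hessThetaTheta g x (innerSol g x) v = gradTheta f x (innerSol g x)) ?_
  have hinj : Function.Injective (hessThetaTheta g x (innerSol g x) : E p →ₗ[ℝ] E p) := by
    rw [injective_iff_map_eq_zero]
    intro v hv
    have h1 := mul_norm_le_norm_hess h.g_contDiff h.g_convex x (innerSol g x) v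
    have hv' : hessThetaTheta g x (innerSol g x) v = 0 := hv
    rw [hv', norm_zero] at h1
    have h2 : ‖v‖ ≤ 0 := nonpos_of_mul_nonpos_right h1 h.μpos
    simpa using h2
  exact LinearMap.injective_iff_surjective.1 hinj _

theorem norm_adjointSol_le (h : NodeAssumption c μ f g) (x : E n) :
    ‖adjointSol f g x‖ ≤ c.M μ := by
  have h1 := mul_norm_le_norm_hess h.g_contDiff h.g_convex x (innerSol g x) (adjointSol f g x)
  rw [h.hess_adjointSol] at h1
  rw [Constants.M, le_div_iff₀ h.μpos]
  linarith [h.f_bound x]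

theorem M_nonneg (h : NodeAssumption c μ f g) : 0 ≤ c.M μ :=
  div_nonneg h.cpos.Cfθ.le h.μpos.le

theorem norm_hessThetaTheta_sub_apply_le (h : NodeAssumption c μ f g) (x x' y : E n)
    (θ θ' : E p) :
    ‖(hessThetaTheta g x θ - hessThetaTheta g x' θ') (adjointSol f g y)‖
      ≤ c.M μ * c.Lgθθ * pairDist x x' θ θ' := by
  refine (ContinuousLinearMap.le_opNorm _ _).trans ?_
  have h1 := mul_le_mul (h.g_lipThetaTheta x x' θ θ') (h.norm_adjointSol_le y) (norm_nonneg _)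
    (mul_nonneg h.cpos.Lgθθ.le (pairDist_nonneg _ _ _ _))
  linarith

theorem norm_hessXTheta_sub_apply_le (h : NodeAssumption c μ f g) (x x' y : E n)
    (θ θ' : E p) :
    ‖(hessXTheta g x θ - hessXTheta g x' θ') (adjointSol f g y)‖
      ≤ c.M μ * c.Lgxθ * pairDist x x' θ θ' := by
  refine (ContinuousLinearMap.le_opNorm _ _).trans ?_
  have h1 := mul_le_mul (h.g_lipXTheta x x' θ θ') (h.norm_adjointSol_le y) (norm_nonneg _)
    (mul_nonneg h.cpos.Lgxθ.le (pairDist_nonneg _ _ _ _))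
  linarith

/-- Apply the Hessian at x to the difference: the two defining equations leave a difference of
gradients of f and a difference of Hessians acting on the bounded vector v*(x'). Coercivity then
divides by μ. -/
theorem norm_adjointSol_sub_le (h : NodeAssumption c μ f g) (x x' : E n) :
    ‖adjointSol f g x - adjointSol f g x'‖ ≤ c.Lvstar μ * ‖x - x'‖ := by
  have h1 := mul_norm_le_norm_hess h.g_contDiff h.g_convex x (innerSol g x)
    (adjointSol f g x - adjointSol f g x')
  have h2 : hessThetaTheta g x (innerSol g x) (adjointSol f g x - adjointSol f g x')
      = (gradTheta f x (innerSol g x) - gradTheta f x' (innerSol g x'))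
        - (hessThetaTheta g x (innerSol g x) - hessThetaTheta g x' (innerSol g x'))
          (adjointSol f g x') := by
    rw [map_sub, sub_apply, h.hess_adjointSol, h.hess_adjointSol]
    abel
  rw [h2] at h1
  have h3 := h1.trans (norm_sub_le _ _)
  have h4 := h.f_lipTheta x x' (innerSol g x) (innerSol g x')
  have h5 := h.norm_hessThetaTheta_sub_apply_le x x' x' (innerSol g x) (innerSol g x')
  have h6 := mul_le_mul_of_nonneg_left (h.pairDist_innerSol_le x x')
    (add_nonneg h.cpos.Lfθ.le (mul_nonneg h.M_nonneg h.cpos.Lgθθ.le))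
  have h7 : μ * (c.Lvstar μ * ‖x - x'‖)
      = (c.Lfθ + c.M μ * c.Lgθθ) * ((1 + c.Lθstar μ) * ‖x - x'‖) := by
    have := h.μpos.ne'
    rw [Constants.Lvstar, Constants.Lv, Constants.M]
    field_simp
  exact le_of_mul_le_mul_left (by linarith) h.μpos

theorem norm_hypergrad_sub_le (h : NodeAssumption c μ f g) (x x' : E n) :
    ‖hypergrad f g x - hypergrad f g x'‖ ≤ c.L μ * ‖x - x'‖ := by
  have h1 : hypergrad f g x - hypergrad f g x'
      = (gradX f x (innerSol g x) - gradX f x' (innerSol g x'))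
        - hessXTheta g x (innerSol g x) (adjointSol f g x - adjointSol f g x')
        - (hessXTheta g x (innerSol g x) - hessXTheta g x' (innerSol g x'))
          (adjointSol f g x') := by
    rw [hypergrad, hypergrad, map_sub, sub_apply]
    abel
  have h2 := (norm_sub_le (gradX f x (innerSol g x) - gradX f x' (innerSol g x'))
    (hessXTheta g x (innerSol g x) (adjointSol f g x - adjointSol f g x')))
  have h3 := norm_sub_le ((gradX f x (innerSol g x) - gradX f x' (innerSol g x'))
        - hessXTheta g x (innerSol g x) (adjointSol f g x - adjointSol f g x'))
        ((hessXTheta g x (innerSol g x) - hessXTheta g x' (innerSol g x'))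
          (adjointSol f g x'))
  rw [← h1] at h3
  have h4 := h.f_lipX x x' (innerSol g x) (innerSol g x')
  have h5 := (hessXTheta g x (innerSol g x)).le_of_opNorm_le (h.g_bound x _)
    (adjointSol f g x - adjointSol f g x')
  have h6 := mul_le_mul_of_nonneg_left (h.norm_adjointSol_sub_le x x') h.cpos.Cgxθ.le
  have h7 := h.norm_hessXTheta_sub_apply_le x x' x' (innerSol g x) (innerSol g x')
  have h8 := mul_le_mul_of_nonneg_left (h.pairDist_innerSol_le x x')
    (add_nonneg h.cpos.Lfx.le (mul_nonneg h.M_nonneg h.cpos.Lgxθ.le))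
  have h9 : c.L μ * ‖x - x'‖ = (c.Lfx + c.M μ * c.Lgxθ) * ((1 + c.Lθstar μ) * ‖x - x'‖)
      + c.Cgxθ * (c.Lvstar μ * ‖x - x'‖) := by
    rw [Constants.L, Constants.Lvstar, Constants.M]; ring
  linarith

/-- Freeze v = v*(x₀) and consider Q(x,θ) = f(x,θ) - ⟨∇_θ g(x,θ), v⟩. On the graph of θ* the second
term vanishes, so Q agrees there with the function to be differentiated. The choice of v kills the
θ-derivative of Q at the base point, so no derivative of θ* appears. Lipschitz continuity of θ*
suffices to turn the remainder of Q into o(‖x - x₀‖). -/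
theorem hasGradientAt (h : NodeAssumption c μ f g) (x₀ : E n) :
    HasGradientAt (fun x => f x (innerSol g x)) (hypergrad f g x₀) x₀ := by
  set θ₀ := innerSol g x₀ with hθ₀
  set v := adjointSol f g x₀ with hv
  set G := fun q : E n × E p => g q.1 q.2 with hG
  have hg1 : ContDiff ℝ 1 G := h.g_contDiff.of_le one_le_two
  have hf := (h.f_contDiff.differentiable one_ne_zero (x₀, θ₀)).hasFDerivAt
  have hd := ((contDiff_fderiv h.g_contDiff).differentiable one_ne_zero
    (x₀, θ₀)).hasFDerivAt.clm_apply (hasFDerivAt_const ((0, v) : E n × E p) (x₀, θ₀))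
  have hQ := hf.sub hd
  -- The right side is free of w: the θ-part ⟨∇_θ f - H v, w⟩ is zero by the adjoint equation.
  have hQ' : ∀ u w, fderiv ℝ (fun q : E n × E p => f q.1 q.2) (x₀, θ₀) (u, w)
      - fderiv ℝ (fderiv ℝ G) (x₀, θ₀) (u, w) (0, v) = inner ℝ (hypergrad f g x₀) u := by
    intro u w
    have h1 : ((u, w) : E n × E p) = (u, 0) + (0, w) := by simp
    rw [snd_fderiv_symm h.g_contDiff, h1, map_add, map_add, ← inner_gradX h.f_contDiff,
      ← inner_gradTheta h.f_contDiff, ← inner_hessXTheta h.g_contDiff,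
      ← inner_hessThetaTheta h.g_contDiff, hv, hθ₀, h.hess_adjointSol, hypergrad,
      inner_sub_left]
    ring
  have hlip : (fun x => ((x, innerSol g x) : E n × E p) - (x₀, θ₀)) =O[𝓝 x₀]
      fun x => x - x₀ := by
    refine Asymptotics.IsBigO.of_bound (1 + c.Lθstar μ) (Eventually.of_forall fun x => ?_)
    have h1 := h.norm_innerSol_sub_le x x₀
    have h2 : 0 ≤ c.Lθstar μ := div_nonneg h.cpos.Cgxθ.le h.μpos.le
    rw [Prod.mk_sub_mk, Prod.norm_mk]
    refine max_le ?_ ?_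
    · nlinarith [norm_nonneg (x - x₀), mul_nonneg h2 (norm_nonneg (x - x₀))]
    · nlinarith [norm_nonneg (x - x₀)]
  have htend : Tendsto (fun x => ((x, innerSol g x) : E n × E p)) (𝓝 x₀) (𝓝 (x₀, θ₀)) := by
    rw [tendsto_iff_norm_sub_tendsto_zero]
    refine (hlip.trans_tendsto ?_).norm.trans (by simp)
    exact tendsto_sub_nhds_zero_iff.2 tendsto_id
  have key := ((hasFDerivAt_iff_isLittleO.1 hQ).comp_tendsto htend).trans_isBigO hlip
  rw [hasGradientAt_iff_hasFDerivAt, hasFDerivAt_iff_isLittleO]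
  refine key.congr_left fun x => ?_
  have h0 : ∀ y, fderiv ℝ G (y, innerSol g y) (0, v) = 0 := fun y => by
    rw [← inner_gradTheta hg1, h.gradTheta_innerSol, inner_zero_left]
  have h1 := hQ' (x - x₀) (innerSol g x - θ₀)
  simp only [Function.comp_apply, Prod.mk_sub_mk, Pi.sub_apply, sub_apply,
    add_apply, ContinuousLinearMap.comp_apply,
    zero_apply, map_zero, zero_add, ContinuousLinearMap.flip_apply,
    InnerProductSpace.toDual_apply_apply]
  rw [h0, hθ₀, h0, ← h1, hθ₀]
  ring

/-- Split into a gradient difference, the mixed Hessian acting on the error of v, and a Hessian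
difference acting on v*. Then (a+b+c)² ≤ 2a² + 4b² + 4c² yields the coefficients 2 and 4 found in
`Lfgx`. -/
theorem norm_direction_sub_hypergrad_sq_le (h : NodeAssumption c μ f g) (y x : E n)
    (θ v : E p) :
    ‖(gradX f x θ - hessXTheta g x θ v) - hypergrad f g y‖ ^ 2
      ≤ c.Lfgx μ * (‖x - y‖ ^ 2 + ‖θ - innerSol g y‖ ^ 2)
        + 4 * c.Cgxθ ^ 2 * ‖v - adjointSol f g y‖ ^ 2 := by
  have h1 : (gradX f x θ - hessXTheta g x θ v) - hypergrad f g y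
      = (gradX f x θ - gradX f y (innerSol g y))
        - hessXTheta g x θ (v - adjointSol f g y)
        - (hessXTheta g x θ - hessXTheta g y (innerSol g y)) (adjointSol f g y) := by
    rw [hypergrad, map_sub, sub_apply]
    abel
  have h2 := norm_sub_le (gradX f x θ - gradX f y (innerSol g y))
        (hessXTheta g x θ (v - adjointSol f g y))
  have h3 := norm_sub_le ((gradX f x θ - gradX f y (innerSol g y))
        - hessXTheta g x θ (v - adjointSol f g y))
        ((hessXTheta g x θ - hessXTheta g y (innerSol g y)) (adjointSol f g y))
  rw [← h1] at h3
  have h4 := h.f_lipX x y θ (innerSol g y)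
  have h5 := (hessXTheta g x θ).le_of_opNorm_le (h.g_bound x θ) (v - adjointSol f g y)
  have h7 := h.norm_hessXTheta_sub_apply_le x y y θ (innerSol g y)
  rw [← pairDist_sq]
  set d := pairDist x y θ (innerSol g y)
  set e := ‖v - adjointSol f g y‖
  have h8 : ‖(gradX f x θ - hessXTheta g x θ v) - hypergrad f g y‖
      ≤ c.Lfx * d + c.Cgxθ * e + c.M μ * c.Lgxθ * d := by linarith
  refine (pow_le_pow_left₀ (norm_nonneg _) h8 2).trans ?_
  rw [Constants.Lfgx]
  nlinarith [sq_nonneg (c.Lfx * d - (c.Cgxθ * e + c.M μ * c.Lgxθ * d)),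
    sq_nonneg (c.Cgxθ * e - c.M μ * c.Lgxθ * d)]

/-- The point v*(y) is fixed by the step taken at (y, θ*(y)). The actual step therefore applies I -
λH to the error and adds λ times the inexactness of the linear system, plus the motion of v*. -/
theorem adjoint_step_sq_le (h : NodeAssumption c μ f g) {lam : ℝ} (hl : 0 < lam)
    (hl1 : lam * μ ≤ 1) (hl2 : lam * (μ + c.Lgθ) ≤ 2) (y y' x : E n) (θ v : E p) :
    ‖v - lam • (hessThetaTheta g x θ v - gradTheta f x θ) - adjointSol f g y'‖ ^ 2
      ≤ (1 - lam * μ) * ‖v - adjointSol f g y‖ ^ 2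
        + 2 * lam / μ * c.Lfgθ μ * (‖x - y‖ ^ 2 + ‖θ - innerSol g y‖ ^ 2)
        + 2 / (lam * μ) * c.Lvstar μ ^ 2 * ‖y - y'‖ ^ 2 := by
  set vs := adjointSol f g y with hvs
  have h1 : v - lam • (hessThetaTheta g x θ v - gradTheta f x θ) - adjointSol f g y'
      = ((v - vs) - lam • hessThetaTheta g x θ (v - vs))
        + (lam • ((gradTheta f x θ - gradTheta f y (innerSol g y))
            - (hessThetaTheta g x θ - hessThetaTheta g y (innerSol g y)) vs)
          + (vs - adjointSol f g y')) := by
    rw [map_sub, sub_apply, hvs, h.hess_adjointSol]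
    module
  have h2 := norm_sub_smul_hess_le h.g_contDiff h.g_convex h.cpos.Lgθ.le h.g_lipTheta hl.le hl2
    x θ (v - vs)
  have h4 := h.f_lipTheta x y θ (innerSol g y)
  have h5 := h.norm_hessThetaTheta_sub_apply_le x y y θ (innerSol g y)
  have h6 := h.norm_adjointSol_sub_le y y'
  rw [← pairDist_sq]
  rw [← hvs] at h5 h6
  set d := pairDist x y θ (innerSol g y) with hd
  have hd0 : 0 ≤ d := pairDist_nonneg _ _ _ _
  have h7 : ‖(gradTheta f x θ - gradTheta f y (innerSol g y))
            - (hessThetaTheta g x θ - hessThetaTheta g y (innerSol g y)) vs‖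
            ≤ (c.Lfθ + c.M μ * c.Lgθθ) * d := by
    refine (norm_sub_le _ _).trans ?_
    linarith
  have h8 : ‖lam • ((gradTheta f x θ - gradTheta f y (innerSol g y))
            - (hessThetaTheta g x θ - hessThetaTheta g y (innerSol g y)) vs)
          + (vs - adjointSol f g y')‖
      ≤ lam * ((c.Lfθ + c.M μ * c.Lgθθ) * d) + c.Lvstar μ * ‖y - y'‖ := by
    refine (norm_add_le _ _).trans (add_le_add ?_ h6)
    rw [norm_smul, Real.norm_eq_abs, abs_of_pos hl]
    exact mul_le_mul_of_nonneg_left h7 hl.le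
  rw [h1]
  have h9 := (norm_add_le _ _).trans (add_le_add h2 h8)
  refine (pow_le_pow_left₀ (norm_nonneg _) h9 2).trans ?_
  have hlm := mul_pos hl h.μpos
  refine (sq_convex_combination_le hlm hl1 _ _).trans ?_
  rw [add_assoc]
  refine add_le_add le_rfl ?_
  have h10 : (lam * ((c.Lfθ + c.M μ * c.Lgθθ) * d) + c.Lvstar μ * ‖y - y'‖) ^ 2
      ≤ 2 * lam ^ 2 * (c.Lfgθ μ * d ^ 2) + 2 * (c.Lvstar μ ^ 2 * ‖y - y'‖ ^ 2) := by
    have h11 : (c.Lfθ + c.M μ * c.Lgθθ) ^ 2 ≤ c.Lfgθ μ := by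
      rw [Constants.Lfgθ]
      nlinarith [sq_nonneg (c.Lfθ - c.M μ * c.Lgθθ), sq_nonneg (c.M μ * c.Lgθθ)]
    have h12 := mul_le_mul_of_nonneg_left h11 (by positivity : 0 ≤ 2 * lam ^ 2 * d ^ 2)
    nlinarith [sq_nonneg (lam * ((c.Lfθ + c.M μ * c.Lgθθ) * d) - c.Lvstar μ * ‖y - y'‖)]
  refine (div_le_div_of_nonneg_right h10 hlm.le).trans (le_of_eq ?_)
  have := h.μpos.ne'
  field_simp

theorem inner_step_sq_le (h : NodeAssumption c μ f g) (hμ : μ ≤ c.Lgθ) {β : ℝ} (hβ : 0 < β)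
    (hβ2 : β * (μ + c.Lgθ) ≤ 2) (y y' x : E n) (θ : E p) :
    ‖θ - β • gradTheta g x θ - innerSol g y'‖ ^ 2
      ≤ (1 - 2 * β * c.ωθ μ) * ‖θ - innerSol g y‖ ^ 2
        + 1 / (β * c.ωθ μ) * (β ^ 2 * c.Cgxθ ^ 2 * ‖x - y‖ ^ 2
          + c.Lθstar μ ^ 2 * ‖y - y'‖ ^ 2) := by
  have hμ0 := h.μpos
  have hL0 := h.cpos.Lgθ
  have hω : 0 < c.ωθ μ := by rw [Constants.ωθ]; positivity
  have hω2 : 2 * c.ωθ μ ≤ μ := by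
    rw [Constants.ωθ, ← mul_div_assoc, div_le_iff₀ (by positivity)]
    nlinarith
  have hβμ : β * μ ≤ 1 := by nlinarith
  set θs := innerSol g y with hθs
  have h1 : θ - β • gradTheta g x θ - innerSol g y'
      = ((θ - β • gradTheta g y θ) - (θs - β • gradTheta g y θs))
        + (-(β • (gradTheta g x θ - gradTheta g y θ)) + (θs - innerSol g y')) := by
    rw [hθs, h.gradTheta_innerSol]
    module
  have h2 := gradient_step_contracts h.g_contDiff h.g_convex h.cpos.Lgθ.le h.g_lipTheta hβ.le
    hβ2 hβμ y θ θs
  have h3 := norm_gradTheta_sub_le h.g_contDiff h.g_bound x y θ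
  have h4 := h.norm_innerSol_sub_le y y'
  have h5 : ‖-(β • (gradTheta g x θ - gradTheta g y θ)) + (θs - innerSol g y')‖
      ≤ β * (c.Cgxθ * ‖x - y‖) + c.Lθstar μ * ‖y - y'‖ := by
    refine (norm_add_le _ _).trans (add_le_add ?_ h4)
    rw [norm_neg, norm_smul, Real.norm_eq_abs, abs_of_pos hβ]
    exact mul_le_mul_of_nonneg_left h3 hβ.le
  -- The rate is relaxed from μ to 2ω = μL_g/(μ + L_g), the form in which it enters the step-size
  -- conditions.
  have h6 : (1 - β * μ) * ‖θ - θs‖ ≤ (1 - β * (2 * c.ωθ μ)) * ‖θ - θs‖ := by gcongr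
  rw [h1]
  have h9 := (norm_add_le _ _).trans (add_le_add (h2.trans h6) h5)
  refine (pow_le_pow_left₀ (norm_nonneg _) h9 2).trans ?_
  have h10 : β * (2 * c.ωθ μ) ≤ 1 := (mul_le_mul_of_nonneg_left hω2 hβ.le).trans hβμ
  refine (sq_convex_combination_le (by positivity) h10 _ _).trans ?_
  refine add_le_add (le_of_eq (by ring)) ?_
  have h11 : (β * (c.Cgxθ * ‖x - y‖) + c.Lθstar μ * ‖y - y'‖) ^ 2
      ≤ 2 * (β ^ 2 * c.Cgxθ ^ 2 * ‖x - y‖ ^ 2 + c.Lθstar μ ^ 2 * ‖y - y'‖ ^ 2) := by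
    nlinarith [sq_nonneg (β * (c.Cgxθ * ‖x - y‖) - c.Lθstar μ * ‖y - y'‖)]
  refine (div_le_div_of_nonneg_right h11 (by positivity)).trans (le_of_eq ?_)
  field_simp

end NodeAssumption

/-! ### Averages over the nodes and mixing -/

/-- The average of a family of vectors. -/
noncomputable def mean {m n : ℕ} (a : Fin m → E n) : E n := (1 / (m : ℝ)) • ∑ i, a i

/-- The mean square of a family of vectors. -/
noncomputable def meanSq {m n : ℕ} (a : Fin m → E n) : ℝ := (1 / (m : ℝ)) * ∑ i, ‖a i‖ ^ 2

section Mean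

variable {m n : ℕ}

theorem meanSq_nonneg (a : Fin m → E n) : 0 ≤ meanSq a := by
  unfold meanSq; positivity

theorem mean_add (a b : Fin m → E n) : mean (fun i => a i + b i) = mean a + mean b := by
  simp only [mean, Finset.sum_add_distrib, smul_add]

theorem mean_sub (a b : Fin m → E n) : mean (fun i => a i - b i) = mean a - mean b := by
  simp only [mean, Finset.sum_sub_distrib, smul_sub]

theorem mean_smul (r : ℝ) (a : Fin m → E n) : mean (fun i => r • a i) = r • mean a := by
  simp only [mean, ← Finset.smul_sum, smul_comm r]

theorem mean_const (hm : 0 < m) (a : E n) : mean (fun _ : Fin m => a) = a := by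
  have : (m : ℝ) ≠ 0 := by positivity
  simp only [mean, Finset.sum_const, Finset.card_univ, Fintype.card_fin]
  rw [← Nat.cast_smul_eq_nsmul ℝ, smul_smul, one_div, inv_mul_cancel₀ this, one_smul]

theorem meanSq_le_of_le {a : Fin m → E n} {b : Fin m → ℝ} (h : ∀ i, ‖a i‖ ^ 2 ≤ b i) :
    meanSq a ≤ (1 / (m : ℝ)) * ∑ i, b i :=
  mul_le_mul_of_nonneg_left (Finset.sum_le_sum fun i _ => h i) (by positivity)

/-- The bias-variance decomposition. -/
theorem meanSq_eq (hm : 0 < m) (a : Fin m → E n) :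
    meanSq a = ‖mean a‖ ^ 2 + meanSq fun i => a i - mean a := by
  have hm' : (m : ℝ) ≠ 0 := by positivity
  have h1 : ∀ i, ‖a i‖ ^ 2 = ‖a i - mean a‖ ^ 2 + 2 * inner ℝ (a i) (mean a) - ‖mean a‖ ^ 2 := by
    intro i
    rw [norm_sub_sq_real]; ring
  have h2 : ∑ i, a i = (m : ℝ) • mean a := by
    rw [mean, smul_smul, mul_one_div_cancel hm', one_smul]
  simp only [meanSq]
  rw [Finset.sum_congr rfl fun i _ => h1 i, Finset.sum_sub_distrib, Finset.sum_add_distrib,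
    ← Finset.mul_sum, ← sum_inner, h2, inner_smul_left, real_inner_self_eq_norm_sq]
  simp only [Finset.sum_const, Finset.card_univ, Fintype.card_fin, nsmul_eq_mul, conj_trivial]
  field_simp
  ring

theorem norm_mean_sq_le (hm : 0 < m) (a : Fin m → E n) : ‖mean a‖ ^ 2 ≤ meanSq a := by
  rw [meanSq_eq hm]
  exact le_add_of_nonneg_right (meanSq_nonneg _)

theorem meanSq_sub_mean_le (hm : 0 < m) (a : Fin m → E n) :
    meanSq (fun i => a i - mean a) ≤ meanSq a := by
  rw [meanSq_eq hm a]
  exact le_add_of_nonneg_left (sq_nonneg _)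

theorem norm_add_sq_le_young {V : Type*} [SeminormedAddCommGroup V] {s : ℝ} (hs : 0 < s)
    (u w : V) : ‖u + w‖ ^ 2 ≤ (1 + s) * ‖u‖ ^ 2 + (1 + 1 / s) * ‖w‖ ^ 2 := by
  have h1 := pow_le_pow_left₀ (norm_nonneg _) (norm_add_le u w) 2
  have h2 : (1 + s) * ‖u‖ ^ 2 + (1 + 1 / s) * ‖w‖ ^ 2 - (‖u‖ + ‖w‖) ^ 2
      = (s * ‖u‖ - ‖w‖) ^ 2 / s := by field_simp; ring
  have h3 : 0 ≤ (s * ‖u‖ - ‖w‖) ^ 2 / s := by positivity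
  linarith

theorem norm_convex_combination_sq_le {V : Type*} [SeminormedAddCommGroup V] [NormedSpace ℝ V]
    {t : ℝ} (h0 : 0 ≤ t) (h1 : t ≤ 1) (u w : V) :
    ‖(1 - t) • u + t • w‖ ^ 2 ≤ (1 - t) * ‖u‖ ^ 2 + t * ‖w‖ ^ 2 := by
  have h2 : ‖(1 - t) • u + t • w‖ ≤ (1 - t) * ‖u‖ + t * ‖w‖ := by
    refine (norm_add_le _ _).trans (le_of_eq ?_)
    rw [norm_smul, norm_smul, Real.norm_of_nonneg h0, Real.norm_of_nonneg (sub_nonneg.2 h1)]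
  refine (pow_le_pow_left₀ (norm_nonneg _) h2 2).trans ?_
  nlinarith [mul_nonneg (mul_nonneg h0 (sub_nonneg.2 h1)) (sq_nonneg (‖u‖ - ‖w‖))]

theorem norm_add_sq_le_two {V : Type*} [SeminormedAddCommGroup V] (u w : V) :
    ‖u + w‖ ^ 2 ≤ 2 * ‖u‖ ^ 2 + 2 * ‖w‖ ^ 2 := by
  have := norm_add_sq_le_young one_pos u w
  linarith

theorem norm_sub_sq_le_two {V : Type*} [SeminormedAddCommGroup V] (u w : V) :
    ‖u - w‖ ^ 2 ≤ 2 * ‖u‖ ^ 2 + 2 * ‖w‖ ^ 2 := by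
  simpa [sub_eq_add_neg] using norm_add_sq_le_two u (-w)

/-- The matrix acts on each of the n coordinates separately, so its spectral norm on ℝ^m applies
coordinate by coordinate. -/
theorem sum_norm_mulVec_sq_le (A : Matrix (Fin m) (Fin m) ℝ) (a : Fin m → E n) :
    ∑ i, ‖∑ j, A i j • a j‖ ^ 2
      ≤ ‖Matrix.toEuclideanCLM (n := Fin m) (𝕜 := ℝ) A‖ ^ 2 * ∑ i, ‖a i‖ ^ 2 := by
  have h1 : ∀ u : Fin n, ∑ i, (∑ j, A i j * a j u) ^ 2
      ≤ ‖Matrix.toEuclideanCLM (n := Fin m) (𝕜 := ℝ) A‖ ^ 2 * ∑ i, (a i u) ^ 2 := by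
    intro u
    have h2 := pow_le_pow_left₀ (norm_nonneg _)
      ((Matrix.toEuclideanCLM (n := Fin m) (𝕜 := ℝ) A).le_opNorm
        (WithLp.toLp 2 fun j => a j u)) 2
    rw [mul_pow, EuclideanSpace.norm_sq_eq, EuclideanSpace.norm_sq_eq] at h2
    simpa [Matrix.toEuclideanCLM_toLp, Matrix.mulVec, dotProduct] using h2
  have h3 : ∀ b : Fin m → E n, ∑ i, ‖b i‖ ^ 2 = ∑ u, ∑ i, (b i u) ^ 2 := by
    intro b
    rw [Finset.sum_comm]
    refine Finset.sum_congr rfl fun i _ => ?_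
    rw [EuclideanSpace.norm_sq_eq]
    simp
  rw [h3, h3 a, Finset.mul_sum]
  refine Finset.sum_le_sum fun u _ => ?_
  simpa using h1 u

variable {W : Matrix (Fin m) (Fin m) ℝ}

theorem mean_mixing (hW : W ∈ doublyStochastic ℝ (Fin m)) (a : Fin m → E n) :
    mean (fun i => ∑ j, W i j • a j) = mean a := by
  simp only [mean]
  rw [Finset.sum_comm]
  congr 1
  refine Finset.sum_congr rfl fun j _ => ?_
  rw [← Finset.sum_smul, sum_col_of_mem_doublyStochastic hW, one_smul]

/-- Deviations have mean zero, so W and W - (1/m)11ᵀ act on them alike; since the rows of W sum to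
1, the result is the mixed family minus its average. -/
theorem meanSq_mixing_le (hm : 0 < m) (hW : W ∈ doublyStochastic ℝ (Fin m))
    (a : Fin m → E n) :
    meanSq (fun i => (∑ j, W i j • a j) - mean a)
      ≤ rho W * meanSq fun i => a i - mean a := by
  have h1 := sum_norm_mulVec_sq_le (W - Matrix.of fun _ _ => 1 / (m : ℝ))
    fun i => a i - mean a
  have h2 : ∀ i, ∑ j, (W - Matrix.of fun _ _ => 1 / (m : ℝ) : Matrix (Fin m) (Fin m) ℝ) i j • (a j - mean a)
      = (∑ j, W i j • a j) - mean a := by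
    intro i
    have h3 := mean_sub a fun _ => mean a
    rw [mean_const hm, sub_self] at h3
    simp only [Matrix.sub_apply, Matrix.of_apply, sub_smul, Finset.sum_sub_distrib]
    rw [← Finset.smul_sum]
    change _ - mean (fun j => a j - mean a) = _
    rw [h3, sub_zero]
    simp only [smul_sub, Finset.sum_sub_distrib]
    rw [← Finset.sum_smul, sum_row_of_mem_doublyStochastic hW, one_smul]
  simp only [h2] at h1
  simp only [meanSq]
  rw [mul_left_comm]
  exact mul_le_mul_of_nonneg_left h1 (by positivity)

/-- Perturbed mixing contracts the deviations from the average. -/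
theorem meanSq_mixing_add_le (hm : 0 < m) (hW : W ∈ doublyStochastic ℝ (Fin m))
    (hρ : rho W < 1) (a b : Fin m → E n) :
    meanSq (fun i => (∑ j, W i j • a j) - mean a + b i)
      ≤ (1 - (1 - rho W) / 2) * meanSq (fun i => a i - mean a)
        + 3 / (1 - rho W) * meanSq b := by
  -- With this Young parameter, (1+s)ρ = (1+s)(1-2s) ≤ 1 - s, and 1 + 1/s ≤ 3/(1-ρ).
  set s := (1 - rho W) / 2 with hs
  have hρ0 : 0 ≤ rho W := sq_nonneg _
  have hs0 : 0 < s := by rw [hs]; linarith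
  have h1 := meanSq_le_of_le fun i =>
    norm_add_sq_le_young hs0 ((∑ j, W i j • a j) - mean a) (b i)
  rw [Finset.sum_add_distrib, ← Finset.mul_sum, ← Finset.mul_sum, mul_add,
    mul_left_comm, mul_left_comm (1 / (m : ℝ))] at h1
  change _ ≤ (1 + s) * meanSq _ + (1 + 1 / s) * meanSq b at h1
  refine h1.trans (add_le_add ?_ ?_)
  · have h2 := mul_le_mul_of_nonneg_left (meanSq_mixing_le hm hW a)
      (by positivity : 0 ≤ 1 + s)
    refine h2.trans ?_
    rw [← mul_assoc]
    refine mul_le_mul_of_nonneg_right ?_ (meanSq_nonneg _)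
    rw [hs]
    nlinarith [sq_nonneg (1 - rho W)]
  · refine mul_le_mul_of_nonneg_right ?_ (meanSq_nonneg _)
    have h3 : 1 / s = 2 / (1 - rho W) := by rw [hs]; field_simp
    rw [h3, ← sub_nonneg]
    have h4 : 3 / (1 - rho W) - (1 + 2 / (1 - rho W)) = rho W / (1 - rho W) := by
      have : 1 - rho W ≠ 0 := by linarith
      field_simp
      ring
    rw [h4]
    exact div_nonneg hρ0 (by linarith)

end Mean

/-! ### Functions with a Lipschitz gradient -/

/-- On [0,1] compare t ↦ F(x + td) with the quadratic of the same value at 0 whose derivative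
dominates by the Lipschitz bound. -/
theorem descent_lemma {n : ℕ} {F : E n → ℝ} {G : E n → E n} {L : ℝ}
    (hF : ∀ x, HasGradientAt F (G x) x) (hG : ∀ x x', ‖G x - G x'‖ ≤ L * ‖x - x'‖)
    (x d : E n) : F (x + d) ≤ F x + inner ℝ (G x) d + L / 2 * ‖d‖ ^ 2 := by
  have h1 : ∀ t : ℝ, HasDerivAt (fun t : ℝ => F (x + t • d)) (inner ℝ (G (x + t • d)) d) t := by
    intro t
    have h2 : HasDerivAt (fun t : ℝ => x + t • d) d t := by
      simpa using ((hasDerivAt_id t).smul_const d).const_add x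
    exact (hF (x + t • d)).hasFDerivAt.comp_hasDerivAt t h2
  have h3 : ∀ t : ℝ, HasDerivAt (fun t : ℝ => F x + t * inner ℝ (G x) d + L / 2 * ‖d‖ ^ 2 * t ^ 2)
      (inner ℝ (G x) d + L / 2 * ‖d‖ ^ 2 * (2 * t)) t := by
    intro t
    have h4 := (((hasDerivAt_id t).mul_const (inner ℝ (G x) d)).const_add (F x)).add
      (((hasDerivAt_id t).pow 2).const_mul (L / 2 * ‖d‖ ^ 2))
    refine h4.congr_deriv ?_
    simp
  have h5 := image_le_of_deriv_right_le_deriv_boundary (a := 0) (b := 1)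
    (fun t _ => (h1 t).continuousAt.continuousWithinAt)
    (fun t _ => (h1 t).hasDerivWithinAt)
    (by simp) (fun t _ => (h3 t).continuousAt.continuousWithinAt)
    (fun t _ => (h3 t).hasDerivWithinAt) (fun t ht => ?_)
    (Set.right_mem_Icc.2 zero_le_one)
  · simpa using h5
  · have h6 := real_inner_le_norm (G (x + t • d) - G x) d
    have h7 := hG (x + t • d) x
    rw [add_sub_cancel_left, norm_smul, Real.norm_of_nonneg ht.1] at h7
    rw [inner_sub_left] at h6
    nlinarith [mul_le_mul_of_nonneg_right h7 (norm_nonneg d)]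

/-! ### Descent of the Lyapunov function -/

namespace Constants

variable {c : Constants} {μ : ℝ}

theorem Pos.Lθstar_pos (hc : c.Pos) (hμ : 0 < μ) : 0 < c.Lθstar μ := div_pos hc.Cgxθ hμ

theorem Pos.Lv_pos (hc : c.Pos) (hμ : 0 < μ) : 0 < c.Lv μ := by
  have h1 := hc.Lfθ; have h2 := hc.Cfθ; have h3 := hc.Lgθθ
  unfold Lv; positivity

theorem Pos.Lvstar_pos (hc : c.Pos) (hμ : 0 < μ) : 0 < c.Lvstar μ := by
  have h1 := hc.Lv_pos hμ; have h2 := hc.Lθstar_pos hμ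
  unfold Lvstar; positivity

theorem Pos.L_pos (hc : c.Pos) (hμ : 0 < μ) : 0 < c.L μ := by
  have h1 := hc.Lv_pos hμ; have h2 := hc.Lθstar_pos hμ; have h3 := hc.Lfx
  have h4 := hc.Cgxθ; have h5 := hc.Cfθ; have h6 := hc.Lgxθ
  unfold L; positivity

theorem Pos.Lfgx_pos (hc : c.Pos) (μ : ℝ) : 0 < c.Lfgx μ := by
  have h1 := hc.Lfx
  unfold Lfgx; positivity

theorem Pos.Lfgθ_pos (hc : c.Pos) (μ : ℝ) : 0 < c.Lfgθ μ := by
  have h1 := hc.Lfθ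
  unfold Lfgθ; positivity

theorem Pos.ωθ_pos (hc : c.Pos) (hμ : 0 < μ) : 0 < c.ωθ μ := by
  have h1 := hc.Lgθ
  unfold ωθ; positivity

theorem Pos.P_pos (hc : c.Pos) (μ : ℝ) : 0 < c.P μ := by
  have h1 := hc.Lfgx_pos μ; have h2 := hc.Lfgθ_pos μ
  unfold P; positivity

theorem Pos.φ_pos (hc : c.Pos) (μ : ℝ) : 0 < c.φ μ := by
  have h1 := hc.P_pos μ
  unfold φ; positivity

end Constants

/-- The relations between the step-sizes on which the analysis rests. -/
structure StepBounds (c : Constants) (μ ρ : ℝ) (t : StepSizes) : Prop where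
  τ_pos : 0 < t.τ
  τ_lt : t.τ < 1
  α_pos : 0 < t.α
  γ_pos : 0 < t.γ
  γ_lt : t.γ < 1
  lam_pos : 0 < t.lam
  β_pos : 0 < t.β
  lam_mul : t.lam * μ ≤ 1
  lam_le : t.lam * (μ + c.Lgθ) ≤ 2
  β_le : t.β * (μ + c.Lgθ) ≤ 2
  α_le : 2 * c.L μ * (t.τ * t.α) ≤ 1
  γ_lower : 4 * c.L μ * (t.τ * t.α) ≤ t.γ
  lam_lower : 48 * c.Lvstar μ * c.Cgxθ * (t.τ * t.α) ≤ t.lam * μ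
  β_lower : 6 * c.Lθstar μ * Real.sqrt (c.P μ) * (t.τ * t.α) ≤ t.β * c.ωθ μ
  αγ_le : 864 * c.φ μ * (t.α * t.γ) ^ 2 ≤ (1 - ρ) ^ 4

/-- The error part of the Lyapunov function, as a combination of the mean square errors of
`z`, `v`, `θ`, `x`, `y`. -/
noncomputable def errorEnergy (c : Constants) (μ ρ : ℝ) (t : StepSizes) (Z V Θ X Y : ℝ) : ℝ :=
  3 * (t.τ * t.α) / (4 * t.γ) * Z + 8 * c.Cgxθ ^ 2 * (t.τ * t.α) / (t.lam * μ) * V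
    + c.P μ * (t.τ * t.α) / (t.β * c.ωθ μ) * Θ + 4 * c.φ μ * t.α / (1 - ρ) * X
    + 24 * c.φ μ * t.τ * t.α ^ 3 / (1 - ρ) ^ 3 * Y

/-! ### Scalar inequalities balancing the terms of the Lyapunov function. -/

section Scalar

variable {c : Constants} {μ ρ : ℝ} {t : StepSizes}

/-- The weight is inversely proportional to the rate γ, so the decrease is (3/4)T Z whatever γ is.
The drift coefficient is (3/2)(LT/γ)², at most 3/32 because γ ≥ 4LT. The bounds for `v` and `θ`
follow the same pattern. -/
theorem StepBounds.z_energy_le (hc : c.Pos) (hμ : 0 < μ) (h : StepBounds c μ ρ t)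
    {Z Z' S q : ℝ} (hq : 0 ≤ q)
    (hZ : Z' ≤ (1 - t.γ) * Z + 2 * t.γ * S + 2 / t.γ * c.L μ ^ 2 * (t.τ * t.α) ^ 2 * q) :
    3 * (t.τ * t.α) / (4 * t.γ) * Z' ≤ 3 * (t.τ * t.α) / (4 * t.γ) * Z
      + t.τ * t.α * (-(3 / 4) * Z + 3 / 2 * S + 3 / 32 * q) := by
  have hγ := h.γ_pos
  have hT : 0 < t.τ * t.α := mul_pos h.τ_pos h.α_pos
  set T := t.τ * t.α
  refine (mul_le_mul_of_nonneg_left hZ (by positivity)).trans ?_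
  have h1 : (c.L μ * T / t.γ) ^ 2 ≤ (1 / 4) ^ 2 := by
    have := (hc.L_pos hμ).le
    refine pow_le_pow_left₀ (by positivity) ?_ 2
    rw [div_le_iff₀ hγ]
    linarith [h.γ_lower]
  have h2 := mul_le_mul_of_nonneg_left h1 (by positivity : 0 ≤ 3 / 2 * T * q)
  have h3 : 3 * T / (4 * t.γ) * ((1 - t.γ) * Z + 2 * t.γ * S
      + 2 / t.γ * c.L μ ^ 2 * T ^ 2 * q) = 3 * T / (4 * t.γ) * Z
      + T * (-(3 / 4) * Z + 3 / 2 * S) + 3 / 2 * T * q * (c.L μ * T / t.γ) ^ 2 := by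
    field_simp
    ring
  rw [h3]
  linarith

theorem StepBounds.v_energy_le (hc : c.Pos) (hμ : 0 < μ) (h : StepBounds c μ ρ t)
    {V V' D q : ℝ} (hq : 0 ≤ q)
    (hV : V' ≤ (1 - t.lam * μ) * V + 2 * t.lam / μ * c.Lfgθ μ * D
      + 2 / (t.lam * μ) * c.Lvstar μ ^ 2 * (t.τ * t.α) ^ 2 * q) :
    8 * c.Cgxθ ^ 2 * (t.τ * t.α) / (t.lam * μ) * V'
      ≤ 8 * c.Cgxθ ^ 2 * (t.τ * t.α) / (t.lam * μ) * V
      + t.τ * t.α * (-(8 * c.Cgxθ ^ 2) * V + 16 * c.Cgxθ ^ 2 * c.Lfgθ μ / μ ^ 2 * D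
        + 1 / 144 * q) := by
  have hl := h.lam_pos
  have hT : 0 < t.τ * t.α := mul_pos h.τ_pos h.α_pos
  set T := t.τ * t.α
  have hC := hc.Cgxθ
  refine (mul_le_mul_of_nonneg_left hV (by positivity)).trans ?_
  have h1 : (c.Lvstar μ * c.Cgxθ * T / (t.lam * μ)) ^ 2 ≤ (1 / 48) ^ 2 := by
    have := (hc.Lvstar_pos hμ).le
    refine pow_le_pow_left₀ (by positivity) ?_ 2
    rw [div_le_iff₀ (by positivity)]
    linarith [h.lam_lower]
  have h2 := mul_le_mul_of_nonneg_left h1 (by positivity : 0 ≤ 16 * T * q)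
  have h3 : 8 * c.Cgxθ ^ 2 * T / (t.lam * μ) * ((1 - t.lam * μ) * V
      + 2 * t.lam / μ * c.Lfgθ μ * D + 2 / (t.lam * μ) * c.Lvstar μ ^ 2 * T ^ 2 * q)
      = 8 * c.Cgxθ ^ 2 * T / (t.lam * μ) * V
      + T * (-(8 * c.Cgxθ ^ 2) * V + 16 * c.Cgxθ ^ 2 * c.Lfgθ μ / μ ^ 2 * D)
      + 16 * T * q * (c.Lvstar μ * c.Cgxθ * T / (t.lam * μ)) ^ 2 := by
    field_simp
    ring
  rw [h3]
  linarith

theorem StepBounds.theta_energy_le (hc : c.Pos) (hμ : 0 < μ) (h : StepBounds c μ ρ t)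
    {Θ Θ' X q : ℝ} (hX : 0 ≤ X) (hq : 0 ≤ q)
    (hΘ : Θ' ≤ (1 - 2 * t.β * c.ωθ μ) * Θ + 1 / (t.β * c.ωθ μ)
      * (t.β ^ 2 * c.Cgxθ ^ 2 * X + c.Lθstar μ ^ 2 * ((t.τ * t.α) ^ 2 * q))) :
    c.P μ * (t.τ * t.α) / (t.β * c.ωθ μ) * Θ' ≤ c.P μ * (t.τ * t.α) / (t.β * c.ωθ μ) * Θ
      + t.τ * t.α * (-(2 * c.P μ) * Θ + c.φ μ / 4 * X + 1 / 36 * q) := by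
  have hβ := h.β_pos
  have hω := hc.ωθ_pos hμ
  have hP := hc.P_pos μ
  have hT : 0 < t.τ * t.α := mul_pos h.τ_pos h.α_pos
  set T := t.τ * t.α
  refine (mul_le_mul_of_nonneg_left hΘ (by positivity)).trans ?_
  have h1 : (c.Lθstar μ * Real.sqrt (c.P μ) * T / (t.β * c.ωθ μ)) ^ 2 ≤ (1 / 6) ^ 2 := by
    have := (hc.Lθstar_pos hμ).le
    refine pow_le_pow_left₀ (by positivity) ?_ 2
    rw [div_le_iff₀ (by positivity)]
    linarith [h.β_lower]
  rw [div_pow, mul_pow, mul_pow, Real.sq_sqrt hP.le] at h1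
  have h2 := mul_le_mul_of_nonneg_left h1 (by positivity : 0 ≤ T * q)
  -- The summand 4 max²/ω² in φ is there to absorb the consensus error entering through the inner
  -- step.
  have h4 : c.P μ * c.Cgxθ ^ 2 / c.ωθ μ ^ 2 ≤ c.φ μ / 4 := by
    have h5 : c.Cgxθ ^ 2 ≤ (max c.Lgθ c.Cgxθ) ^ 2 :=
      pow_le_pow_left₀ hc.Cgxθ.le (le_max_right _ _) 2
    have h6 : c.φ μ / 4 = c.P μ / 4 + c.P μ * (max c.Lgθ c.Cgxθ) ^ 2 / c.ωθ μ ^ 2 := by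
      rw [Constants.φ]; ring
    have h7 : c.P μ * c.Cgxθ ^ 2 / c.ωθ μ ^ 2
        ≤ c.P μ * (max c.Lgθ c.Cgxθ) ^ 2 / c.ωθ μ ^ 2 := by gcongr
    linarith
  have h8 := mul_le_mul_of_nonneg_left h4 (by positivity : 0 ≤ T * X)
  have h3 : c.P μ * T / (t.β * c.ωθ μ) * ((1 - 2 * t.β * c.ωθ μ) * Θ + 1 / (t.β * c.ωθ μ)
      * (t.β ^ 2 * c.Cgxθ ^ 2 * X + c.Lθstar μ ^ 2 * (T ^ 2 * q)))
      = c.P μ * T / (t.β * c.ωθ μ) * Θ + T * (-(2 * c.P μ) * Θ)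
      + T * X * (c.P μ * c.Cgxθ ^ 2 / c.ωθ μ ^ 2)
      + T * q * (c.Lθstar μ ^ 2 * c.P μ * T ^ 2 / (t.β * c.ωθ μ) ^ 2) := by
    field_simp
    ring
  rw [h3]
  linarith

/-- The weight of Y is chosen so that its contraction cancels exactly the Y term in the recursion
for X. What Y receives is 144φτα³γ²R/(1-ρ)⁴, at most ταR/6 by `αγ_le`. -/
theorem StepBounds.xy_energy_le (hρ : ρ < 1) (hc : c.Pos)
    (h : StepBounds c μ ρ t) {X X' Y Y' R : ℝ} (hR : 0 ≤ R)
    (hX : X' ≤ (1 - t.τ * (1 - ρ) / 2) * X + 3 * t.τ * t.α ^ 2 / (1 - ρ) * Y)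
    (hY : Y' ≤ (1 - (1 - ρ) / 2) * Y + 3 / (1 - ρ) * (t.γ ^ 2 * (2 * R))) :
    4 * c.φ μ * t.α / (1 - ρ) * X' + 24 * c.φ μ * t.τ * t.α ^ 3 / (1 - ρ) ^ 3 * Y'
      ≤ 4 * c.φ μ * t.α / (1 - ρ) * X + 24 * c.φ μ * t.τ * t.α ^ 3 / (1 - ρ) ^ 3 * Y
      + t.τ * t.α * (-(2 * c.φ μ) * X + 1 / 4 * R) := by
  have hφ := hc.φ_pos μ
  have hτ := h.τ_pos
  have hα := h.α_pos
  have hr : 0 < 1 - ρ := sub_pos.2 hρ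
  have h0 := h.αγ_le
  set r := 1 - ρ
  have h1 := mul_le_mul_of_nonneg_left hX (by positivity : 0 ≤ 4 * c.φ μ * t.α / r)
  have h2 := mul_le_mul_of_nonneg_left hY
    (by positivity : 0 ≤ 24 * c.φ μ * t.τ * t.α ^ 3 / r ^ 3)
  refine (add_le_add h1 h2).trans ?_
  have h3 : 864 * c.φ μ * (t.α * t.γ) ^ 2 / r ^ 4 ≤ 1 := by
    rw [div_le_one (by positivity)]; exact h0
  have h4 := mul_le_mul_of_nonneg_left h3 (by positivity : 0 ≤ t.τ * t.α * (1 / 6) * R)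
  have h5 : 4 * c.φ μ * t.α / r * ((1 - t.τ * r / 2) * X + 3 * t.τ * t.α ^ 2 / r * Y)
      + 24 * c.φ μ * t.τ * t.α ^ 3 / r ^ 3 * ((1 - r / 2) * Y + 3 / r * (t.γ ^ 2 * (2 * R)))
      = 4 * c.φ μ * t.α / r * X + 24 * c.φ μ * t.τ * t.α ^ 3 / r ^ 3 * Y
      + t.τ * t.α * (-(2 * c.φ μ) * X)
      + t.τ * t.α * (1 / 6) * R * (864 * c.φ μ * (t.α * t.γ) ^ 2 / r ^ 4) := by
    field_simp
    ring
  rw [h5]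
  have h6 : 0 ≤ t.τ * t.α * R := by positivity
  linarith

theorem StepBounds.energy_descent (hc : c.Pos) (hμ : 0 < μ) (hρ : ρ < 1)
    (h : StepBounds c μ ρ t) {F F' G q S Z Z' V V' Θ Θ' X X' Y Y' : ℝ}
    (hq : 0 ≤ q) (hS0 : 0 ≤ S) (hZ0 : 0 ≤ Z) (hV0 : 0 ≤ V) (hΘ0 : 0 ≤ Θ) (hX0 : 0 ≤ X)
    (hF : F' ≤ F - t.τ * t.α / 2 * G - t.τ * t.α / 4 * q + t.τ * t.α / 2 * Z)
    (hS : S ≤ c.Lfgx μ * (X + Θ) + 4 * c.Cgxθ ^ 2 * V)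
    (hZ : Z' ≤ (1 - t.γ) * Z + 2 * t.γ * S + 2 / t.γ * c.L μ ^ 2 * (t.τ * t.α) ^ 2 * q)
    (hV : V' ≤ (1 - t.lam * μ) * V + 2 * t.lam / μ * c.Lfgθ μ * (X + Θ)
      + 2 / (t.lam * μ) * c.Lvstar μ ^ 2 * (t.τ * t.α) ^ 2 * q)
    (hΘ : Θ' ≤ (1 - 2 * t.β * c.ωθ μ) * Θ + 1 / (t.β * c.ωθ μ)
      * (t.β ^ 2 * c.Cgxθ ^ 2 * X + c.Lθstar μ ^ 2 * ((t.τ * t.α) ^ 2 * q)))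
    (hX : X' ≤ (1 - t.τ * (1 - ρ) / 2) * X + 3 * t.τ * t.α ^ 2 / (1 - ρ) * Y)
    (hY : Y' ≤ (1 - (1 - ρ) / 2) * Y + 3 / (1 - ρ) * (t.γ ^ 2 * (2 * (S + Z)))) :
    F' + errorEnergy c μ ρ t Z' V' Θ' X' Y'
      ≤ F + errorEnergy c μ ρ t Z V Θ X Y - t.τ * t.α / 2 * G := by
  have e1 := h.z_energy_le hc hμ hq hZ
  have e2 := h.v_energy_le hc hμ hq hV
  have e3 := h.theta_energy_le hc hμ hX0 hq hΘ
  have e4 := h.xy_energy_le hρ hc (add_nonneg hS0 hZ0) hX hY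
  have hT : 0 < t.τ * t.α := mul_pos h.τ_pos h.α_pos
  have hP : c.P μ = c.Lfgx μ + 2 * (16 * c.Cgxθ ^ 2 * c.Lfgθ μ / μ ^ 2) := by
    rw [Constants.P]; ring
  have hφ : c.P μ ≤ c.φ μ := by
    have := hc.P_pos μ
    rw [Constants.φ]
    exact le_mul_of_one_le_right this.le (le_add_of_nonneg_right (by positivity))
  have hQ : 0 ≤ 16 * c.Cgxθ ^ 2 * c.Lfgθ μ / μ ^ 2 := by
    have := hc.Lfgθ_pos μ; positivity
  set Q := 16 * c.Cgxθ ^ 2 * c.Lfgθ μ / μ ^ 2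
  -- Z cancels exactly (1/2 - 3/4 + 1/4). S occurs with total coefficient 7/4, costing 7C²V against
  -- the available 8C²V and (7/4)Lfgx in X and Θ. P = Lfgx + 2Q and φ ≥ P cover these, and the q
  -- coefficients sum to -35/288.
  have key : -(1 / 4) * q + 1 / 2 * Z + (-(3 / 4) * Z + 3 / 2 * S + 3 / 32 * q)
      + (-(8 * c.Cgxθ ^ 2) * V + Q * (X + Θ) + 1 / 144 * q)
      + (-(2 * c.P μ) * Θ + c.φ μ / 4 * X + 1 / 36 * q)
      + (-(2 * c.φ μ) * X + 1 / 4 * (S + Z)) ≤ 0 := by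
    have k1 := mul_le_mul_of_nonneg_right hφ hX0
    have k2 : 0 ≤ c.Cgxθ ^ 2 * V := by positivity
    have k3 := mul_nonneg hQ hX0
    have k4 := mul_nonneg hQ hΘ0
    have k5 := mul_nonneg (hc.Lfgx_pos μ).le hΘ0
    rw [hP] at k1 ⊢
    nlinarith
  have key2 := mul_le_mul_of_nonneg_left key hT.le
  simp only [errorEnergy]
  linarith

end Scalar

/-! ### One step of the algorithm -/

section Algorithm

variable {m n p : ℕ} {c : Constants} {μ : ℝ} {f g : Fin m → E n → E p → ℝ}

theorem hasGradientAt_objective (h : ∀ i, NodeAssumption c μ (f i) (g i)) (x : E n) :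
    HasGradientAt (objective f g) (mean fun i => hypergrad (f i) (g i) x) x := by
  rw [hasGradientAt_iff_hasFDerivAt, mean, map_smul, map_sum]
  exact (HasFDerivAt.fun_sum fun i _ => ((h i).hasGradientAt x).hasFDerivAt).const_mul _

theorem norm_mean_hypergrad_sub_le (hm : 0 < m) (h : ∀ i, NodeAssumption c μ (f i) (g i))
    (x x' : E n) :
    ‖(mean fun i => hypergrad (f i) (g i) x) - mean fun i => hypergrad (f i) (g i) x'‖
      ≤ c.L μ * ‖x - x'‖ := by
  have hL : 0 ≤ c.L μ := ((h ⟨0, hm⟩).cpos.L_pos (h ⟨0, hm⟩).μpos).le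
  rw [← mean_sub]
  refine abs_le_of_sq_le_sq' ?_ (by positivity) |>.2
  refine (norm_mean_sq_le hm _).trans ((meanSq_le_of_le fun i =>
    pow_le_pow_left₀ (norm_nonneg _) ((h i).norm_hypergrad_sub_le x x') 2).trans ?_)
  have : (m : ℝ) ≠ 0 := by positivity
  simp [this]

/-- Mean square error of `z` as an estimate of the local hypergradients at the average. -/
noncomputable def zError (f g : Fin m → E n → E p → ℝ) (S : State m n p) : ℝ :=
  meanSq fun i => S.z i - hypergrad (f i) (g i) S.xbar

/-- Mean square error of `v` as an estimate of the adjoint solutions at the average. -/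
noncomputable def vError (f g : Fin m → E n → E p → ℝ) (S : State m n p) : ℝ :=
  meanSq fun i => S.v i - adjointSol (f i) (g i) S.xbar

/-- Mean square error of `θ` as an estimate of the inner solutions at the average. -/
noncomputable def thetaError (g : Fin m → E n → E p → ℝ) (S : State m n p) : ℝ :=
  meanSq fun i => S.θ i - innerSol (g i) S.xbar

/-- The Lyapunov function. -/
noncomputable def lyapunov (c : Constants) (μ ρ : ℝ) (t : StepSizes)
    (f g : Fin m → E n → E p → ℝ) (S : State m n p) : ℝ :=
  objective f g S.xbar + errorEnergy c μ ρ t (zError f g S) (vError f g S) (thetaError g S)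
    (meanSq fun i => S.x i - S.xbar) (meanSq fun i => S.y i - mean S.y)

variable {W : Matrix (Fin m) (Fin m) ℝ} {t : StepSizes} {S : State m n p}

theorem xbar_step (hW : W ∈ doublyStochastic ℝ (Fin m)) :
    (step f g W t S).xbar = S.xbar - (t.τ * t.α) • mean S.y := by
  change mean (fun i => (1 - t.τ) • S.x i + t.τ • ((∑ j, W i j • S.x j) - t.α • S.y i))
    = mean S.x - _
  rw [mean_add, mean_smul, mean_smul, mean_sub, mean_mixing hW, mean_smul]
  module

theorem mean_y_step (hW : W ∈ doublyStochastic ℝ (Fin m)) :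
    mean (step f g W t S).y = mean S.y + (mean (step f g W t S).z - mean S.z) := by
  change mean (fun i => (∑ j, W i j • S.y j) + nextZ f g t.γ S i - S.z i)
    = _ + (mean (nextZ f g t.γ S) - _)
  rw [mean_sub, mean_add, mean_mixing hW]
  module

/-- The gradient tracking invariant: mixing preserves averages, and `y` receives exactly the
increments of `z`. -/
theorem mean_y_iter (hW : W ∈ doublyStochastic ℝ (Fin m)) (h0 : mean S.y = mean S.z) (k : ℕ) :
    mean (iter f g W t S k).y = mean (iter f g W t S k).z := by
  induction k with
  | zero => exact h0
  | succ k ih =>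
    change mean (step f g W t (iter f g W t S k)).y = mean (step f g W t (iter f g W t S k)).z
    rw [mean_y_step hW, ih]
    module

/-- The new deviation is a convex combination, with weight τ, of the old one and a perturbed mixing
step. Only that fraction contracts, whence the rate τ(1-ρ)/2. -/
theorem x_step_le (hm : 0 < m) (hW : W ∈ doublyStochastic ℝ (Fin m)) (hρ : rho W < 1)
    (hτ0 : 0 ≤ t.τ) (hτ1 : t.τ ≤ 1) :
    meanSq (fun i => (step f g W t S).x i - (step f g W t S).xbar)
      ≤ (1 - t.τ * (1 - rho W) / 2) * meanSq (fun i => S.x i - S.xbar)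
        + 3 * t.τ * t.α ^ 2 / (1 - rho W) * meanSq fun i => S.y i - mean S.y := by
  have h1 : ∀ i, (step f g W t S).x i - (step f g W t S).xbar
      = (1 - t.τ) • (S.x i - S.xbar)
        + t.τ • ((∑ j, W i j • S.x j) - mean S.x + (-t.α) • (S.y i - mean S.y)) := by
    intro i
    rw [xbar_step hW]
    change (1 - t.τ) • S.x i + t.τ • ((∑ j, W i j • S.x j) - t.α • S.y i) - (mean S.x - _)
      = (1 - t.τ) • (S.x i - mean S.x) + _
    module
  have h2 := meanSq_mixing_add_le hm hW hρ S.x fun i => (-t.α) • (S.y i - mean S.y)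
  have h3 : meanSq (fun i => (-t.α) • (S.y i - mean S.y))
      = t.α ^ 2 * meanSq fun i => S.y i - mean S.y := by
    simp only [meanSq, norm_smul, mul_pow, ← Finset.mul_sum, norm_neg, Real.norm_eq_abs, sq_abs]
    ring
  rw [h3] at h2
  have h4 := meanSq_le_of_le fun i => norm_convex_combination_sq_le hτ0 hτ1
    (S.x i - S.xbar) ((∑ j, W i j • S.x j) - mean S.x + (-t.α) • (S.y i - mean S.y))
  simp only [← h1] at h4
  rw [Finset.sum_add_distrib, ← Finset.mul_sum, ← Finset.mul_sum, mul_add,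
    mul_left_comm, mul_left_comm (1 / (m : ℝ))] at h4
  refine h4.trans ((add_le_add le_rfl (mul_le_mul_of_nonneg_left h2 hτ0)).trans (le_of_eq ?_))
  change (1 - t.τ) * meanSq (fun i => S.x i - S.xbar) + t.τ * (_ * meanSq
    (fun i => S.x i - S.xbar) + _) = _
  ring

/-- The perturbation of the mixing step is the centred increment of `z`, which is γ(s - z); small γ
thus keeps the tracking noise small. -/
theorem y_step_le (hm : 0 < m) (hW : W ∈ doublyStochastic ℝ (Fin m)) (hρ : rho W < 1) :
    meanSq (fun i => (step f g W t S).y i - mean (step f g W t S).y)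
      ≤ (1 - (1 - rho W) / 2) * meanSq (fun i => S.y i - mean S.y)
        + 3 / (1 - rho W) * meanSq fun i => t.γ • (dirS f g S i - S.z i) := by
  set dz := fun i => t.γ • (dirS f g S i - S.z i) with hdz
  have hz : ∀ i, (step f g W t S).z i - S.z i = dz i := by
    intro i
    change nextZ f g t.γ S i - S.z i = dz i
    rw [nextZ, hdz]
    module
  have h1 : ∀ i, (step f g W t S).y i - mean (step f g W t S).y
      = (∑ j, W i j • S.y j) - mean S.y + (dz i - mean dz) := by
    intro i
    rw [mean_y_step hW, ← mean_sub]
    simp only [hz]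
    rw [← hz i]
    change (∑ j, W i j • S.y j) + nextZ f g t.γ S i - S.z i - _ = _ + (nextZ f g t.γ S i - _ - _)
    abel
  simp only [h1]
  refine (meanSq_mixing_add_le hm hW hρ S.y _).trans (add_le_add le_rfl ?_)
  exact mul_le_mul_of_nonneg_left (meanSq_sub_mean_le hm dz)
    (div_nonneg zero_le_three (sub_pos.2 hρ).le)

theorem tracking_error_le (f g : Fin m → E n → E p → ℝ) (γ : ℝ) (S : State m n p) :
    meanSq (fun i => γ • (dirS f g S i - S.z i))
      ≤ γ ^ 2 * (2 * (meanSq (fun i => dirS f g S i - hypergrad (f i) (g i) S.xbar)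
        + zError f g S)) := by
  have h1 := meanSq_le_of_le fun i => (show ‖γ • (dirS f g S i - S.z i)‖ ^ 2
      ≤ γ ^ 2 * (2 * ‖dirS f g S i - hypergrad (f i) (g i) S.xbar‖ ^ 2
        + 2 * ‖S.z i - hypergrad (f i) (g i) S.xbar‖ ^ 2) by
    rw [norm_smul, mul_pow, Real.norm_eq_abs, sq_abs]
    refine mul_le_mul_of_nonneg_left ?_ (sq_nonneg _)
    rw [← sub_sub_sub_cancel_right _ _ (hypergrad (f i) (g i) S.xbar)]
    exact norm_sub_sq_le_two _ _)
  refine h1.trans (le_of_eq ?_)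
  rw [← Finset.mul_sum, Finset.sum_add_distrib, ← Finset.mul_sum, ← Finset.mul_sum, zError,
    meanSq, meanSq]
  ring

theorem direction_error_le (h : ∀ i, NodeAssumption c μ (f i) (g i)) (S : State m n p) :
    meanSq (fun i => dirS f g S i - hypergrad (f i) (g i) S.xbar)
      ≤ c.Lfgx μ * (meanSq (fun i => S.x i - S.xbar) + thetaError g S)
        + 4 * c.Cgxθ ^ 2 * vError f g S := by
  refine (meanSq_le_of_le fun i => (h i).norm_direction_sub_hypergrad_sq_le S.xbar (S.x i)
    (S.θ i) (S.v i)).trans (le_of_eq ?_)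
  simp only [Finset.sum_add_distrib, ← Finset.mul_sum, thetaError, vError, meanSq]
  ring

/-- Write the new error as a convex combination with weight γ of the old error and (s - G(x̄)) +
(G(x̄) - G(x̄'))/γ. Convexity of the squared norm leaves the factor 1 - γ intact and puts 1/γ on the
drift. -/
theorem z_step_le (hm : 0 < m) (h : ∀ i, NodeAssumption c μ (f i) (g i))
    (hW : W ∈ doublyStochastic ℝ (Fin m)) (hγ0 : 0 < t.γ) (hγ1 : t.γ ≤ 1) :
    zError f g (step f g W t S) ≤ (1 - t.γ) * zError f g S
      + 2 * t.γ * meanSq (fun i => dirS f g S i - hypergrad (f i) (g i) S.xbar)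
      + 2 / t.γ * c.L μ ^ 2 * (t.τ * t.α) ^ 2 * ‖mean S.y‖ ^ 2 := by
  set x' := (step f g W t S).xbar with hx'
  have hd : ‖S.xbar - x'‖ ^ 2 = (t.τ * t.α) ^ 2 * ‖mean S.y‖ ^ 2 := by
    rw [hx', xbar_step hW, sub_sub_cancel, norm_smul, mul_pow, Real.norm_eq_abs, sq_abs]
  have h1 : ∀ i, ‖(step f g W t S).z i - hypergrad (f i) (g i) x'‖ ^ 2
      ≤ (1 - t.γ) * ‖S.z i - hypergrad (f i) (g i) S.xbar‖ ^ 2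
        + (2 * t.γ * ‖dirS f g S i - hypergrad (f i) (g i) S.xbar‖ ^ 2
        + 2 / t.γ * c.L μ ^ 2 * ((t.τ * t.α) ^ 2 * ‖mean S.y‖ ^ 2)) := by
    intro i
    set G := hypergrad (f i) (g i)
    have h2 : (step f g W t S).z i - G x' = (1 - t.γ) • (S.z i - G S.xbar)
        + t.γ • ((dirS f g S i - G S.xbar) + (1 / t.γ) • (G S.xbar - G x')) := by
      change nextZ f g t.γ S i - G x' = _
      rw [nextZ, smul_add t.γ, smul_smul, mul_one_div_cancel hγ0.ne']
      module
    rw [h2]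
    refine (norm_convex_combination_sq_le hγ0.le hγ1 _ _).trans (add_le_add le_rfl ?_)
    have h3 := norm_add_sq_le_two (dirS f g S i - G S.xbar) ((1 / t.γ) • (G S.xbar - G x'))
    have h4 := pow_le_pow_left₀ (norm_nonneg _) ((h i).norm_hypergrad_sub_le S.xbar x') 2
    rw [norm_smul, mul_pow, Real.norm_eq_abs, sq_abs] at h3
    rw [mul_pow, hd] at h4
    have h5 := mul_le_mul_of_nonneg_left h4 (by positivity : 0 ≤ 2 * t.γ * (1 / t.γ) ^ 2)
    have h6 := mul_le_mul_of_nonneg_left h3 hγ0.le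
    have h7 : 2 * t.γ * (1 / t.γ) ^ 2 = 2 / t.γ := by field_simp
    rw [h7] at h5
    have h8 : t.γ * (2 * ((1 / t.γ) ^ 2 * ‖G S.xbar - G x'‖ ^ 2))
        = 2 / t.γ * ‖G S.xbar - G x'‖ ^ 2 := by field_simp
    rw [mul_add t.γ, h8] at h6
    linarith
  refine (meanSq_le_of_le h1).trans (le_of_eq ?_)
  have : (m : ℝ) ≠ 0 := by positivity
  simp only [Finset.sum_add_distrib, ← Finset.mul_sum, zError, meanSq, Finset.sum_const,
    Finset.card_univ, Fintype.card_fin, nsmul_eq_mul]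
  field_simp
  ring

theorem v_step_le (hm : 0 < m) (h : ∀ i, NodeAssumption c μ (f i) (g i))
    (hW : W ∈ doublyStochastic ℝ (Fin m)) (hl : 0 < t.lam) (hl1 : t.lam * μ ≤ 1)
    (hl2 : t.lam * (μ + c.Lgθ) ≤ 2) :
    vError f g (step f g W t S) ≤ (1 - t.lam * μ) * vError f g S
      + 2 * t.lam / μ * c.Lfgθ μ * (meanSq (fun i => S.x i - S.xbar) + thetaError g S)
      + 2 / (t.lam * μ) * c.Lvstar μ ^ 2 * (t.τ * t.α) ^ 2 * ‖mean S.y‖ ^ 2 := by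
  have hd : ‖S.xbar - (step f g W t S).xbar‖ ^ 2 = (t.τ * t.α) ^ 2 * ‖mean S.y‖ ^ 2 := by
    rw [xbar_step hW, sub_sub_cancel, norm_smul, mul_pow, Real.norm_eq_abs, sq_abs]
  refine (meanSq_le_of_le fun i => (h i).adjoint_step_sq_le hl hl1 hl2 S.xbar
    (step f g W t S).xbar (S.x i) (S.θ i) (S.v i)).trans (le_of_eq ?_)
  have hm' : (m : ℝ) ≠ 0 := by positivity
  rw [hd]
  simp only [Finset.sum_add_distrib, ← Finset.mul_sum, thetaError, vError, meanSq,
    Finset.sum_const, Finset.card_univ, Fintype.card_fin, nsmul_eq_mul]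
  linear_combination 2 / (t.lam * μ) * c.Lvstar μ ^ 2 * (t.τ * t.α) ^ 2 * ‖mean S.y‖ ^ 2
    * one_div_mul_cancel hm'

theorem theta_step_le (hm : 0 < m) (h : ∀ i, NodeAssumption c μ (f i) (g i))
    (hW : W ∈ doublyStochastic ℝ (Fin m)) (hμ : μ ≤ c.Lgθ) (hβ : 0 < t.β)
    (hβ2 : t.β * (μ + c.Lgθ) ≤ 2) :
    thetaError g (step f g W t S) ≤ (1 - 2 * t.β * c.ωθ μ) * thetaError g S
      + 1 / (t.β * c.ωθ μ) * (t.β ^ 2 * c.Cgxθ ^ 2 * meanSq (fun i => S.x i - S.xbar)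
        + c.Lθstar μ ^ 2 * ((t.τ * t.α) ^ 2 * ‖mean S.y‖ ^ 2)) := by
  have hd : ‖S.xbar - (step f g W t S).xbar‖ ^ 2 = (t.τ * t.α) ^ 2 * ‖mean S.y‖ ^ 2 := by
    rw [xbar_step hW, sub_sub_cancel, norm_smul, mul_pow, Real.norm_eq_abs, sq_abs]
  refine (meanSq_le_of_le fun i => (h i).inner_step_sq_le hμ hβ hβ2 S.xbar
    (step f g W t S).xbar (S.x i) (S.θ i)).trans (le_of_eq ?_)
  have hm' : (m : ℝ) ≠ 0 := by positivity
  rw [hd]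
  simp only [Finset.sum_add_distrib, ← Finset.mul_sum, thetaError, meanSq,
    Finset.sum_const, Finset.card_univ, Fintype.card_fin, nsmul_eq_mul]
  linear_combination 1 / (t.β * c.ωθ μ) * c.Lθstar μ ^ 2 * ((t.τ * t.α) ^ 2 * ‖mean S.y‖ ^ 2)
    * one_div_mul_cancel hm'

/-- Polarize -T⟨∇Φ, ȳ⟩ into (T/2)(‖ȳ - ∇Φ‖² - ‖∇Φ‖² - ‖ȳ‖²). Since ȳ = z̄, the first square is at
most the `z` error by Jensen. The smoothness term uses up half of the ‖ȳ‖² term because 2LT ≤ 1. -/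
theorem objective_step_le (hm : 0 < m) (h : ∀ i, NodeAssumption c μ (f i) (g i))
    (hW : W ∈ doublyStochastic ℝ (Fin m)) (hT : 0 ≤ t.τ * t.α)
    (hL : 2 * c.L μ * (t.τ * t.α) ≤ 1) (hyz : mean S.y = mean S.z) :
    objective f g (step f g W t S).xbar ≤ objective f g S.xbar
      - t.τ * t.α / 2 * ‖gradient (objective f g) S.xbar‖ ^ 2
      - t.τ * t.α / 4 * ‖mean S.y‖ ^ 2 + t.τ * t.α / 2 * zError f g S := by
  set T := t.τ * t.α
  rw [(hasGradientAt_objective h S.xbar).gradient]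
  have h1 := descent_lemma (hasGradientAt_objective h) (norm_mean_hypergrad_sub_le hm h)
    S.xbar (-(T • mean S.y))
  set G := mean fun i => hypergrad (f i) (g i) S.xbar with hG
  rw [← sub_eq_add_neg, ← xbar_step (f := f) (g := g) hW, norm_neg, norm_smul, inner_neg_right,
    inner_smul_right, mul_pow, Real.norm_eq_abs, sq_abs] at h1
  have h2 : ‖mean S.y - G‖ ^ 2 ≤ zError f g S := by
    rw [hyz, hG, ← mean_sub]
    exact norm_mean_sq_le hm _
  rw [norm_sub_sq_real, real_inner_comm] at h2
  have h3 := mul_le_mul_of_nonneg_left h2 (by linarith : 0 ≤ T / 2)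
  have h4 := mul_le_mul_of_nonneg_right hL (by positivity : 0 ≤ T * ‖mean S.y‖ ^ 2)
  linarith

theorem lyapunov_step_le (hm : 0 < m) (h : ∀ i, NodeAssumption c μ (f i) (g i))
    (hW : W ∈ doublyStochastic ℝ (Fin m)) (hρ : rho W < 1) (hμ : μ ≤ c.Lgθ)
    (ht : StepBounds c μ (rho W) t) (hyz : mean S.y = mean S.z) :
    lyapunov c μ (rho W) t f g (step f g W t S) ≤ lyapunov c μ (rho W) t f g S
      - t.τ * t.α / 2 * ‖gradient (objective f g) S.xbar‖ ^ 2 := by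
  have hc := (h ⟨0, hm⟩).cpos
  have hμ0 := (h ⟨0, hm⟩).μpos
  refine ht.energy_descent hc hμ0 hρ (sq_nonneg ‖mean S.y‖) (meanSq_nonneg _)
    (meanSq_nonneg _) (meanSq_nonneg _) (meanSq_nonneg _) (meanSq_nonneg _)
    (objective_step_le hm h hW (mul_pos ht.τ_pos ht.α_pos).le ht.α_le hyz)
    (direction_error_le h S) (z_step_le hm h hW ht.γ_pos ht.γ_lt.le)
    (v_step_le hm h hW ht.lam_pos ht.lam_mul ht.lam_le)
    (theta_step_le hm h hW hμ ht.β_pos ht.β_le)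
    (x_step_le hm hW hρ ht.τ_pos.le ht.τ_lt.le) ((y_step_le hm hW hρ).trans ?_)
  exact add_le_add le_rfl (mul_le_mul_of_nonneg_left (tracking_error_le f g t.γ S)
    (div_nonneg zero_le_three (sub_pos.2 hρ).le))

theorem objective_le_lyapunov (hc : c.Pos) (hμ : 0 < μ) {ρ : ℝ} (hρ : ρ < 1)
    (ht : StepBounds c μ ρ t) (S : State m n p) :
    objective f g S.xbar ≤ lyapunov c μ ρ t f g S := by
  have h1 := ht.τ_pos; have h2 := ht.α_pos; have h3 := ht.γ_pos; have h4 := ht.lam_pos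
  have h5 := ht.β_pos; have h6 := hc.P_pos μ; have h7 := hc.φ_pos μ; have h8 := hc.ωθ_pos hμ
  have h9 : 0 < 1 - ρ := sub_pos.2 hρ
  have e1 : 0 ≤ zError f g S := meanSq_nonneg _
  have e2 : 0 ≤ vError f g S := meanSq_nonneg _
  have e3 : 0 ≤ thetaError g S := meanSq_nonneg _
  have e4 := meanSq_nonneg fun i => S.x i - S.xbar
  have e5 := meanSq_nonneg fun i => S.y i - mean S.y
  rw [lyapunov, errorEnergy]
  exact le_add_of_nonneg_right (by positivity)

theorem sum_norm_gradient_sq_le (hm : 0 < m) (h : ∀ i, NodeAssumption c μ (f i) (g i))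
    (hW : W ∈ doublyStochastic ℝ (Fin m)) (hρ : rho W < 1) (hμ : μ ≤ c.Lgθ)
    (ht : StepBounds c μ (rho W) t) (hyz : mean S.y = mean S.z)
    (hbdd : BddBelow (Set.range (objective f g))) (K : ℕ) :
    t.τ * t.α / 2 * ∑ k ∈ Finset.range K,
        ‖gradient (objective f g) (iter f g W t S k).xbar‖ ^ 2
      ≤ lyapunov c μ (rho W) t f g S - ⨅ x, objective f g x := by
  have h1 : ∀ K, t.τ * t.α / 2 * ∑ k ∈ Finset.range K,
        ‖gradient (objective f g) (iter f g W t S k).xbar‖ ^ 2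
      ≤ lyapunov c μ (rho W) t f g S - lyapunov c μ (rho W) t f g (iter f g W t S K) := by
    intro K
    induction K with
    | zero => simp [iter]
    | succ K ih =>
      have h2 := lyapunov_step_le hm h hW hρ hμ ht (mean_y_iter (f := f) (g := g) (t := t)
        hW hyz K)
      rw [Finset.sum_range_succ, mul_add, iter]
      linarith
  have h2 := objective_le_lyapunov (f := f) (g := g) (h ⟨0, hm⟩).cpos (h ⟨0, hm⟩).μpos hρ ht
    (iter f g W t S K)
  have h3 := ciInf_le hbdd (iter f g W t S K).xbar
  linarith [h1 K]

end Algorithm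

/-! ### Dependence of the derived constants on the condition number -/

namespace Constants

/-- The largest Lipschitz constant. -/
noncomputable def maxLip (c : Constants) : ℝ :=
  max c.Lfx (max c.Lfθ (max c.Lgθ (max c.Lgxθ c.Lgθθ)))

variable {c : Constants} {μ : ℝ}

theorem Pos.maxLip_pos (hc : c.Pos) : 0 < c.maxLip := lt_max_of_lt_left hc.Lfx

theorem kappa_eq (c : Constants) (μ : ℝ) : c.kappa μ = c.maxLip / μ := rfl

theorem one_le_kappa (hμ : 0 < μ) (h : μ ≤ c.Lgθ) : 1 ≤ c.kappa μ := by
  rw [kappa_eq, one_le_div hμ]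
  exact h.trans ((le_max_left _ _).trans ((le_max_right _ _).trans (le_max_right _ _)))

/-- Separates the dependence on μ: each derived constant is compared with a power of κ times its own
value at μ = `maxLip`, where κ = 1, and that value depends on `c` alone. -/
theorem Pos.inv_eq (hc : c.Pos) (μ : ℝ) : 1 / μ = c.kappa μ * (1 / c.maxLip) := by
  have := hc.maxLip_pos.ne'
  rw [kappa_eq]; field_simp

theorem Pos.M_eq (hc : c.Pos) (μ : ℝ) : c.M μ = c.kappa μ * c.M c.maxLip := by
  rw [M, M, div_eq_mul_one_div, hc.inv_eq]; ring

theorem Pos.Lθstar_eq (hc : c.Pos) (μ : ℝ) :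
    c.Lθstar μ = c.kappa μ * c.Lθstar c.maxLip := by
  rw [Lθstar, Lθstar, div_eq_mul_one_div, hc.inv_eq]; ring

theorem Pos.Lv_le (hc : c.Pos) (hκ : 1 ≤ c.kappa μ) :
    c.Lv μ ≤ c.kappa μ ^ 2 * c.Lv c.maxLip := by
  have h1 := hc.Lfθ; have h2 := hc.maxLip_pos
  have h3 : c.Lv μ = c.kappa μ * (c.Lfθ / c.maxLip)
      + c.kappa μ ^ 2 * (c.Cfθ * c.Lgθθ / c.maxLip ^ 2) := by
    have e : c.Lv μ = c.Lfθ * (1 / μ) + c.Cfθ * c.Lgθθ * (1 / μ) ^ 2 := by rw [Lv]; ring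
    rw [e, hc.inv_eq]; ring
  have h4 : c.kappa μ * (c.Lfθ / c.maxLip) ≤ c.kappa μ ^ 2 * (c.Lfθ / c.maxLip) := by
    gcongr; exact le_self_pow₀ hκ two_ne_zero
  rw [h3, Lv]
  linarith

theorem Pos.one_add_Lθstar_le (hc : c.Pos) (hκ : 1 ≤ c.kappa μ) :
    1 + c.Lθstar μ ≤ c.kappa μ * (1 + c.Lθstar c.maxLip) := by
  rw [hc.Lθstar_eq]; linarith

theorem Pos.Lvstar_le (hc : c.Pos) (hκ : 1 ≤ c.kappa μ) :
    c.Lvstar μ ≤ c.kappa μ ^ 3 * c.Lvstar c.maxLip := by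
  have h1 := (hc.Lv_pos hc.maxLip_pos).le
  have h2 := (hc.Lθstar_pos hc.maxLip_pos).le
  have hκ0 : 0 ≤ c.kappa μ := zero_le_one.trans hκ
  have h3 : 0 ≤ 1 + c.Lθstar μ := by rw [hc.Lθstar_eq]; positivity
  calc c.Lvstar μ ≤ (c.kappa μ ^ 2 * c.Lv c.maxLip) * (c.kappa μ * (1 + c.Lθstar c.maxLip)) :=
        mul_le_mul (hc.Lv_le hκ) (hc.one_add_Lθstar_le hκ) h3 (by positivity)
    _ = _ := by rw [Lvstar]; ring

theorem Pos.L_le (hc : c.Pos) (hκ : 1 ≤ c.kappa μ) :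
    c.L μ ≤ c.kappa μ ^ 3 * c.L c.maxLip := by
  have h1 := (hc.Lv_pos hc.maxLip_pos).le
  have h2 := (hc.Lθstar_pos hc.maxLip_pos).le
  have hκ0 : 0 ≤ c.kappa μ := zero_le_one.trans hκ
  have h3 : 0 ≤ 1 + c.Lθstar μ := by rw [hc.Lθstar_eq]; positivity
  have h4 := hc.Lfx; have h5 := hc.Cgxθ; have h6 := hc.Cfθ; have h7 := hc.Lgxθ
  have h8 := hc.maxLip_pos
  have e1 : c.Lfx ≤ c.kappa μ ^ 2 * c.Lfx := le_mul_of_one_le_left h4.le (one_le_pow₀ hκ)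
  have e2 := mul_le_mul_of_nonneg_left (hc.Lv_le hκ) h5.le
  have e3 : c.Cfθ * c.Lgxθ / μ ≤ c.kappa μ ^ 2 * (c.Cfθ * c.Lgxθ / c.maxLip) := by
    have e : c.Cfθ * c.Lgxθ / μ = c.kappa μ * (c.Cfθ * c.Lgxθ / c.maxLip) := by
      rw [div_eq_mul_one_div, hc.inv_eq]; ring
    rw [e]
    gcongr; exact le_self_pow₀ hκ two_ne_zero
  calc c.L μ ≤ (c.kappa μ ^ 2 * (c.Lfx + c.Cgxθ * c.Lv c.maxLip + c.Cfθ * c.Lgxθ / c.maxLip))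
        * (c.kappa μ * (1 + c.Lθstar c.maxLip)) :=
        mul_le_mul (by linarith) (hc.one_add_Lθstar_le hκ) h3 (by positivity)
    _ = _ := by rw [L]; ring

theorem Pos.Lfgx_le (hc : c.Pos) (hκ : 1 ≤ c.kappa μ) :
    c.Lfgx μ ≤ c.kappa μ ^ 2 * c.Lfgx c.maxLip := by
  have e1 : c.Lfx ^ 2 ≤ c.kappa μ ^ 2 * c.Lfx ^ 2 :=
    le_mul_of_one_le_left (sq_nonneg _) (one_le_pow₀ hκ)
  rw [Lfgx, Lfgx, hc.M_eq]
  linarith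

theorem Pos.Lfgθ_le (hc : c.Pos) (hκ : 1 ≤ c.kappa μ) :
    c.Lfgθ μ ≤ c.kappa μ ^ 2 * c.Lfgθ c.maxLip := by
  have e1 : c.Lfθ ^ 2 ≤ c.kappa μ ^ 2 * c.Lfθ ^ 2 :=
    le_mul_of_one_le_left (sq_nonneg _) (one_le_pow₀ hκ)
  rw [Lfgθ, Lfgθ, hc.M_eq]
  linarith

theorem Pos.P_le (hc : c.Pos) (hκ : 1 ≤ c.kappa μ) :
    c.P μ ≤ c.kappa μ ^ 4 * c.P c.maxLip := by
  have h1 : c.Lfgx μ ≤ c.kappa μ ^ 4 * c.Lfgx c.maxLip := by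
    refine (hc.Lfgx_le hκ).trans ?_
    have := hc.Lfgx_pos c.maxLip
    gcongr
    norm_num
  have e : ∀ ν, c.P ν = c.Lfgx ν + 32 * c.Cgxθ ^ 2 * c.Lfgθ ν * (1 / ν) ^ 2 := by
    intro ν; rw [P]; ring
  have h2 := mul_le_mul_of_nonneg_left (hc.Lfgθ_le hκ)
    (by positivity : 0 ≤ 32 * c.Cgxθ ^ 2 * (1 / μ) ^ 2)
  rw [e, e c.maxLip]
  have h3 : 32 * c.Cgxθ ^ 2 * (1 / μ) ^ 2 * (c.kappa μ ^ 2 * c.Lfgθ c.maxLip)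
      = c.kappa μ ^ 4 * (32 * c.Cgxθ ^ 2 * c.Lfgθ c.maxLip * (1 / c.maxLip) ^ 2) := by
    rw [hc.inv_eq]; ring
  linarith

theorem Pos.ωθ_le (hc : c.Pos) (hμ : 0 < μ) (hκ : 1 ≤ c.kappa μ) :
    c.ωθ c.maxLip ≤ c.kappa μ * c.ωθ μ := by
  have h1 := hc.Lgθ; have h2 := hc.maxLip_pos
  have h3 : μ ≤ c.maxLip := by rwa [kappa_eq, one_le_div hμ] at hκ
  have h4 : c.kappa μ * c.ωθ μ = c.maxLip * c.Lgθ / (2 * (μ + c.Lgθ)) := by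
    rw [kappa_eq, ωθ]; field_simp
  rw [h4, ωθ]
  gcongr

theorem Pos.φ_div_P_le (hc : c.Pos) (hμ : 0 < μ) (hκ : 1 ≤ c.kappa μ) :
    1 + 4 * (max c.Lgθ c.Cgxθ) ^ 2 / c.ωθ μ ^ 2
      ≤ c.kappa μ ^ 2 * (1 + 4 * (max c.Lgθ c.Cgxθ) ^ 2 / c.ωθ c.maxLip ^ 2) := by
  have h1 := hc.ωθ_pos hμ
  have h2 := hc.ωθ_pos hc.maxLip_pos
  have h3 := pow_le_pow_left₀ h2.le (hc.ωθ_le hμ hκ) 2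
  have hκ0 : 0 < c.kappa μ := zero_lt_one.trans_le hκ
  have h4 : 4 * (max c.Lgθ c.Cgxθ) ^ 2 / c.ωθ μ ^ 2
      ≤ c.kappa μ ^ 2 * (4 * (max c.Lgθ c.Cgxθ) ^ 2 / c.ωθ c.maxLip ^ 2) := by
    rw [← mul_div_assoc, div_le_div_iff₀ (by positivity) (by positivity)]
    have := mul_le_mul_of_nonneg_left h3
      (by positivity : 0 ≤ 4 * (max c.Lgθ c.Cgxθ) ^ 2)
    nlinarith
  have h5 : 1 ≤ c.kappa μ ^ 2 := one_le_pow₀ hκ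
  linarith

/-- Four powers come from P, namely two from M² and two from 1/μ², and two more from 1/ω². -/
theorem Pos.φ_le (hc : c.Pos) (hμ : 0 < μ) (hκ : 1 ≤ c.kappa μ) :
    c.φ μ ≤ c.kappa μ ^ 6 * c.φ c.maxLip := by
  have h1 := (hc.P_pos c.maxLip).le
  have hκ0 : 0 ≤ c.kappa μ := zero_le_one.trans hκ
  calc c.φ μ ≤ (c.kappa μ ^ 4 * c.P c.maxLip) * (c.kappa μ ^ 2
        * (1 + 4 * (max c.Lgθ c.Cgxθ) ^ 2 / c.ωθ c.maxLip ^ 2)) :=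
        mul_le_mul (hc.P_le hκ) (hc.φ_div_P_le hμ hκ) (by positivity) (by positivity)
    _ = _ := by rw [φ]; ring

/-- The factor P of φ cancels, leaving two powers from 1/ω² and two from `Lfgx`. -/
theorem Pos.φ_mul_Lfgx_div_P_le (hc : c.Pos) (hμ : 0 < μ) (hκ : 1 ≤ c.kappa μ) :
    c.φ μ * c.Lfgx μ / c.P μ
      ≤ c.kappa μ ^ 4 * (c.φ c.maxLip * c.Lfgx c.maxLip / c.P c.maxLip) := by
  have e : ∀ ν, c.φ ν * c.Lfgx ν / c.P ν
      = (1 + 4 * (max c.Lgθ c.Cgxθ) ^ 2 / c.ωθ ν ^ 2) * c.Lfgx ν := by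
    intro ν
    have := (hc.P_pos ν).ne'
    rw [φ]; field_simp
  rw [e, e c.maxLip]
  refine (mul_le_mul (hc.φ_div_P_le hμ hκ) (hc.Lfgx_le hκ) (hc.Lfgx_pos μ).le
    (by positivity)).trans (le_of_eq (by ring))

/-! ### A lower bound for the step-size threshold -/

/-- The parameters `(μ, ρ, τ)` that occur. -/
structure Admissible (c : Constants) (t₂ μ ρ τ : ℝ) : Prop where
  μ_pos : 0 < μ
  μ_le : μ ≤ c.Lgθ
  ρ_nonneg : 0 ≤ ρ
  ρ_lt : ρ < 1
  τ_pos : 0 < τ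
  τ_le : τ ≤ t₂ / c.kappa μ ^ 4

/-- `F` is at least a fixed multiple of `(1 - ρ)² / κ³`. -/
def Dominates (c : Constants) (t₂ : ℝ) (F : ℝ → ℝ → ℝ → ℝ) : Prop :=
  ∃ k, 0 < k ∧ ∀ μ ρ τ, c.Admissible t₂ μ ρ τ → k * ((1 - ρ) ^ 2 / c.kappa μ ^ 3) ≤ F μ ρ τ

variable {t₂ : ℝ}

theorem Dominates.min {F G : ℝ → ℝ → ℝ → ℝ} (hF : c.Dominates t₂ F)
    (hG : c.Dominates t₂ G) :
    c.Dominates t₂ fun μ ρ τ => min (F μ ρ τ) (G μ ρ τ) := by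
  obtain ⟨k, hk, hF⟩ := hF
  obtain ⟨l, hl, hG⟩ := hG
  refine ⟨Min.min k l, lt_min hk hl, fun μ ρ τ h => ?_⟩
  have hκ : 0 < c.kappa μ := zero_lt_one.trans_le (Constants.one_le_kappa h.μ_pos h.μ_le)
  have hw : 0 ≤ (1 - ρ) ^ 2 / c.kappa μ ^ 3 := by positivity
  exact le_min ((mul_le_mul_of_nonneg_right (min_le_left _ _) hw).trans (hF μ ρ τ h))
    ((mul_le_mul_of_nonneg_right (min_le_right _ _) hw).trans (hG μ ρ τ h))

theorem Admissible.one_le_kappa {ρ τ : ℝ} (h : c.Admissible t₂ μ ρ τ) :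
    1 ≤ c.kappa μ := Constants.one_le_kappa h.μ_pos h.μ_le

theorem Admissible.weight_le_inv {ρ τ : ℝ} (h : c.Admissible t₂ μ ρ τ) :
    (1 - ρ) ^ 2 / c.kappa μ ^ 3 ≤ 1 / c.kappa μ := by
  have hκ := h.one_le_kappa
  have hκ0 : 0 < c.kappa μ := zero_lt_one.trans_le hκ
  have h1 : (1 - ρ) ^ 2 ≤ 1 := pow_le_one₀ (sub_pos.2 h.ρ_lt).le (by linarith [h.ρ_nonneg])
  exact div_le_div₀ zero_le_one h1 hκ0 (le_self_pow₀ hκ three_ne_zero)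

theorem Admissible.weight_le_one {ρ τ : ℝ} (h : c.Admissible t₂ μ ρ τ) :
    (1 - ρ) ^ 2 / c.kappa μ ^ 3 ≤ 1 := by
  have hκ := h.one_le_kappa
  exact (h.weight_le_inv).trans (by rw [div_le_one (by linarith)]; exact hκ)

/-- Since τ is of order κ⁻⁴, its product with any constant of order κ³ is bounded uniformly in μ. -/
theorem Admissible.τ_mul_le (ht₂ : 0 < t₂) {ρ τ a A : ℝ}
    (h : c.Admissible t₂ μ ρ τ) (hA : 0 ≤ A) (ha : a ≤ c.kappa μ ^ 3 * A) :
    τ * a ≤ t₂ * A := by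
  have hκ := h.one_le_kappa
  have hκ0 : 0 < c.kappa μ := zero_lt_one.trans_le hκ
  calc τ * a ≤ τ * (c.kappa μ ^ 3 * A) := mul_le_mul_of_nonneg_left ha h.τ_pos.le
    _ ≤ t₂ / c.kappa μ ^ 4 * (c.kappa μ ^ 3 * A) :=
        mul_le_mul_of_nonneg_right h.τ_le (by positivity)
    _ = t₂ * A / c.kappa μ := by field_simp
    _ ≤ t₂ * A := div_le_self (by positivity) hκ

theorem Admissible.τL_le (hc : c.Pos) (ht₂ : 0 < t₂) {ρ τ : ℝ}
    (h : c.Admissible t₂ μ ρ τ) : τ * c.L μ ≤ t₂ * c.L c.maxLip + 1 :=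
  (h.τ_mul_le ht₂ (hc.L_pos hc.maxLip_pos).le (hc.L_le (h.one_le_kappa))).trans
    (le_add_of_nonneg_right zero_le_one)

theorem dominates_one : c.Dominates t₂ fun _ _ _ => 1 :=
  ⟨1, one_pos, fun μ ρ τ h => by rw [one_mul]; exact h.weight_le_one⟩

theorem dominates_inv_τL (hc : c.Pos) (ht₂ : 0 < t₂) {a : ℝ} (ha : 0 < a) :
    c.Dominates t₂ fun μ _ τ => 1 / (a * τ * c.L μ) := by
  have hL := hc.L_pos hc.maxLip_pos
  refine ⟨1 / (a * (t₂ * c.L c.maxLip + 1)), by positivity, fun μ ρ τ h => ?_⟩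
  have h1 := hc.L_pos h.μ_pos
  have h2 := h.τ_pos
  refine (mul_le_of_le_one_right (by positivity) (h.weight_le_one)).trans ?_
  beta_reduce
  rw [mul_assoc a τ]
  exact one_div_le_one_div_of_le (by positivity)
    (mul_le_mul_of_nonneg_left (h.τL_le hc ht₂) ha.le)

/-- Here √φ = O(κ³) while τL is bounded, so this term has the weight (1-ρ)²/κ³ itself and dictates
the form of `Dominates`. -/
theorem dominates_sqrt (hc : c.Pos) (ht₂ : 0 < t₂) :
    c.Dominates t₂ fun μ ρ τ =>
      (1 - ρ) ^ 2 / (32 * Real.sqrt (c.φ μ) * Real.sqrt (τ * c.L μ)) := by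
  have hL := hc.L_pos hc.maxLip_pos
  have hφ := hc.φ_pos c.maxLip
  refine ⟨1 / (32 * Real.sqrt (c.φ c.maxLip) * Real.sqrt (t₂ * c.L c.maxLip + 1)),
    by positivity, fun μ ρ τ h => ?_⟩
  have h1 := hc.L_pos h.μ_pos
  have h2 := h.τ_pos
  have h3 := hc.φ_pos μ
  have hκ := h.one_le_kappa
  have hκ0 : 0 < c.kappa μ := zero_lt_one.trans_le hκ
  have e1 : Real.sqrt (c.φ μ) ≤ c.kappa μ ^ 3 * Real.sqrt (c.φ c.maxLip) := by
    refine (Real.sqrt_le_sqrt (hc.φ_le h.μ_pos hκ)).trans (le_of_eq ?_)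
    rw [Real.sqrt_mul (by positivity), show c.kappa μ ^ 6 = (c.kappa μ ^ 3) ^ 2 by ring,
      Real.sqrt_sq (by positivity)]
  have e2 := Real.sqrt_le_sqrt (h.τL_le hc ht₂)
  have e3 : 32 * Real.sqrt (c.φ μ) * Real.sqrt (τ * c.L μ)
      ≤ 32 * (c.kappa μ ^ 3 * Real.sqrt (c.φ c.maxLip))
        * Real.sqrt (t₂ * c.L c.maxLip + 1) := by gcongr
  refine le_trans (le_of_eq ?_) (div_le_div_of_nonneg_left (sq_nonneg (1 - ρ))
    (by positivity) e3)
  field_simp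

/-- The common form of the three terms of `u₂ / (8 τ L)`. -/
theorem dominates_rpow (hc : c.Pos) (ht₂ : 0 < t₂) {a B : ℝ} (ha : 0 < a) (hB : 0 < B)
    {s : ℝ → ℝ} (hs : ∀ μ, 0 < s μ)
    (hsB : ∀ μ, 0 < μ → 1 ≤ c.kappa μ → s μ ≤ c.kappa μ ^ 6 * B) :
    c.Dominates t₂ fun μ ρ τ => (1 - ρ) ^ (4 / 3 : ℝ) * (τ * c.L μ) ^ (1 / 3 : ℝ) /
      (a * s μ ^ (1 / 3 : ℝ)) / (8 * τ * c.L μ) := by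
  have hL := hc.L_pos hc.maxLip_pos
  -- The added 1 gives A ≥ 1, so x/A ≤ (x/A)^(1/3) ≤ x^(1/3) for x = τL ≤ A. The quotient x^(1/3)/x
  -- then has the lower bound 1/A even when τL is small.
  set A := t₂ * c.L c.maxLip + 1 with hA
  have hA1 : 1 ≤ A := by rw [hA]; linarith [mul_pos ht₂ hL]
  have hA0 : 0 < A := by linarith
  refine ⟨1 / (8 * a * B ^ (1 / 3 : ℝ) * A), by positivity, fun μ ρ τ h => ?_⟩
  have h1 := hc.L_pos h.μ_pos
  have h2 := h.τ_pos
  have hκ := h.one_le_kappa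
  have hκ0 : 0 < c.kappa μ := zero_lt_one.trans_le hκ
  have hq : 0 < 1 - ρ := sub_pos.2 h.ρ_lt
  have hx0 : 0 < τ * c.L μ := mul_pos h2 h1
  have e1 : (1 - ρ) ^ 2 ≤ (1 - ρ) ^ (4 / 3 : ℝ) := by
    rw [← Real.rpow_natCast]
    exact Real.rpow_le_rpow_of_exponent_ge hq (by linarith [h.ρ_nonneg]) (by norm_num)
  have e2 : τ * c.L μ / A ≤ (τ * c.L μ) ^ (1 / 3 : ℝ) := by
    have h3 : τ * c.L μ / A ≤ 1 := (div_le_one hA0).2 (h.τL_le hc ht₂)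
    calc τ * c.L μ / A = (τ * c.L μ / A) ^ (1 : ℝ) := (Real.rpow_one _).symm
      _ ≤ (τ * c.L μ / A) ^ (1 / 3 : ℝ) :=
          Real.rpow_le_rpow_of_exponent_ge (by positivity) h3 (by norm_num)
      _ ≤ (τ * c.L μ) ^ (1 / 3 : ℝ) :=
          Real.rpow_le_rpow (by positivity) (div_le_self hx0.le hA1) (by norm_num)
  -- The cube root gives only κ²; it is weakened to κ³ to match the common weight.
  have e3 : s μ ^ (1 / 3 : ℝ) ≤ c.kappa μ ^ 3 * B ^ (1 / 3 : ℝ) := by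
    refine (Real.rpow_le_rpow (hs μ).le (hsB μ h.μ_pos hκ) (by norm_num)).trans ?_
    rw [Real.mul_rpow (by positivity) hB.le, ← Real.rpow_natCast, ← Real.rpow_mul hκ0.le,
      ← Real.rpow_natCast]
    exact mul_le_mul_of_nonneg_right
      (Real.rpow_le_rpow_of_exponent_le hκ (by norm_num)) (by positivity)
  have hs0 := hs μ
  have e4 : (1 - ρ) ^ 2 * (τ * c.L μ / A) / (a * (c.kappa μ ^ 3 * B ^ (1 / 3 : ℝ)))
      ≤ (1 - ρ) ^ (4 / 3 : ℝ) * (τ * c.L μ) ^ (1 / 3 : ℝ) / (a * s μ ^ (1 / 3 : ℝ)) := by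
    gcongr
  refine le_trans (le_of_eq ?_) (div_le_div_of_nonneg_right e4
    (by positivity : 0 ≤ 8 * τ * c.L μ))
  field_simp

theorem dominates_u₂ (hc : c.Pos) (ht₂ : 0 < t₂) :
    c.Dominates t₂ fun μ ρ τ => c.u₂ μ ρ τ / (8 * τ * c.L μ) := by
  have hφ := hc.φ_pos; have hP := hc.P_pos; have hx := hc.Lfgx_pos
  have hB : ∀ {k : ℕ} {μ B : ℝ}, k ≤ 6 → 0 < B → 1 ≤ c.kappa μ →
      c.kappa μ ^ k * B ≤ c.kappa μ ^ 6 * B := fun hk hB hκ =>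
    mul_le_mul_of_nonneg_right (pow_le_pow_right₀ hκ hk) hB.le
  have d1 := dominates_rpow hc ht₂ (by norm_num : (0 : ℝ) < 6) (hφ c.maxLip) hφ
    fun μ hμ hκ => hc.φ_le hμ hκ
  have d2 := dominates_rpow hc ht₂ four_pos
    (div_pos (mul_pos (hφ c.maxLip) (hx c.maxLip)) (hP c.maxLip))
    (s := fun μ => c.φ μ * c.Lfgx μ / c.P μ)
    (fun μ => div_pos (mul_pos (hφ μ) (hx μ)) (hP μ))
    fun μ hμ hκ => (hc.φ_mul_Lfgx_div_P_le hμ hκ).trans (hB (by norm_num)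
      (div_pos (mul_pos (hφ c.maxLip) (hx c.maxLip)) (hP c.maxLip)) hκ)
  have d3 := dominates_rpow hc ht₂ four_pos (hx c.maxLip) hx
    fun μ hμ hκ => (hc.Lfgx_le hκ).trans (hB (by norm_num) (hx c.maxLip) hκ)
  obtain ⟨k, hk, hd⟩ := Dominates.min d1 (Dominates.min d2 d3)
  refine ⟨k, hk, fun μ ρ τ h => (hd μ ρ τ h).trans (le_of_eq ?_)⟩
  have h0 : 0 ≤ 8 * τ * c.L μ := by
    have := h.τ_pos; have := hc.L_pos h.μ_pos; positivity
  beta_reduce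
  rw [u₂, ← min_div_div_right h0, ← min_div_div_right h0]
  congr 3
  rw [Real.div_rpow (mul_pos (hφ μ) (hx μ)).le (hP μ).le, Real.mul_rpow (hφ μ).le (hx μ).le]
  have := (Real.rpow_pos_of_pos (hP μ) (1 / 3)).ne'
  have := (Real.rpow_pos_of_pos (hφ μ) (1 / 3)).ne'
  have := (Real.rpow_pos_of_pos (hx μ) (1 / 3)).ne'
  field_simp

/-- The minimum is at least μ/L_g, of order 1/κ, and τL_{v*} is bounded; so 1/κ, which exceeds the
weight, is the true order of this lower bound. -/
theorem dominates_u₃_left (hc : c.Pos) (ht₂ : 0 < t₂) :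
    c.Dominates t₂ fun μ _ τ =>
      min 1 (2 * μ / (μ + c.Lgθ)) / (96 * τ * c.Lvstar μ * c.Cgxθ) := by
  have hL := hc.Lvstar_pos hc.maxLip_pos
  have hℓ := hc.maxLip_pos; have hg := hc.Lgθ; have hC := hc.Cgxθ
  refine ⟨c.maxLip / c.Lgθ / (96 * (t₂ * c.Lvstar c.maxLip) * c.Cgxθ), by positivity,
    fun μ ρ τ h => ?_⟩
  have hμ := h.μ_pos; have hτ := h.τ_pos; have hLμ := hc.Lvstar_pos hμ
  have hκ := h.one_le_kappa
  have e1 : μ / c.Lgθ ≤ min 1 (2 * μ / (μ + c.Lgθ)) := by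
    refine le_min ((div_le_one hg).2 h.μ_le) ?_
    rw [div_le_div_iff₀ hg (by positivity)]
    nlinarith [h.μ_le]
  have e2 := h.τ_mul_le ht₂ hL.le (hc.Lvstar_le hκ)
  have e3 : μ / c.Lgθ / (96 * (t₂ * c.Lvstar c.maxLip) * c.Cgxθ)
      ≤ min 1 (2 * μ / (μ + c.Lgθ)) / (96 * τ * c.Lvstar μ * c.Cgxθ) := by
    rw [mul_assoc 96 τ]
    gcongr
  refine (mul_le_mul_of_nonneg_left (h.weight_le_inv) (by positivity)).trans
    (le_trans (le_of_eq ?_) e3)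
  rw [kappa_eq]
  field_simp

theorem dominates_u₃_right (hc : c.Pos) (ht₂ : 0 < t₂) :
    c.Dominates t₂ fun μ _ τ =>
      min (2 / (μ + c.Lgθ)) ((μ + c.Lgθ) / (2 * μ * c.Lgθ)) * c.ωθ μ /
      (12 * τ * Real.sqrt (c.P μ) * c.Lθstar μ) := by
  have hℓ := hc.maxLip_pos; have hg := hc.Lgθ
  have hLs := hc.Lθstar_pos hℓ; have hPs := hc.P_pos c.maxLip; have hωs := hc.ωθ_pos hℓ
  refine ⟨1 / c.Lgθ * c.ωθ c.maxLip
    / (12 * (t₂ * (Real.sqrt (c.P c.maxLip) * c.Lθstar c.maxLip))), by positivity,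
    fun μ ρ τ h => ?_⟩
  have hμ := h.μ_pos; have hτ := h.τ_pos; have hLμ := hc.Lθstar_pos hμ
  have hP := hc.P_pos μ; have hω := hc.ωθ_pos hμ
  have hκ := h.one_le_kappa
  have hκ0 : 0 < c.kappa μ := zero_lt_one.trans_le hκ
  have e1 : 1 / c.Lgθ ≤ min (2 / (μ + c.Lgθ)) ((μ + c.Lgθ) / (2 * μ * c.Lgθ)) := by
    refine le_min ?_ ?_
    · rw [div_le_div_iff₀ hg (by positivity)]; linarith [h.μ_le]
    · rw [div_le_div_iff₀ hg (by positivity)]; nlinarith [h.μ_le]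
  have e2 : Real.sqrt (c.P μ) ≤ c.kappa μ ^ 2 * Real.sqrt (c.P c.maxLip) := by
    refine (Real.sqrt_le_sqrt (hc.P_le hκ)).trans (le_of_eq ?_)
    rw [Real.sqrt_mul (by positivity), show c.kappa μ ^ 4 = (c.kappa μ ^ 2) ^ 2 by ring,
      Real.sqrt_sq (by positivity)]
  have e3 : Real.sqrt (c.P μ) * c.Lθstar μ
      ≤ c.kappa μ ^ 3 * (Real.sqrt (c.P c.maxLip) * c.Lθstar c.maxLip) := by
    rw [hc.Lθstar_eq]
    refine (mul_le_mul_of_nonneg_right e2 (by positivity)).trans (le_of_eq (by ring))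
  have e4 := h.τ_mul_le ht₂ (by positivity) e3
  have e5 : c.ωθ c.maxLip / c.kappa μ ≤ c.ωθ μ := by
    rw [div_le_iff₀ hκ0, mul_comm]; exact hc.ωθ_le hμ hκ
  have e6 : 1 / c.Lgθ * (c.ωθ c.maxLip / c.kappa μ)
      / (12 * (t₂ * (Real.sqrt (c.P c.maxLip) * c.Lθstar c.maxLip)))
      ≤ min (2 / (μ + c.Lgθ)) ((μ + c.Lgθ) / (2 * μ * c.Lgθ)) * c.ωθ μ /
      (12 * τ * Real.sqrt (c.P μ) * c.Lθstar μ) := by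
    rw [mul_assoc 12 τ, mul_assoc 12, mul_assoc τ]
    gcongr
  refine (mul_le_mul_of_nonneg_left (h.weight_le_inv) (by positivity)).trans
    (le_trans (le_of_eq ?_) e6)
  field_simp

theorem dominates_uPrime (hc : c.Pos) (ht₂ : 0 < t₂) :
    c.Dominates t₂ fun μ ρ τ => c.uPrime μ ρ τ := by
  have d2 := Dominates.min (dominates_inv_τL hc ht₂ (by norm_num : (0 : ℝ) < 8))
    (dominates_u₂ hc ht₂)
  obtain ⟨k, hk, hd⟩ := Dominates.min (dominates_one) (Dominates.min
    (Dominates.min (dominates_inv_τL hc ht₂ two_pos) (dominates_sqrt hc ht₂))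
    (Dominates.min d2
      (Dominates.min (dominates_u₃_left hc ht₂) (dominates_u₃_right hc ht₂))))
  refine ⟨k, hk, fun μ ρ τ h => (hd μ ρ τ h).trans (le_of_eq ?_)⟩
  have h0 : 0 ≤ 8 * τ * c.L μ := by
    have := h.τ_pos; have := hc.L_pos h.μ_pos; positivity
  beta_reduce
  rw [uPrime, u₁, u₃, ← min_div_div_right h0]

end Constants

/-! ### Admissible step-sizes and the initial energy -/

section

variable {c : Constants} {μ ρ τ α cγ clam cβ : ℝ}

theorem sq_le_of_le_u₁ (hc : c.Pos) (hμ : 0 < μ) (hτ : 0 < τ) (hα : 0 < α)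
    (h : α ≤ c.uPrime μ ρ τ) : 1024 * c.φ μ * (τ * c.L μ) * α ^ 2 ≤ (1 - ρ) ^ 4 := by
  have hφ := hc.φ_pos μ
  have hL := hc.L_pos hμ
  have h1 : α ≤ (1 - ρ) ^ 2 / (32 * Real.sqrt (c.φ μ) * Real.sqrt (τ * c.L μ)) :=
    h.trans ((min_le_right _ _).trans ((min_le_left _ _).trans (min_le_right _ _)))
  rw [le_div_iff₀ (by positivity)] at h1
  have h2 := pow_le_pow_left₀ (by positivity) h1 2
  rw [mul_pow, mul_pow, mul_pow, Real.sq_sqrt hφ.le, Real.sq_sqrt (by positivity)] at h2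
  linarith

/-- Only the first of the three terms of `u₂` is used; cubing clears its fractional powers. -/
theorem cube_le_of_le_u₂ (hc : c.Pos) (hμ : 0 < μ) (hρ : ρ < 1) (hτ : 0 < τ) {γ : ℝ} (hγ : 0 ≤ γ)
    (h : γ ≤ c.u₂ μ ρ τ) : 216 * c.φ μ * γ ^ 3 ≤ (1 - ρ) ^ 4 * (τ * c.L μ) := by
  have hφ := hc.φ_pos μ
  have hL := hc.L_pos hμ
  have hr : 0 < 1 - ρ := sub_pos.2 hρ
  have h1 := h.trans (min_le_left _ _)
  rw [le_div_iff₀ (by positivity)] at h1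
  have h2 := pow_le_pow_left₀ (by positivity) h1 3
  have e : ∀ {x : ℝ}, 0 ≤ x → (x ^ (1 / 3 : ℝ)) ^ 3 = x := fun hx => by
    rw [← Real.rpow_natCast, ← Real.rpow_mul hx]; norm_num
  have e' : ((1 - ρ) ^ (4 / 3 : ℝ)) ^ 3 = (1 - ρ) ^ 4 := by
    rw [← Real.rpow_natCast, ← Real.rpow_mul hr.le, ← Real.rpow_natCast]; norm_num
  rw [mul_pow, mul_pow, mul_pow, e hφ.le, e (by positivity), e'] at h2
  linarith

theorem stepBounds_of_admissible (hc : c.Pos) (hμ : 0 < μ) (hρ : ρ < 1)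
    (hτ : 0 < τ) (hτ1 : τ < 1) (hα : 0 < α) (hu : α ≤ c.uPrime μ ρ τ)
    (h : c.AdmissibleRatios μ ρ τ α cγ clam cβ) :
    StepBounds c μ ρ ⟨α, cβ * α, clam * α, cγ * α, τ⟩ := by
  have hL := hc.L_pos hμ
  have hLv := hc.Lvstar_pos hμ
  have hω := hc.ωθ_pos hμ
  have hLθ := hc.Lθstar_pos hμ
  have hP := hc.P_pos μ
  have hφ := hc.φ_pos μ
  have hg := hc.Lgθ
  have hC := hc.Cgxθ
  have hcγ : 0 < cγ := lt_of_lt_of_le (by positivity) h.gamma_lower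
  have hcl : 0 < clam := lt_of_lt_of_le (by positivity) h.lam_lower
  have hcβ : 0 < cβ := lt_of_lt_of_le (by positivity) h.beta_lower
  have hl1 := h.lam_upper.le.trans (min_le_left _ _)
  have hl2 := h.lam_upper.le.trans (min_le_right _ _)
  have hb := h.beta_upper.le.trans (min_le_left _ _)
  rw [le_div_iff₀ hμ] at hl1
  rw [le_div_iff₀ (by positivity)] at hl2 hb
  have hγL : 4 * c.L μ * (τ * α) ≤ cγ * α := by
    have := mul_le_mul_of_nonneg_right h.gamma_lower hα.le
    linarith
  refine ⟨hτ, hτ1, hα, mul_pos hcγ hα, h.gamma_upper.trans_le (min_le_left _ _),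
    mul_pos hcl hα, mul_pos hcβ hα, hl1, hl2, hb, ?_, hγL, ?_, ?_, ?_⟩
  · have h1 : α ≤ 1 / (2 * τ * c.L μ) :=
      hu.trans ((min_le_right _ _).trans ((min_le_left _ _).trans (min_le_left _ _)))
    rw [le_div_iff₀ (by positivity)] at h1
    linarith
  · have h1 := mul_le_mul_of_nonneg_right h.lam_lower (mul_pos hα hμ).le
    have h2 : 48 * c.Lvstar μ * c.Cgxθ / μ * τ * (α * μ)
        = 48 * c.Lvstar μ * c.Cgxθ * (τ * α) := by field_simp
    change _ ≤ clam * α * μ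
    linarith
  · have h1 := mul_le_mul_of_nonneg_right h.beta_lower (mul_pos hα hω).le
    have h2 : 6 * c.Lθstar μ / c.ωθ μ * Real.sqrt (c.P μ) * τ * (α * c.ωθ μ)
        = 6 * c.Lθstar μ * Real.sqrt (c.P μ) * (τ * α) := by field_simp
    change _ ≤ cβ * α * c.ωθ μ
    linarith
  · change 864 * c.φ μ * (α * (cγ * α)) ^ 2 ≤ (1 - ρ) ^ 4
    have hγ : 0 < cγ * α := mul_pos hcγ hα
    have h1 := cube_le_of_le_u₂ hc hμ hρ hτ hγ.le (h.gamma_upper.le.trans (min_le_right _ _))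
    set γ := cγ * α
    have hα1 : α ≤ 1 := hu.trans (min_le_left _ _)
    have hx : 0 < τ * c.L μ := mul_pos hτ hL
    -- Multiply the goal by τL: 864φα²γ²·τL = 216φαγ²·(4Lτα) ≤ 216φαγ³ ≤ α(1-ρ)⁴τL, and α ≤ 1.
    have h2 := mul_le_mul_of_nonneg_left hγL
      (by positivity : 0 ≤ 216 * c.φ μ * α * γ ^ 2)
    have h3 := mul_le_mul_of_nonneg_left h1 hα.le
    have h4 := mul_le_mul_of_nonneg_right hα1
      (by positivity : 0 ≤ (1 - ρ) ^ 4 * (τ * c.L μ))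
    refine le_of_mul_le_mul_right ?_ hx
    linarith

/-- A bound for the initial Lyapunov function in units of `κ`. -/
noncomputable def initialBound (c : Constants) (D : ℝ) : ℝ :=
  D + 3 * D / c.Lfx + c.Cgxθ * c.Cfθ / c.Lgθθ + c.Cgxθ * c.Lgθ * D / c.Lfθ
    + c.Cgxθ * c.Cfθ / c.Lgθθ + Real.sqrt (c.P c.maxLip) * D / c.Lθstar c.maxLip

theorem initialBound_pos (hc : c.Pos) {D : ℝ} (hD : 0 < D) : 0 < initialBound c D := by
  have h1 := hc.Lfx; have h2 := hc.Lgθθ; have h3 := hc.Lfθ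
  have h4 := hc.Lθstar_pos hc.maxLip_pos; have h5 := hc.Cgxθ; have h6 := hc.Cfθ
  have h7 := hc.Lgθ
  rw [initialBound]; positivity

variable {t : StepSizes} {D : ℝ}

/-- The lower bound on γ caps the weight by 3/(16L). The term M², of order 1/μ², is harmless because
L itself contains C_{g,xθ}C_{f,θ}L_{g,θθ}/μ². -/
theorem initial_z_energy_le (hc : c.Pos) (hμ : 0 < μ) (h : StepBounds c μ ρ t) (hD : 0 < D)
    {Z : ℝ} (hZ : Z ≤ 6 * D + 4 * c.Cgxθ ^ 2 * c.M μ ^ 2) :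
    3 * (t.τ * t.α) / (4 * t.γ) * Z ≤ 2 * D / c.Lfx + c.Cgxθ * c.Cfθ / c.Lgθθ := by
  have h1 := hc.Lfx; have h2 := hc.Lgθθ; have h5 := hc.Cgxθ; have h6 := hc.Cfθ
  have h7 := h.γ_pos; have h8 := hc.Lfθ; have h9 := hc.Lgxθ
  have hT : 0 < t.τ * t.α := mul_pos h.τ_pos h.α_pos
  have hL := hc.L_pos hμ
  have hγ := h.γ_lower
  set T := t.τ * t.α
  have ha : 3 * T / (4 * t.γ) ≤ 3 / (16 * c.L μ) := by
    rw [div_le_div_iff₀ (by positivity) (by positivity)]; linarith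
  have hb0 : c.Lfx + c.Cgxθ * (c.Cfθ * c.Lgθθ / μ ^ 2) ≤ c.L μ := by
    have hθ := (hc.Lθstar_pos hμ).le
    have e : c.Lfx + c.Cgxθ * (c.Cfθ * c.Lgθθ / μ ^ 2)
        ≤ c.Lfx + c.Cgxθ * c.Lv μ + c.Cfθ * c.Lgxθ / μ := by
      rw [Constants.Lv, mul_add]
      have e1 : 0 ≤ c.Cgxθ * (c.Lfθ / μ) := by positivity
      have e2 : 0 ≤ c.Cfθ * c.Lgxθ / μ := by positivity
      linarith
    refine e.trans ?_
    rw [Constants.L]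
    have := hc.Lv_pos hμ
    exact le_mul_of_one_le_right (by positivity) (by linarith)
  have hL1 : c.Lfx ≤ c.L μ := le_trans (le_add_of_nonneg_right (by positivity)) hb0
  have hL2 : c.Cgxθ * (c.Cfθ * c.Lgθθ / μ ^ 2) ≤ c.L μ :=
    le_trans (le_add_of_nonneg_left h1.le) hb0
  refine (mul_le_mul_of_nonneg_left hZ (by positivity)).trans
    ((mul_le_mul_of_nonneg_right ha (by positivity)).trans ?_)
  rw [mul_add]
  refine add_le_add ?_ ?_
  · rw [div_mul_eq_mul_div, div_le_div_iff₀ (by positivity) h1]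
    nlinarith [mul_le_mul_of_nonneg_left hL1 hD.le, mul_pos hD hL]
  · rw [div_mul_eq_mul_div, div_le_div_iff₀ (by positivity) h2]
    have e3 : 3 * (4 * c.Cgxθ ^ 2 * c.M μ ^ 2) * c.Lgθθ
        = 12 * (c.Cgxθ * c.Cfθ) * (c.Cgxθ * (c.Cfθ * c.Lgθθ / μ ^ 2)) := by
      rw [Constants.M]; field_simp; norm_num
    rw [e3]
    have e4 := mul_le_mul_of_nonneg_left hL2 (by positivity : 0 ≤ 12 * (c.Cgxθ * c.Cfθ))
    have e5 : 0 < c.Cgxθ * c.Cfθ * c.L μ := by positivity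
    linarith

/-- The weight is at most C_{g,xθ}/(6L_{v*}); the 1/μ² part of L_{v*} absorbs M², and its part
L_{f,θ}/μ ≥ L_{f,θ}/L_{g,θ} handles D. -/
theorem initial_v_energy_le (hc : c.Pos) (hμ : 0 < μ) (hμL : μ ≤ c.Lgθ)
    (h : StepBounds c μ ρ t) (hD : 0 < D) {V : ℝ} (hV : V ≤ 2 * D + 2 * c.M μ ^ 2) :
    8 * c.Cgxθ ^ 2 * (t.τ * t.α) / (t.lam * μ) * V
      ≤ c.Cgxθ * c.Lgθ * D / c.Lfθ + c.Cgxθ * c.Cfθ / c.Lgθθ := by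
  have h2 := hc.Lgθθ; have h5 := hc.Cgxθ; have h6 := hc.Cfθ
  have h7 := h.lam_pos; have h8 := hc.Lfθ
  have hT : 0 < t.τ * t.α := mul_pos h.τ_pos h.α_pos
  have hL := hc.Lvstar_pos hμ
  have hl := h.lam_lower
  set T := t.τ * t.α
  have ha : 8 * c.Cgxθ ^ 2 * T / (t.lam * μ) ≤ c.Cgxθ / (6 * c.Lvstar μ) := by
    rw [div_le_div_iff₀ (by positivity) (by positivity)]
    have := mul_le_mul_of_nonneg_left hl h5.le
    linarith
  have hb0 : c.Lfθ / μ + c.Cfθ * c.Lgθθ / μ ^ 2 ≤ c.Lvstar μ := by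
    have hθ := (hc.Lθstar_pos hμ).le
    exact le_mul_of_one_le_right (hc.Lv_pos hμ).le (by linarith)
  have hL1 : c.Lfθ / c.Lgθ ≤ c.Lvstar μ := by
    have e : c.Lfθ / c.Lgθ ≤ c.Lfθ / μ := by gcongr
    exact e.trans (le_trans (le_add_of_nonneg_right (by positivity)) hb0)
  rw [div_le_iff₀ hc.Lgθ] at hL1
  have hL2 : c.Cfθ * c.Lgθθ / μ ^ 2 ≤ c.Lvstar μ :=
    le_trans (le_add_of_nonneg_left (by positivity)) hb0
  refine (mul_le_mul_of_nonneg_left hV (by positivity)).trans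
    ((mul_le_mul_of_nonneg_right ha (by positivity)).trans ?_)
  rw [mul_add]
  refine add_le_add ?_ ?_
  · rw [div_mul_eq_mul_div, div_le_div_iff₀ (by positivity) h8]
    have e4 := mul_le_mul_of_nonneg_left hL1 (by positivity : 0 ≤ 2 * c.Cgxθ * D)
    have e5 : 0 < c.Cgxθ * c.Lgθ * D * c.Lvstar μ := by
      have := hc.Lgθ; positivity
    linarith
  · rw [div_mul_eq_mul_div, div_le_div_iff₀ (by positivity) h2]
    have e3 : c.Cgxθ * (2 * c.M μ ^ 2) * c.Lgθθ
        = 2 * (c.Cgxθ * c.Cfθ) * (c.Cfθ * c.Lgθθ / μ ^ 2) := by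
      rw [Constants.M]; field_simp
    rw [e3]
    have e4 := mul_le_mul_of_nonneg_left hL2 (by positivity : 0 ≤ 2 * (c.Cgxθ * c.Cfθ))
    have e5 : 0 < c.Cgxθ * c.Cfθ * c.Lvstar μ := by positivity
    linarith

/-- The lower bound on β caps the weight by a multiple of √P/L_{θ*}, of order κ²/κ. Among the
initial bounds this is the only one that grows with κ. -/
theorem initial_theta_energy_le (hc : c.Pos) (hμ : 0 < μ) (hμL : μ ≤ c.Lgθ)
    (h : StepBounds c μ ρ t) (hD : 0 < D) {Θ : ℝ} (hΘ : Θ ≤ D) :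
    c.P μ * (t.τ * t.α) / (t.β * c.ωθ μ) * Θ
      ≤ c.kappa μ * (Real.sqrt (c.P c.maxLip) * D / c.Lθstar c.maxLip) := by
  have hT : 0 < t.τ * t.α := mul_pos h.τ_pos h.α_pos
  have hβ := h.β_pos; have hω := hc.ωθ_pos hμ; have hP := hc.P_pos μ
  have hθ := hc.Lθstar_pos hμ; have hθs := hc.Lθstar_pos hc.maxLip_pos
  have hκ := Constants.one_le_kappa hμ hμL
  have hκ0 : 0 < c.kappa μ := zero_lt_one.trans_le hκ
  have hPs := Real.sqrt_pos.2 hP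
  have hb := h.β_lower
  set T := t.τ * t.α
  have ha : c.P μ * T / (t.β * c.ωθ μ) ≤ Real.sqrt (c.P μ) / c.Lθstar μ := by
    rw [div_le_div_iff₀ (by positivity) (by positivity)]
    have e1 := mul_le_mul_of_nonneg_left hb hPs.le
    have e2 : Real.sqrt (c.P μ) * (6 * c.Lθstar μ * Real.sqrt (c.P μ) * T)
        = 6 * (c.P μ * T * c.Lθstar μ) := by
      nth_rewrite 3 [← Real.mul_self_sqrt hP.le]
      ring
    have e3 : 0 < c.P μ * T * c.Lθstar μ := by positivity
    linarith
  have e2 : Real.sqrt (c.P μ) ≤ c.kappa μ ^ 2 * Real.sqrt (c.P c.maxLip) := by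
    refine (Real.sqrt_le_sqrt (hc.P_le hκ)).trans (le_of_eq ?_)
    rw [Real.sqrt_mul (by positivity), show c.kappa μ ^ 4 = (c.kappa μ ^ 2) ^ 2 by ring,
      Real.sqrt_sq (by positivity)]
  have e3 : Real.sqrt (c.P μ) / c.Lθstar μ
      ≤ c.kappa μ ^ 2 * Real.sqrt (c.P c.maxLip) / c.Lθstar μ := by gcongr
  refine (mul_le_mul_of_nonneg_left hΘ (by positivity)).trans
    ((mul_le_mul_of_nonneg_right (ha.trans e3) hD.le).trans (le_of_eq ?_))
  rw [hc.Lθstar_eq μ]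
  field_simp

/-- The square root term of `u₁` bounds φτLα² by a multiple of (1-ρ)⁴, which offsets the (1-ρ)³ in
the denominator of the weight. -/
theorem initial_y_energy_le (hc : c.Pos) (hμ : 0 < μ) (hρ0 : 0 ≤ ρ) (hρ : ρ < 1)
    (h : StepBounds c μ ρ t) (hα1 : t.α ≤ 1)
    (hu : 1024 * c.φ μ * (t.τ * c.L μ) * t.α ^ 2 ≤ (1 - ρ) ^ 4)
    (hL1 : c.Lfx ≤ c.L μ) (hD : 0 < D) {Y : ℝ} (hY : Y ≤ D) :
    24 * c.φ μ * t.τ * t.α ^ 3 / (1 - ρ) ^ 3 * Y ≤ D / c.Lfx := by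
  have h1 := hc.Lfx
  have hL := hc.L_pos hμ
  have hφ := hc.φ_pos μ
  have hτ := h.τ_pos
  have hα := h.α_pos
  have hr : 0 < 1 - ρ := sub_pos.2 hρ
  have hr1 : 1 - ρ ≤ 1 := by linarith
  have e1 : 24 * c.φ μ * t.τ * t.α ^ 3 / (1 - ρ) ^ 3 ≤ 1 / c.L μ := by
    rw [div_le_div_iff₀ (by positivity) hL]
    have e2 := mul_le_mul_of_nonneg_right hu hα.le
    have e3 : (1 - ρ) ^ 4 * t.α ≤ (1 - ρ) ^ 3 * 1 :=
      mul_le_mul (pow_le_pow_of_le_one hr.le hr1 (by norm_num)) hα1 hα.le (by positivity)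
    have e4 : 0 < c.φ μ * t.τ * t.α ^ 3 * c.L μ := by positivity
    nlinarith
  have e5 : 1 / c.L μ ≤ 1 / c.Lfx := one_div_le_one_div_of_le h1 hL1
  refine (mul_le_mul_of_nonneg_left hY (by positivity)).trans
    ((mul_le_mul_of_nonneg_right (e1.trans e5) hD.le).trans (le_of_eq ?_))
  ring

theorem Lfx_le_L (hc : c.Pos) (hμ : 0 < μ) : c.Lfx ≤ c.L μ := by
  have h1 := hc.Lfx; have h2 := hc.Cgxθ; have h3 := hc.Lv_pos hμ; have h4 := hc.Lθstar_pos hμ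
  have h5 := hc.Cfθ; have h6 := hc.Lgxθ
  have e : c.Lfx ≤ c.Lfx + c.Cgxθ * c.Lv μ + c.Cfθ * c.Lgxθ / μ := by
    rw [add_assoc]; exact le_add_of_nonneg_right (by positivity)
  exact e.trans (le_mul_of_one_le_right (by positivity) (by linarith))

variable {m n p : ℕ} {f g : Fin m → E n → E p → ℝ} {S : State m n p}

theorem initial_zError_le (hm : 0 < m) (hN : ∀ i, NodeAssumption c μ (f i) (g i))
    (h0 : InitAssumption f g D S) :
    zError f g S ≤ 6 * D + 4 * c.Cgxθ ^ 2 * c.M μ ^ 2 := by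
  have h1 : ∀ i, ‖S.z i - hypergrad (f i) (g i) S.xbar‖ ^ 2
      ≤ 2 * ‖S.z i‖ ^ 2 + 4 * ‖gradX (f i) S.xbar (innerSol (g i) S.xbar)‖ ^ 2
        + 4 * c.Cgxθ ^ 2 * c.M μ ^ 2 := by
    intro i
    have e1 := norm_sub_sq_le_two (S.z i) (hypergrad (f i) (g i) S.xbar)
    have e2 := norm_sub_sq_le_two (gradX (f i) S.xbar (innerSol (g i) S.xbar))
      (hessXTheta (g i) S.xbar (innerSol (g i) S.xbar) (adjointSol (f i) (g i) S.xbar))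
    have e3 := (hessXTheta (g i) S.xbar (innerSol (g i) S.xbar)).le_of_opNorm_le
      ((hN i).g_bound _ _) (adjointSol (f i) (g i) S.xbar)
    have e4 := e3.trans (mul_le_mul_of_nonneg_left ((hN i).norm_adjointSol_le S.xbar)
      (hN i).cpos.Cgxθ.le)
    have e5 := pow_le_pow_left₀ (norm_nonneg _) e4 2
    rw [mul_pow] at e5
    rw [← hypergrad] at e2
    linarith
  refine (meanSq_le_of_le h1).trans ?_
  have hm' : (m : ℝ) ≠ 0 := by positivity
  have e1 := h0.z_le
  have e2 := h0.grad_le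
  rw [Finset.sum_add_distrib, Finset.sum_add_distrib, ← Finset.mul_sum, ← Finset.mul_sum,
    mul_add, mul_add, Finset.sum_const, Finset.card_univ, Fintype.card_fin, nsmul_eq_mul,
    one_div, inv_mul_cancel_left₀ hm']
  rw [one_div] at e1 e2
  linarith

theorem initial_vError_le (hm : 0 < m) (hN : ∀ i, NodeAssumption c μ (f i) (g i))
    (h0 : InitAssumption f g D S) : vError f g S ≤ 2 * D + 2 * c.M μ ^ 2 := by
  have h1 : ∀ i, ‖S.v i - adjointSol (f i) (g i) S.xbar‖ ^ 2
      ≤ 2 * ‖S.v i‖ ^ 2 + 2 * c.M μ ^ 2 := by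
    intro i
    have e1 := norm_sub_sq_le_two (S.v i) (adjointSol (f i) (g i) S.xbar)
    have e2 := pow_le_pow_left₀ (norm_nonneg _) ((hN i).norm_adjointSol_le S.xbar) 2
    linarith
  refine (meanSq_le_of_le h1).trans ?_
  have hm' : (m : ℝ) ≠ 0 := by positivity
  have e1 := h0.v_le
  rw [Finset.sum_add_distrib, ← Finset.mul_sum, mul_add, Finset.sum_const, Finset.card_univ,
    Fintype.card_fin, nsmul_eq_mul, one_div, inv_mul_cancel_left₀ hm']
  rw [one_div] at e1
  linarith

/-- The common start makes the `x` consensus error vanish, and y⁰ = z⁰ bounds that of `y` by D. The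
bounded terms are enlarged by the factor κ ≥ 1 to match the `θ` term. -/
theorem initial_lyapunov_le (hm : 0 < m) (hN : ∀ i, NodeAssumption c μ (f i) (g i))
    (hμL : μ ≤ c.Lgθ) (hρ0 : 0 ≤ ρ) (hρ : ρ < 1) (h : StepBounds c μ ρ t) (hα1 : t.α ≤ 1)
    (hu : 1024 * c.φ μ * (t.τ * c.L μ) * t.α ^ 2 ≤ (1 - ρ) ^ 4) (hD : 0 < D)
    (h0 : InitAssumption f g D S) :
    lyapunov c μ ρ t f g S - ⨅ x, objective f g x ≤ c.kappa μ * initialBound c D := by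
  have hc := (hN ⟨0, hm⟩).cpos
  have hμ := (hN ⟨0, hm⟩).μpos
  have hκ := Constants.one_le_kappa hμ hμL
  have e1 := initial_z_energy_le hc hμ h hD (initial_zError_le hm hN h0)
  have e2 := initial_v_energy_le hc hμ hμL h hD (initial_vError_le hm hN h0)
  have e3 := initial_theta_energy_le hc hμ hμL h hD
    (show thetaError g S ≤ D from h0.theta_le)
  have hY : meanSq (fun i => S.y i - mean S.y) ≤ D :=
    (meanSq_sub_mean_le hm S.y).trans (by
      rw [funext h0.y_eq]
      exact h0.z_le)
  have e4 := initial_y_energy_le hc hμ hρ0 hρ h hα1 hu (Lfx_le_L hc hμ) hD hY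
  have hX : meanSq (fun i => S.x i - S.xbar) = 0 := by
    have hx : ∀ i, S.x i - S.xbar = 0 := by
      intro i
      have : S.x = fun _ => S.x i := funext fun j => h0.x_eq j i
      change S.x i - mean S.x = 0
      rw [this, mean_const hm, sub_self]
    simp [meanSq, hx]
  have h1 := hc.Lfx; have h2 := hc.Lgθθ; have h3 := hc.Lfθ; have h5 := hc.Cgxθ
  have h6 := hc.Cfθ; have h7 := hc.Lgθ
  have e5 : D + 3 * D / c.Lfx + c.Cgxθ * c.Cfθ / c.Lgθθ + c.Cgxθ * c.Lgθ * D / c.Lfθ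
      + c.Cgxθ * c.Cfθ / c.Lgθθ ≤ c.kappa μ * (D + 3 * D / c.Lfx + c.Cgxθ * c.Cfθ / c.Lgθθ
      + c.Cgxθ * c.Lgθ * D / c.Lfθ + c.Cgxθ * c.Cfθ / c.Lgθθ) :=
    le_mul_of_one_le_left (by positivity) hκ
  have e6 : 3 * D / c.Lfx = 2 * D / c.Lfx + D / c.Lfx := by ring
  rw [lyapunov, errorEnergy, hX, mul_zero, initialBound, mul_add]
  rw [e6] at e5 ⊢
  linarith [h0.gap]

end

theorem nodeAssumption_of_assumptions {m n p : ℕ} {c : Constants} (hc : c.Pos) {μ : ℝ}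
    (hμ : 0 < μ) {f g : Fin m → E n → E p → ℝ} (hf : OuterAssumption c f g)
    (hg : InnerAssumption c μ g) (i : Fin m) : NodeAssumption c μ (f i) (g i) where
  cpos := hc
  μpos := hμ
  f_contDiff := hf.contDiff i
  f_lipX := hf.lipschitz_gradX i
  f_lipTheta := hf.lipschitz_gradTheta i
  f_bound := hf.bound_gradTheta i
  g_convex := hg.strongConvex i
  g_contDiff := hg.contDiff i
  g_lipTheta := hg.lipschitz_gradTheta i
  g_lipXTheta := hg.lipschitz_hessXTheta i
  g_lipThetaTheta := hg.lipschitz_hessThetaTheta i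
  g_bound := hg.bound_hessXTheta i

end LoPA

/-! ### Assembly of the rate. -/

theorem mainTheorem7 (c : LoPA.Constants) (hc : c.Pos) (D t₁ t₂ : ℝ)
    (hD : 0 < D) (ht₁ : 0 < t₁) (ht₂ : 0 < t₂) :
    ∃ C : ℝ, 0 < C ∧
      ∀ (μ : ℝ) (m n p : ℕ) (edge : Fin m → Fin m → Prop) (W : Matrix (Fin m) (Fin m) ℝ)
        (f g : Fin m → LoPA.E n → LoPA.E p → ℝ) (S₀ : LoPA.State m n p)
        (α τ cγ clam cβ : ℝ),
        0 < μ → 0 < m → 0 < p →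
        LoPA.NetworkAssumption edge W → LoPA.rho W < 1 →
        LoPA.OuterAssumption c f g → LoPA.InnerAssumption c μ g →
        BddBelow (Set.range (LoPA.objective f g)) →
        LoPA.InitAssumption f g D S₀ →
        0 < τ → τ < 1 → t₁ / c.kappa μ ^ 4 ≤ τ → τ ≤ t₂ / c.kappa μ ^ 4 →
        0 < α → α ≤ c.uPrime μ (LoPA.rho W) τ →
        c.AdmissibleRatios μ (LoPA.rho W) τ α cγ clam cβ →
        Differentiable ℝ (LoPA.objective f g) ∧
        ∀ K : ℕ, 1 ≤ K →
          (1 / ((K : ℝ) + 1)) * ∑ k ∈ Finset.range (K + 1),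
            ‖gradient (LoPA.objective f g)
              (LoPA.iter f g W ⟨α, cβ * α, clam * α, cγ * α, τ⟩ S₀ k).xbar‖ ^ 2
          ≤ C * (c.uPrime μ (LoPA.rho W) τ / α) *
              (c.kappa μ ^ 8 / ((1 - LoPA.rho W) ^ 2 * (K : ℝ))) := by
  obtain ⟨k₀, hk₀, hu'⟩ := LoPA.Constants.dominates_uPrime (t₂ := t₂) hc ht₂
  have hB := LoPA.initialBound_pos hc hD
  refine ⟨2 * LoPA.initialBound c D / (t₁ * k₀), by positivity, ?_⟩
  intro μ m n p edge W f g S₀ α τ cγ clam cβ hμ hm hp hW hρ hf hg hbdd h0 hτ hτ1 hτl hτu hα hαu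
    hadm
  have hN := LoPA.nodeAssumption_of_assumptions hc hμ hf hg
  refine ⟨fun x => (LoPA.hasGradientAt_objective hN x).differentiableAt, fun K hK => ?_⟩
  have : NeZero p := ⟨hp.ne'⟩
  have hμL : μ ≤ c.Lgθ := LoPA.modulus_le ((hN ⟨0, hm⟩).g_contDiff.of_le one_le_two)
    (hN ⟨0, hm⟩).g_convex (hN ⟨0, hm⟩).g_lipTheta
  have hρ0 : 0 ≤ LoPA.rho W := sq_nonneg _
  have ht := LoPA.stepBounds_of_admissible hc hμ hρ hτ hτ1 hα hαu hadm
  have hyz : LoPA.mean S₀.y = LoPA.mean S₀.z := by rw [funext h0.y_eq]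
  have h1 := LoPA.sum_norm_gradient_sq_le hm hN hW.doubly_stochastic hρ hμL ht hyz hbdd (K + 1)
  have h2 := h1.trans (LoPA.initial_lyapunov_le hm hN hμL hρ0 hρ ht
    (hαu.trans (min_le_left _ _)) (LoPA.sq_le_of_le_u₁ hc hμ hτ hα hαu) hD h0)
  have h3 := hu' μ (LoPA.rho W) τ ⟨hμ, hμL, hρ0, hρ, hτ, hτu⟩
  have hκ : 0 < c.kappa μ := zero_lt_one.trans_le (LoPA.Constants.one_le_kappa hμ hμL)
  have hr : 0 < 1 - LoPA.rho W := sub_pos.2 hρ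
  have hK' : (0 : ℝ) < K := by exact_mod_cast hK
  set B := LoPA.initialBound c D
  set s := ∑ k ∈ Finset.range (K + 1), ‖gradient (LoPA.objective f g)
    (LoPA.iter f g W ⟨α, cβ * α, clam * α, cγ * α, τ⟩ S₀ k).xbar‖ ^ 2
  have hs : 0 ≤ s := Finset.sum_nonneg fun _ _ => sq_nonneg _
  set κ := c.kappa μ
  set r := 1 - LoPA.rho W
  have h4 : t₁ / κ ^ 4 * α / 2 * s ≤ κ * B := by
    refine le_trans ?_ h2
    change _ ≤ τ * α / 2 * s
    gcongr
  have h5 : s ≤ 2 * B * κ ^ 5 / (t₁ * α) := by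
    rw [le_div_iff₀ (by positivity)]
    have h6 := mul_le_mul_of_nonneg_left h4 (by positivity : 0 ≤ 2 * κ ^ 4)
    have h7 : 2 * κ ^ 4 * (t₁ / κ ^ 4 * α / 2 * s) = s * (t₁ * α) := by field_simp
    rw [h7] at h6
    linarith
  -- Five powers of κ are present already (one from the initial energy, four from 1/τ). The lower
  -- bound k₀(1-ρ)²/κ³ for u' is inserted and then replaced by u', producing the ratio u'/α and the
  -- remaining κ³/(1-ρ)².
  calc 1 / ((K : ℝ) + 1) * s ≤ 1 / (K : ℝ) * (2 * B * κ ^ 5 / (t₁ * α)) := by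
        refine mul_le_mul (one_div_le_one_div_of_le hK' (by linarith)) h5 hs (by positivity)
    _ = 2 * B / (t₁ * k₀) * (k₀ * (r ^ 2 / κ ^ 3) / α) * (κ ^ 8 / (r ^ 2 * K)) := by
        field_simp
    _ ≤ _ := by gcongr
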